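/- **Theorem 4.7.** Let $\mathcal A$ and $\mathcal B$ be abelian categories and let $F:\mathcal A\to\mathcal B$ be an additive right exact functor. Let $(F,\mathcal B)$ be the left comma category: its objects are triples $\binom{Y}{X}_\phi$ with $Y\in\mathcal A$, $X\in\mathcal B$ and $\phi:FY\to X$ a morphism of $\mathcal B$, and its morphisms are pairs $\binom{\alpha}{\beta}$ with $\beta\phi=\phi' F(\alpha)$; it is abelian. A *complete projective resolution* in an abelian category $\mathcal C$ is an exact sequence $Q^\bullet=(\cdots\to Q^{-1}\to Q^0\to Q^1\to\cdots)$ of projective objects, indexed by $\mathbb Z$, such that $\operatorname{Hom}(Q^\bullet,P)$ is exact for every projective object $P$. An object $G$ is *Gorenstein projective* if $G\cong\operatorname{Im}(Q^{-1}\to Q^0)$ for some such $Q^\bullet$. Write $\mathcal{GP}(\mathcal C)$ for the full subcategory of Gorenstein projective objects and $\underline{\mathcal{GP}(\mathcal C)}$ for its stable category (morphisms modulo those that factor through a projective object), with its standard triangulated structure, in which the distinguished triangles are, up to isomorphism, those induced by the short exact sequences of $\mathcal C$ with all terms Gorenstein projective. Suppose that * $F$ is *perfect*: (P1) if $Q^\bullet$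 is an exact $\mathbb Z$-indexed sequence of projective objects of $\mathcal A$, then $FQ^\bullet$ is exact; (P2) if $P^\bullet$ is a complete projective resolution in $\mathcal B$ and $Q\in\mathcal A$ is projective, then $\operatorname{Hom}(P^\bullet,FQ)$ is exact; * $F$ sends projective objects to projective objects; * $\mathcal B$ is *Gorenstein*: it has enough projective and enough injective objects, the projective dimensions of its injective objects are bounded, and the injective dimensions of its projective objects are bounded. Then there is a recollement of triangulated categories of $\underline{\mathcal{GP}((F,\mathcal B))}$ relative to $\underline{\mathcal{GP}(\mathcal B)}$ and $\underline{\mathcal{GP}(\mathcal A)}$, that is, there are exact functors $$i^*,i^!:\underline{\mathcal{GP}((F,\mathcal B))}\to\underline{\mathcal{GP}(\mathcal B)},\quad i_*:\underline{\mathcal{GP}(\mathcal B)}\to\underline{\mathcal{GP}((F,\mathcal B))},\quad j^*:\underline{\mathcal{GP}((F,\mathcal B))}\to\underline{\mathcal{GP}(\mathcal A)},\quad j_!,j_*:\underline{\mathcal{GP}(\mathcal A)}\to\underline{\mathcal{GP}((F,\mathcal B))}$$ such that $(i^*,i_*)$, $(i_*,i^!)$, $(j_!,j^*)$ and $(j^*,j_*)$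 are adjoint pairs, $i_*$, $j_!$ and $j_*$ are fully faithful, $j^*i_*=0$, and for every object $W$ the units and counits extend to distinguished triangles $$j_!j^*W\to W\to i_*i^*W\to (j_!j^*W)[1],\qquad i_*i^!W\to W\to j_*j^*W\to (i_*i^!W)[1].$$ Moreover, $i^*$, $i_*$, $i^!$, $j_!$ and $j^*$ are induced respectively by the functors $\binom{Y}{X}_\phi\mapsto\operatorname{Coker}\phi$, $X\mapsto\binom{0}{X}$, $\binom{Y}{X}_\phi\mapsto X$, $Y\mapsto\binom{Y}{FY}_{\mathrm{id}}$ and $\binom{Y}{X}_\phi\mapsto Y$, all of which preserve Gorenstein projective objects. For every $Y\in\mathcal{GP}(\mathcal A)$ there is a short exact sequence $0\to FY\xrightarrow{\phi}P\to G\to0$ in $\mathcal B$ with $P$ projective and $G$ Gorenstein projective; for every such sequence $\binom{Y}{P}_\phi$ is Gorenstein projective and is isomorphic to $j_*Y$ in the stable category, naturally with respect to all morphisms between objects $\binom{Y}{P}_\phi$ of this kind. -/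

import Mathlib

open CategoryTheory CategoryTheory.Limits CategoryTheory.Pretriangulated
open scoped ZeroObject

universe v v₁ v₂ v₃ u u₁ u₂ u₃

noncomputable section

namespace GorensteinComma

section GorensteinProjective

variable {C : Type u} [Category.{v} C] [Abelian C]

/-- The complex of abelian groups `Hom(K, X)` is exact: every morphism `K.X n ⟶ X` killed by
the incoming differential factors through the outgoing one. -/
def HomExact (K : CochainComplex C ℤ) (X : C) : Prop :=
  ∀ (n : ℤ) (f : K.X n ⟶ X), K.d (n - 1) n ≫ f = 0 →
    ∃ g : K.X (n + 1) ⟶ X, K.d n (n + 1) ≫ g = f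

/-- A complete projective resolution: an exact `ℤ`-indexed sequence of projective objects which
remains exact under `Hom(-, P)` for every projective object `P`. -/
structure IsCompleteProjectiveResolution (K : CochainComplex C ℤ) : Prop where
  projective : ∀ n : ℤ, Projective (K.X n)
  acyclic : K.Acyclic
  homExact : ∀ P : C, Projective P → HomExact K P

variable (C) in
/-- Gorenstein projective objects, as a property of objects of `C`. -/
def GP : ObjectProperty C := fun G =>
  ∃ K : CochainComplex C ℤ, IsCompleteProjectiveResolution K ∧
    Nonempty (G ≅ Abelian.image (K.d (-1) 0))

lemma GP_of_isZero {Z : C} (hZ : IsZero Z) : GP C Z := by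
  have h0 : IsZero (0 : CochainComplex C ℤ) := isZero_zero _
  have hX : ∀ n, IsZero ((0 : CochainComplex C ℤ).X n) := fun n =>
    (HomologicalComplex.eval C (ComplexShape.up ℤ) n).map_isZero h0
  refine ⟨0, ⟨fun n => ?_, fun n => ?_, fun P _ n f _ => ⟨0, (hX n).eq_of_src _ _⟩⟩,
    ⟨hZ.iso ?_⟩⟩
  · exact ⟨fun f e _ => ⟨0, (hX n).eq_of_src _ _⟩⟩
  · exact ShortComplex.exact_of_isZero_X₂ _ (hX n)
  · exact IsZero.of_mono (Abelian.image.ι _) (hX 0)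

end GorensteinProjective

section Stable

variable (C : Type u) [Category.{v} C] [Abelian C]

/-- Two parallel morphisms between Gorenstein projective objects are identified when their
difference factors through a projective object. -/
def stableRel : HomRel (GP C).FullSubcategory := fun X Y f g =>
  ∃ (P : C) (_ : Projective P) (a : X.obj ⟶ P) (b : P ⟶ Y.obj), f.hom - g.hom = a ≫ b

instance : Congruence (stableRel C) where
  equivalence :=
    { refl := fun f => ⟨0, inferInstance, 0, 0, by simp⟩
      symm := by
        rintro f g ⟨P, hP, a, b, h⟩
        exact ⟨P, hP, -a, b, by rw [Preadditive.neg_comp, ← h, neg_sub]⟩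
      trans := by
        rintro f g k ⟨P, hP, a, b, h⟩ ⟨Q, hQ, c, d, h'⟩
        exact ⟨P ⊞ Q, inferInstance, biprod.lift a c, biprod.desc b d, by
          rw [biprod.lift_desc, ← h, ← h', sub_add_sub_cancel]⟩ }
  comp_left := by
    rintro X Y Z f g g' ⟨P, hP, a, b, h⟩
    exact ⟨P, hP, f.hom ≫ a, b, by
      rw [Category.assoc, ← h, Preadditive.comp_sub]; rfl⟩
  comp_right := by
    rintro X Y Z f f' g ⟨P, hP, a, b, h⟩
    exact ⟨P, hP, a, b ≫ g.hom, by
      rw [← Category.assoc, ← h, Preadditive.sub_comp]; rfl⟩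

lemma stableRel_add ⦃X Y : (GP C).FullSubcategory⦄ (f₁ f₂ g₁ g₂ : X ⟶ Y)
    (hf : stableRel C f₁ f₂) (hg : stableRel C g₁ g₂) :
    stableRel C (f₁ + g₁) (f₂ + g₂) := by
  obtain ⟨P, hP, a, b, h⟩ := hf
  obtain ⟨Q, hQ, c, d, h'⟩ := hg
  refine ⟨P ⊞ Q, inferInstance, biprod.lift a c, biprod.desc b d, ?_⟩
  rw [biprod.lift_desc, ← h, ← h']
  change (f₁.hom + g₁.hom) - (f₂.hom + g₂.hom) = _
  abel

/-- The stable category of Gorenstein projective objects modulo projective objects. -/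
def StableGP : Type u := Quotient (stableRel C)

instance : Category.{v} (StableGP C) := inferInstanceAs (Category (Quotient (stableRel C)))

instance : Preadditive (StableGP C) := Quotient.preadditive (stableRel C) (stableRel_add C)

/-- The canonical functor from Gorenstein projective objects to their stable category. -/
def toStable : (GP C).FullSubcategory ⥤ StableGP C := Quotient.functor (stableRel C)

instance : (toStable C).Additive := Quotient.functor_additive (stableRel C) (stableRel_add C)

instance : HasZeroObject (StableGP C) := by
  refine ⟨(toStable C).obj ⟨0, GP_of_isZero (isZero_zero C)⟩, (IsZero.iff_id_eq_zero _).2 ?_⟩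
  rw [← (toStable C).map_id, ← (toStable C).map_zero]
  congr 1
  exact ObjectProperty.hom_ext _ ((isZero_zero C).eq_of_src _ _)

/-- The triangulated structure of the stable category coming from the Frobenius category of
Gorenstein projective objects. It consists of a shift and a class of distinguished triangles
satisfying the axioms of a triangulated category, together with connecting morphisms
`S.X₃ ⟶ S.X₁⟦1⟧` in the stable category, natural in the short exact sequence `S` of Gorenstein
projective objects, such that the distinguished triangles are exactly those isomorphic to
`S.X₁ ⟶ S.X₂ ⟶ S.X₃ ⟶ S.X₁⟦1⟧` for some `S`. These requirements determine the structure up to a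
canonical isomorphism of shift functors: when `S.X₂` is projective, the connecting morphism
identifies the cosyzygy `S.X₃` with `S.X₁⟦1⟧`, and the other connecting morphisms follow from
these by naturality. -/
class StableTriangulation where
  [shift : HasShift (StableGP C) ℤ]
  [shift_additive : ∀ n : ℤ, (shiftFunctor (StableGP C) n).Additive]
  [pretriangulated : Pretriangulated (StableGP C)]
  [isTriangulated : IsTriangulated (StableGP C)]
  /-- the connecting morphism of a short exact sequence -/
  δ (S : ShortComplex (GP C).FullSubcategory) (hS : (S.map (GP C).ι).ShortExact) :
    (toStable C).obj S.X₃ ⟶ ((toStable C).obj S.X₁)⟦(1 : ℤ)⟧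
  δ_naturality {S S' : ShortComplex (GP C).FullSubcategory}
    (hS : (S.map (GP C).ι).ShortExact) (hS' : (S'.map (GP C).ι).ShortExact) (φ : S ⟶ S') :
    (toStable C).map φ.τ₃ ≫ δ S' hS' = δ S hS ≫ ((toStable C).map φ.τ₁)⟦(1 : ℤ)⟧'
  distinguished_iff (T : Triangle (StableGP C)) :
    T ∈ distTriang (StableGP C) ↔
      ∃ (S : ShortComplex (GP C).FullSubcategory) (hS : (S.map (GP C).ι).ShortExact),
        Nonempty (T ≅ Triangle.mk ((toStable C).map S.f) ((toStable C).map S.g) (δ S hS))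

attribute [reducible, instance] StableTriangulation.shift StableTriangulation.pretriangulated

attribute [instance] StableTriangulation.shift_additive StableTriangulation.isTriangulated

end Stable

section Induced

variable {C : Type u₁} [Category.{v₁} C] [Abelian C] {D : Type u₂} [Category.{v₂} D] [Abelian D]

/-- The restriction of a functor to Gorenstein projective objects, when it preserves them. -/
def restrictGP (φ : C ⥤ D) (h : ∀ X : C, GP C X → GP D (φ.obj X)) :
    (GP C).FullSubcategory ⥤ (GP D).FullSubcategory :=
  (GP D).lift ((GP C).ι ⋙ φ) (fun X => h _ X.property)

/-- `Φ` is the functor between stable categories induced by `φ`: the functor `φ` preserves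
Gorenstein projective objects and `Φ` acts, up to natural isomorphism, by `φ` on objects and
morphisms. -/
def IsInducedBy (Φ : StableGP C ⥤ StableGP D) (φ : C ⥤ D) : Prop :=
  ∃ h : ∀ X : C, GP C X → GP D (φ.obj X),
    Nonempty (toStable C ⋙ Φ ≅ restrictGP φ h ⋙ toStable D)

end Induced

section Recollement

variable (C' : Type u₁) [Category.{v₁} C'] [Preadditive C'] [HasZeroObject C'] [HasShift C' ℤ]
  [∀ n : ℤ, (shiftFunctor C' n).Additive] [Pretriangulated C']
  (C : Type u₂) [Category.{v₂} C] [Preadditive C] [HasZeroObject C] [HasShift C ℤ]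
  [∀ n : ℤ, (shiftFunctor C n).Additive] [Pretriangulated C]
  (C'' : Type u₃) [Category.{v₃} C''] [Preadditive C''] [HasZeroObject C''] [HasShift C'' ℤ]
  [∀ n : ℤ, (shiftFunctor C'' n).Additive] [Pretriangulated C'']

/-- A recollement of `C` relative to `C'` and `C''`; the six functors `i^*`, `i_*`, `i^!`, `j_!`,
`j^*`, `j_*` are exact (triangulated). -/
structure Recollement where
  /-- `i^*` -/
  iUpperStar : C ⥤ C'
  /-- `i_*` -/
  iLowerStar : C' ⥤ C
  /-- `i^!` -/
  iUpperShriek : C ⥤ C'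
  /-- `j_!` -/
  jLowerShriek : C'' ⥤ C
  /-- `j^*` -/
  jUpperStar : C ⥤ C''
  /-- `j_*` -/
  jLowerStar : C'' ⥤ C
  [iUpperStar_commShift : iUpperStar.CommShift ℤ]
  [iLowerStar_commShift : iLowerStar.CommShift ℤ]
  [iUpperShriek_commShift : iUpperShriek.CommShift ℤ]
  [jLowerShriek_commShift : jLowerShriek.CommShift ℤ]
  [jUpperStar_commShift : jUpperStar.CommShift ℤ]
  [jLowerStar_commShift : jLowerStar.CommShift ℤ]
  iUpperStar_isTriangulated : iUpperStar.IsTriangulated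
  iLowerStar_isTriangulated : iLowerStar.IsTriangulated
  iUpperShriek_isTriangulated : iUpperShriek.IsTriangulated
  jLowerShriek_isTriangulated : jLowerShriek.IsTriangulated
  jUpperStar_isTriangulated : jUpperStar.IsTriangulated
  jLowerStar_isTriangulated : jLowerStar.IsTriangulated
  /-- `(i^*, i_*)` is an adjoint pair -/
  adjUpperStarI : iUpperStar ⊣ iLowerStar
  /-- `(i_*, i^!)` is an adjoint pair -/
  adjShriekI : iLowerStar ⊣ iUpperShriek
  /-- `(j_!, j^*)` is an adjoint pair -/
  adjShriekJ : jLowerShriek ⊣ jUpperStar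
  /-- `(j^*, j_*)` is an adjoint pair -/
  adjUpperStarJ : jUpperStar ⊣ jLowerStar
  iLowerStar_full : iLowerStar.Full
  iLowerStar_faithful : iLowerStar.Faithful
  jLowerShriek_full : jLowerShriek.Full
  jLowerShriek_faithful : jLowerShriek.Faithful
  jLowerStar_full : jLowerStar.Full
  jLowerStar_faithful : jLowerStar.Faithful
  jUpperStar_iLowerStar : ∀ X : C', IsZero (jUpperStar.obj (iLowerStar.obj X))
  triangle_jShriek_iStar : ∀ X : C,
    ∃ w : iLowerStar.obj (iUpperStar.obj X) ⟶ (jLowerShriek.obj (jUpperStar.obj X))⟦(1 : ℤ)⟧,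
      Triangle.mk (adjShriekJ.counit.app X) (adjUpperStarI.unit.app X) w ∈ distTriang C
  triangle_iShriek_jStar : ∀ X : C,
    ∃ w : jLowerStar.obj (jUpperStar.obj X) ⟶ (iLowerStar.obj (iUpperShriek.obj X))⟦(1 : ℤ)⟧,
      Triangle.mk (adjShriekI.counit.app X) (adjUpperStarJ.unit.app X) w ∈ distTriang C

end Recollement

section Gorenstein

variable (B : Type u) [Category.{v} B] [Abelian B]

/-- Gorenstein abelian categories: there are enough projectives and injectives, the projective
dimension of the injective objects is bounded and so is the injective dimension of the
projective objects. -/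
structure IsGorenstein : Prop where
  enoughProjectives : EnoughProjectives B
  enoughInjectives : EnoughInjectives B
  projectiveDimension : ∃ n : ℕ, ∀ I : B, Injective I → HasProjectiveDimensionLE I n
  injectiveDimension : ∃ n : ℕ, ∀ P : B, Projective P → HasInjectiveDimensionLE P n

end Gorenstein

section LeftComma

variable {A : Type u₁} [Category.{v₁} A] [Abelian A] {B : Type u₂} [Category.{v₂} B] [Abelian B]

/-- Perfect functors. -/
structure IsPerfect (F : A ⥤ B) [F.Additive] : Prop where
  /-- `F` keeps exact sequences of projective objects exact -/
  acyclic_map : ∀ Q : CochainComplex A ℤ, (∀ n : ℤ, Projective (Q.X n)) → Q.Acyclic →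
    ((F.mapHomologicalComplex (ComplexShape.up ℤ)).obj Q).Acyclic
  /-- complete projective resolutions stay exact under `Hom(-, F Q)` for `Q` projective -/
  homExact : ∀ P : CochainComplex B ℤ, IsCompleteProjectiveResolution P →
    ∀ Q : A, Projective Q → HomExact P (F.obj Q)

/-- The left comma category `(F, B)`: objects are morphisms `F Y ⟶ X`, where `Y` is the component
`left` and `X` is the component `right`. -/
abbrev LeftComma (F : A ⥤ B) := Comma F (𝟭 B)

section Abelian

variable (F : A ⥤ B)

lemma preservesLimitsOfShape_fst (J : Type) [SmallCategory J] [FinCategory J] :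
    PreservesLimitsOfShape J (Comma.fst F (𝟭 B)) where
  preservesLimit :=
    preservesLimit_of_preserves_limit_cone
      (Comma.coneOfPreservesIsLimit _ (limit.isLimit _) (limit.isLimit _))
      (limit.isLimit _)

lemma preservesLimitsOfShape_snd (J : Type) [SmallCategory J] [FinCategory J] :
    PreservesLimitsOfShape J (Comma.snd F (𝟭 B)) where
  preservesLimit :=
    preservesLimit_of_preserves_limit_cone
      (Comma.coneOfPreservesIsLimit _ (limit.isLimit _) (limit.isLimit _))
      (limit.isLimit _)

lemma isIso_of_components {X Y : LeftComma F} (f : X ⟶ Y) (h₁ : IsIso f.left)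
    (h₂ : IsIso f.right) : IsIso f :=
  (Comma.isoMk (asIso f.left) (asIso f.right) f.w).isIso_hom

variable [F.Additive] [PreservesFiniteColimits F]

lemma isIso_coimageImageComparison {X Y : LeftComma F} (f : X ⟶ Y) :
    IsIso (Abelian.coimageImageComparison f) := by
  have := preservesLimitsOfShape_fst F WalkingParallelPair
  have := preservesLimitsOfShape_snd F WalkingParallelPair
  apply isIso_of_components
  · exact ((MorphismProperty.isomorphisms A).arrow_mk_iso_iff
      (Abelian.PreservesCoimageImageComparison.iso (Comma.fst F (𝟭 B)) f)).2
      (inferInstanceAs (IsIso (Abelian.coimageImageComparison _)))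
  · exact ((MorphismProperty.isomorphisms B).arrow_mk_iso_iff
      (Abelian.PreservesCoimageImageComparison.iso (Comma.snd F (𝟭 B)) f)).2
      (inferInstanceAs (IsIso (Abelian.coimageImageComparison _)))

/-- The left comma category of a right exact functor is abelian. -/
instance : Abelian (LeftComma F) :=
  have : ∀ {X Y : LeftComma F} (f : X ⟶ Y), IsIso (Abelian.coimageImageComparison f) :=
    isIso_coimageImageComparison F
  Abelian.ofCoimageImageComparisonIsIso

end Abelian

variable (F : A ⥤ B)

/-- The functor `(Y, X)_φ ↦ Coker φ`. -/
@[simps]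
def cokerFunctor : LeftComma F ⥤ B where
  obj W := cokernel W.hom
  map {W W'} f := cokernel.map W.hom W'.hom (F.map f.left) f.right f.w.symm

/-- The functor `X ↦ (0, X)`. -/
@[simps]
def zeroLeftFunctor : B ⥤ LeftComma F where
  obj X := { left := 0, right := X, hom := 0 }
  map f := { left := 0, right := f }

/-- The functor `Y ↦ (Y, F Y)` with the identity as structure morphism. -/
@[simps]
def freeFunctor : A ⥤ LeftComma F where
  obj Y := { left := Y, right := F.obj Y, hom := 𝟙 _ }
  map f := { left := f, right := F.map f }

/-- The objects `(Y, P)_φ` of the left comma category for which `Y` is Gorenstein projective and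
`φ` fits in a short exact sequence `0 ⟶ F Y ⟶ P ⟶ G ⟶ 0` with `P` projective and `G` Gorenstein
projective. -/
def IsProjectiveCopresentation : ObjectProperty (LeftComma F) := fun W =>
  GP A W.left ∧ Mono W.hom ∧ Projective W.right ∧ GP B (cokernel W.hom)

/-- The functor `(Y, P)_φ ↦ Y` on the objects of `IsProjectiveCopresentation`. -/
def copresentationLeft :
    (IsProjectiveCopresentation F).FullSubcategory ⥤ (GP A).FullSubcategory :=
  (GP A).lift ((IsProjectiveCopresentation F).ι ⋙ Comma.fst F (𝟭 B)) (fun W => W.property.1)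

variable [F.Additive] [PreservesFiniteColimits F]

/-- `Ψ` sends a Gorenstein projective object `Y` to `(Y, P)_φ` for any short exact sequence
`0 ⟶ F Y ⟶ P ⟶ G ⟶ 0` with `P` projective and `G` Gorenstein projective, and a morphism `g` to any
morphism of the comma category with first component `g`: such sequences exist for every `Y`, all
these `(Y, P)_φ` are Gorenstein projective, and `(Y, P)_φ ≅ Ψ Y` in the stable category,
naturally in `(Y, P)_φ`. -/
def IsGivenByCopresentations (Ψ : StableGP A ⥤ StableGP (LeftComma F)) : Prop :=
  (∀ Y : A, GP A Y → ∃ (P : B) (φ : F.obj Y ⟶ P),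
    IsProjectiveCopresentation F { left := Y, right := P, hom := φ }) ∧
  ∃ h : IsProjectiveCopresentation F ≤ GP (LeftComma F),
    Nonempty (copresentationLeft F ⋙ toStable A ⋙ Ψ ≅
      ObjectProperty.ιOfLE h ⋙ toStable (LeftComma F))

end LeftComma

end GorensteinComma

end

open GorensteinComma

noncomputable section

namespace GorensteinComma

/-! The engine is an explicit model of the stable category. Taking cycles in degree 0 gives an
equivalence `stableCycles` from the homotopy category `Tac C` of complete projective resolutions to
`StableGP C`. Hom-exactness and projectivity let a morphism of cycles spread to a chain map in both
directions (`IsCompleteProjectiveResolution.exists_hom`), and a difference of chain maps factors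
through a projective on cycles exactly when it is null-homotopic (`toStable_map_cycMap_eq_iff`).
Since `Tac C` is a triangulated subcategory of the homotopy category, its structure can be
transported. Every short exact sequence of Gorenstein projectives consists of the cycles of a
degreewise split extension `twist ψ` (`exists_iso_cycles_twist`), and this identifies the
transported triangles with those of short exact sequences.

An additive functor that preserves epimorphisms and complete projective resolutions commutes with
taking cycles (`isIso_mapCyclesHom`). If it also preserves projectives, it induces a stable functor
that corresponds to a functor between the `Tac` categories and is therefore triangulated.
Adjunctions descend as well. So five of the six functors reduce to preservation of complete
resolutions. For the functors to $(0,X)$, $(Y,FY)$ and $\operatorname{Coker}\phi$, Hom-exactness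
follows by adjunction, and perfectness supplies acyclicity for the last two. For the second
projection it is automatic, because over a Gorenstein category every acyclic complex of projectives
is complete. The first projection needs a separate argument (`fst_preservesCompleteResolutions`): a
cocycle is first extended to the comma category and corrected there.

The key fact on objects is that $\phi$ is a monomorphism when $(Y,X)_\phi$ is Gorenstein projective
(`mono_hom_of_GP`). Then $0\to(Y,FY)\to(Y,X)\to(0,\operatorname{Coker}\phi)\to0$ is exact and gives
the first triangle. Embedding $X$ in a projective $P$ with Gorenstein projective cokernel gives
$0\to(0,X)\to(Y,X)\oplus(0,P)\to(Y,P)\to0$ and the second triangle. Its last term is a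
copresentation, and stable morphisms from any $W$ to a copresentation over $Y'$ are the same as
stable morphisms from the first component of $W$ to $Y'$ (`stableFst_bijective`). Hence
copresentations are the values of the right adjoint $j_*$, which is triangulated as an adjoint of a
triangulated functor. -/

lemma exists_int_family {α : ℤ → Type*} (R : ∀ n, α n → α (n + 1) → Prop) (m : ℤ) (x₀ : α m)
    (hr : ∀ n (x : α n), ∃ y, R n x y) (hl : ∀ n (y : α (n + 1)), ∃ x, R n x y) :
    ∃ f : ∀ n, α n, f m = x₀ ∧ ∀ n, R n (f n) (f (n + 1)) := by
  classical
  choose r hr using hr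
  choose l hl using hl
  -- The family is built outwards from `m`: `r` chooses successors above it and `l` predecessors
  -- below it. The cast is needed because `k - 1 + 1` equals `k` only propositionally.
  refine ⟨fun n => Int.inductionOn' (motive := α) n m x₀ (fun k _ x => r k x)
    (fun k _ x => l (k - 1) (cast (by rw [sub_add_cancel]) x)), ?_, fun n => ?_⟩
  · simp [Int.inductionOn'_self]
  · by_cases h : m ≤ n
    · dsimp only
      rw [Int.inductionOn'_add_one h]
      exact hr _ _
    · obtain ⟨k, rfl⟩ : ∃ k, n = k - 1 := ⟨n + 1, by lia⟩
      dsimp only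
      rw [Int.inductionOn'_sub_one (by lia)]
      convert hl (k - 1) _
      rw [eq_cast_iff_heq]
      congr 1
      all_goals simp

/-! ### Cycles of acyclic complexes and of complete projective resolutions. -/

section Complex

variable {C : Type u} [Category.{v} C] [Abelian C] {K L : CochainComplex C ℤ}

open HomologicalComplex

lemma acyclic_epi_toCycles (hK : K.Acyclic) (i j : ℤ) (hij : i + 1 = j) :
    Epi (K.toCycles i j) := by
  have := hK j
  obtain rfl : i = (ComplexShape.up ℤ).prev j := by simp; lia
  exact (ShortComplex.exact_iff_epi_toCycles _).1 this

/-- The short complex `Z ⟶ K ⟶ Z` formed by the cycles of a complex. -/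
def cyclesShortComplex (K : CochainComplex C ℤ) (i j : ℤ) : ShortComplex C where
  X₁ := K.cycles i
  X₂ := K.X i
  X₃ := K.cycles j
  f := K.iCycles i
  g := K.toCycles i j
  zero := by rw [← cancel_mono (K.iCycles j)]; simp

lemma cyclesShortComplex_shortExact (hK : K.Acyclic) (i j : ℤ) (hij : i + 1 = j) :
    (cyclesShortComplex K i j).ShortExact where
  exact := by
    rw [ShortComplex.exact_iff_exact_up_to_refinements]
    intro A x hx
    let y : A ⟶ K.X i := x
    have hy : y ≫ K.toCycles i j = 0 := hx
    have hy' : y ≫ K.d i j = 0 := by rw [← toCycles_i, reassoc_of% hy, zero_comp]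
    exact ⟨A, 𝟙 _, inferInstance, K.liftCycles y j (by simp [hij]) hy',
      (Category.id_comp y).trans (K.liftCycles_i y j (by simp [hij]) hy').symm⟩
  mono_f := inferInstanceAs (Mono (K.iCycles i))
  epi_g := acyclic_epi_toCycles hK i j hij

/-- A morphism killed by the cycles factors through the next cycles. -/
lemma acyclic_exists_desc (hK : K.Acyclic) (i j : ℤ) (hij : i + 1 = j) {X : C} (f : K.X i ⟶ X)
    (hf : K.iCycles i ≫ f = 0) : ∃ g : K.cycles j ⟶ X, K.toCycles i j ≫ g = f := by
  have hS := cyclesShortComplex_shortExact hK i j hij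
  have := hS.epi_g
  exact ⟨hS.exact.desc f hf, hS.exact.g_desc f hf⟩

lemma acyclic_exists_lift (hK : K.Acyclic) (i j : ℤ) (hij : i + 1 = j) {P : C} [Projective P]
    (f : P ⟶ K.cycles j) : ∃ g : P ⟶ K.X i, g ≫ K.toCycles i j = f := by
  have := acyclic_epi_toCycles hK i j hij
  exact ⟨Projective.factorThru f (K.toCycles i j), by simp⟩

lemma HomExact.exists_desc {X : C} (h : HomExact K X) (i j k : ℤ) (hij : i + 1 = j)
    (hjk : j + 1 = k) (f : K.X j ⟶ X) (hf : K.d i j ≫ f = 0) :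
    ∃ g : K.X k ⟶ X, K.d j k ≫ g = f := by
  obtain rfl := hjk
  obtain rfl : i = j - 1 := by lia
  exact h j f hf

/-- The previous term surjects onto the cycles; the pullback of `f` to it is killed by the incoming
differential, so Hom-exactness applies. -/
lemma HomExact.exists_extension {X : C} (h : HomExact K X) (hK : K.Acyclic) (n : ℤ)
    (f : K.cycles n ⟶ X) : ∃ g : K.X n ⟶ X, K.iCycles n ≫ g = f := by
  obtain ⟨m, rfl⟩ : ∃ m, n = m + 1 := ⟨n - 1, by lia⟩
  have := acyclic_epi_toCycles hK m (m + 1) rfl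
  obtain ⟨g, hg⟩ := h m (K.toCycles m (m + 1) ≫ f) (by simp)
  refine ⟨g, ?_⟩
  rw [← cancel_epi (K.toCycles m (m + 1)), ← hg]
  simp

/-- By acyclicity the differential factors as an epimorphism onto the cycles followed by their
inclusion, so the cycles are its image. -/
lemma GP_iff (G : C) : GP C G ↔ ∃ K : CochainComplex C ℤ,
    IsCompleteProjectiveResolution K ∧ Nonempty (G ≅ K.cycles 0) := by
  have key : ∀ K : CochainComplex C ℤ, K.Acyclic →
      Nonempty (Abelian.image (K.d (-1) 0) ≅ K.cycles 0) := fun K hK => by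
    have := acyclic_epi_toCycles hK (-1) 0 rfl
    have h : K.toCycles (-1) 0 ≫ K.iCycles 0 = K.d (-1) 0 := by simp
    have := strongEpi_of_epi (K.toCycles (-1) 0)
    exact ⟨(Abelian.imageIsoImage _) ≪≫ (image.isoStrongEpiMono _ _ h).symm⟩
  exact ⟨fun ⟨K, hK, ⟨e⟩⟩ => ⟨K, hK, ⟨e ≪≫ (key K hK.acyclic).some⟩⟩,
    fun ⟨K, hK, ⟨e⟩⟩ => ⟨K, hK, ⟨e ≪≫ (key K hK.acyclic).some.symm⟩⟩⟩

instance GP_isClosedUnderIsomorphisms : (GP C).IsClosedUnderIsomorphisms where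
  of_iso := fun e ⟨K, hK, ⟨e'⟩⟩ => ⟨K, hK, ⟨e.symm ≪≫ e'⟩⟩

/-- Shifting changes the differential only by a sign, which is moved onto the factoring morphism. -/
lemma HomExact.shift {X : C} (h : HomExact K X) (n : ℤ) : HomExact (K⟦n⟧) X := by
  intro m f hf
  let f' : K.X (m + n) ⟶ X := f
  have hf' : (n.negOnePow • K.d (m - 1 + n) (m + n)) ≫ f' = 0 := hf
  rw [Linear.units_smul_comp, smul_eq_zero_iff_eq] at hf'
  obtain ⟨g, hg⟩ := h.exists_desc (m - 1 + n) (m + n) (m + 1 + n) (by lia) (by lia) f' hf'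
  refine ⟨n.negOnePow • g, ?_⟩
  change (n.negOnePow • K.d (m + n) (m + 1 + n)) ≫ (n.negOnePow • g) = f'
  rw [Linear.units_smul_comp, Linear.comp_units_smul, smul_smul, Int.units_mul_self, one_smul, hg]

lemma IsCompleteProjectiveResolution.shift (hK : IsCompleteProjectiveResolution K) (n : ℤ) :
    IsCompleteProjectiveResolution (K⟦n⟧) where
  projective m := hK.projective _
  acyclic := by
    rw [← HomotopyCategory.quotient_obj_mem_subcategoryAcyclic_iff_acyclic,
      ← HomotopyCategory.shift_quotient_obj]
    exact (HomotopyCategory.subcategoryAcyclic C).le_shift n _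
      ((HomotopyCategory.quotient_obj_mem_subcategoryAcyclic_iff_acyclic K).2 hK.acyclic)
  homExact P hP := (hK.homExact P hP).shift n

lemma iCycles_shift_comp_d (K : CochainComplex C ℤ) (n i : ℤ) :
    (K.iCycles (i + n) ≫ (CochainComplex.shiftFunctorObjXIso K n i _ rfl).inv) ≫
      (K⟦n⟧).d i (i + 1) = 0 := by
  have h : K.iCycles (i + n) ≫ (n.negOnePow • K.d (i + n) (i + 1 + n)) = 0 := by
    rw [Linear.comp_units_smul, K.iCycles_d, smul_zero]
  exact (congrArg (fun t => t ≫ (K⟦n⟧).d i (i + 1)) (Category.comp_id _)).trans h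

/-- The cycles of a shifted complex. -/
def cyclesShiftIso (K : CochainComplex C ℤ) (n i : ℤ) : (K⟦n⟧).cycles i ≅ K.cycles (i + n) :=
  have h₁ : ((K⟦n⟧).iCycles i ≫ (CochainComplex.shiftFunctorObjXIso K n i _ rfl).hom) ≫
      K.d (i + n) (i + 1 + n) = 0 := by
    let ι : (K⟦n⟧).cycles i ⟶ K.X (i + n) := (K⟦n⟧).iCycles i
    have h : ι ≫ (n.negOnePow • K.d (i + n) (i + 1 + n)) = 0 :=
      (K⟦n⟧).iCycles_d i (i + 1)
    rw [Linear.comp_units_smul, smul_eq_zero_iff_eq] at h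
    rw [← h]
    exact congrArg (fun t => t ≫ _) (Category.comp_id _)
  have h₂ := iCycles_shift_comp_d K n i
  { hom := K.liftCycles _ (i + 1 + n) (by simp; lia) h₁
    inv := (K⟦n⟧).liftCycles _ (i + 1) (by simp) h₂
    hom_inv_id := by
      rw [← cancel_mono ((K⟦n⟧).iCycles i)]
      simp only [Category.assoc, liftCycles_i, liftCycles_i_assoc,
        Iso.hom_inv_id, Category.comp_id, Category.id_comp]
    inv_hom_id := by
      rw [← cancel_mono (K.iCycles (i + n))]
      simp only [Category.assoc, liftCycles_i, liftCycles_i_assoc,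
        Iso.inv_hom_id, Category.comp_id, Category.id_comp] }

lemma IsCompleteProjectiveResolution.GP_cycles (hK : IsCompleteProjectiveResolution K) (n : ℤ) :
    GP C (K.cycles n) := by
  rw [GP_iff]
  exact ⟨K⟦n⟧, hK.shift n, ⟨(eqToIso (by simp)) ≪≫ (cyclesShiftIso K n 0).symm⟩⟩

/-- Morphisms to projective objects extend along monomorphisms with Gorenstein projective
cokernel. -/
lemma GP.exists_extension {S : ShortComplex C} (hS : S.ShortExact) (h₃ : GP C S.X₃) {P : C}
    [Projective P] (f : S.X₁ ⟶ P) : ∃ g : S.X₂ ⟶ P, S.f ≫ g = f := by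
  obtain ⟨K, hK, ⟨e⟩⟩ := (GP_iff _).1 h₃
  have := hK.projective (-1)
  have := hS.mono_f
  have := hS.epi_g
  have := acyclic_epi_toCycles hK.acyclic (-1) 0 rfl
  let π : K.X (-1) ⟶ S.X₃ := K.toCycles (-1) 0 ≫ e.inv
  let ℓ : K.X (-1) ⟶ S.X₂ := Projective.factorThru π S.g
  have hℓ : ℓ ≫ S.g = π := by simp [ℓ]
  have hπ : K.iCycles (-1) ≫ π = 0 := by
    have : K.iCycles (-1) ≫ K.toCycles (-1) 0 = 0 := by
      rw [← cancel_mono (K.iCycles 0)]; simp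
    simp [π, reassoc_of% this]
  let m : K.cycles (-1) ⟶ S.X₁ := hS.exact.lift (K.iCycles (-1) ≫ ℓ) (by simp [hℓ, hπ])
  have hm : m ≫ S.f = K.iCycles (-1) ≫ ℓ := hS.exact.lift_f _ _
  obtain ⟨u, hu⟩ := (hK.homExact P inferInstance).exists_extension hK.acyclic (-1) (m ≫ f)
  -- The middle object is the pushout of `S.X₁` and `K.X (-1)` over the cycles in degree -1. Hence
  -- `f` extends to it as soon as `m ≫ f` extends to `K.X (-1)`, and `u` is such an extension. This
  -- is the vanishing of the first Ext group in elementary form.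
  let T : ShortComplex C := ShortComplex.mk (biprod.lift m (-K.iCycles (-1)))
    (biprod.desc S.f ℓ) (by simp [hm])
  have hT : T.Exact := by
    rw [ShortComplex.exact_iff_exact_up_to_refinements]
    intro A x hx
    have hx' : (x ≫ biprod.fst) ≫ S.f + (x ≫ biprod.snd) ≫ ℓ = 0 := by
      rw [← hx]; simp [T, biprod.desc_eq]
    have h1 : (x ≫ biprod.snd) ≫ π = 0 := by
      have := hx' =≫ S.g
      simpa [hℓ] using this
    have h2 : (x ≫ biprod.snd) ≫ K.d (-1) 0 = 0 := by
      have := h1 =≫ (e.hom ≫ K.iCycles 0)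
      simpa [π] using this
    refine ⟨A, 𝟙 _, inferInstance, -K.liftCycles (x ≫ biprod.snd) 0 (by simp) h2, ?_⟩
    rw [Category.id_comp]
    apply biprod.hom_ext
    · rw [← cancel_mono S.f]
      simp only [T, Preadditive.neg_comp, Category.assoc, biprod.lift_fst, hm, liftCycles_i_assoc]
      simpa [add_eq_zero_iff_eq_neg] using hx'
    · simp [T]
  have : Epi T.g := by
    refine (Preadditive.epi_iff_cancel_zero _).2 fun Z g hg => ?_
    have h1 : S.f ≫ g = 0 := by simpa [T] using biprod.inl ≫= hg
    have h2 : ℓ ≫ g = 0 := by simpa [T] using biprod.inr ≫= hg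
    have h3 := hS.exact.g_desc g h1
    have h4 : π ≫ hS.exact.desc g h1 = 0 := by rw [← hℓ, Category.assoc, h3, h2]
    have : Epi π := by dsimp only [π]; infer_instance
    rw [← h3, (cancel_epi π).1 (h4.trans comp_zero.symm), comp_zero]
  refine ⟨hT.desc (biprod.desc f u) (by simp [T, hu]), ?_⟩
  have h := hT.g_desc (biprod.desc f u) (by simp [T, hu])
  have := biprod.inl ≫= h
  simpa [T] using this

end Complex


/-! ### Lifting morphisms of cycles to chain maps and homotopies. -/

section ChainMaps

variable {C : Type u} [Category.{v} C] [Abelian C] {K L : CochainComplex C ℤ}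

open HomologicalComplex

/-- A morphism between cycles of complete projective resolutions lifts to a chain map. -/
lemma IsCompleteProjectiveResolution.exists_hom (hK : IsCompleteProjectiveResolution K)
    (hL : IsCompleteProjectiveResolution L) (m : ℤ) (h : K.cycles m ⟶ L.cycles m) :
    ∃ f : K ⟶ L, cyclesMap f m = h := by
  -- The recursion runs over morphisms of cycles, each link being a component compatible with two
  -- consecutive ones. Upwards the component comes from Hom-exactness into projectives, downwards
  -- from lifting along the epimorphism onto the cycles of `L`.
  obtain ⟨φ, hφ, H⟩ := exists_int_family (α := fun n => (K.cycles n ⟶ L.cycles n))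
    (fun n a b => ∃ g : K.X n ⟶ L.X n, K.iCycles n ≫ g = a ≫ L.iCycles n ∧
      g ≫ L.toCycles n (n + 1) = K.toCycles n (n + 1) ≫ b) m h
    (fun n a => by
      obtain ⟨g, hg⟩ := (hK.homExact _ (hL.projective n)).exists_extension hK.acyclic n
        (a ≫ L.iCycles n)
      obtain ⟨b, hb⟩ := acyclic_exists_desc hK.acyclic n (n + 1) rfl (g ≫ L.toCycles n (n + 1)) (by
        rw [← cancel_mono (L.iCycles (n + 1))]; simp [reassoc_of% hg])
      exact ⟨b, g, hg, hb.symm⟩)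
    (fun n b => by
      have := hK.projective n
      obtain ⟨g, hg⟩ := acyclic_exists_lift hL.acyclic n (n + 1) rfl (K.toCycles n (n + 1) ≫ b)
      have hg' : (K.iCycles n ≫ g) ≫ L.d n (n + 1) = 0 := by
        have h1 : K.iCycles n ≫ K.toCycles n (n + 1) = 0 := by
          rw [← cancel_mono (K.iCycles (n + 1))]; simp
        rw [← L.toCycles_i, Category.assoc, reassoc_of% hg, reassoc_of% h1, zero_comp]
      exact ⟨L.liftCycles _ (n + 1) (by simp) hg', g, by simp, hg⟩)
  choose g hg hg' using H
  let f : K ⟶ L :=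
    { f := g
      comm' := fun i j hij => by
        obtain rfl : i + 1 = j := hij
        rw [← L.toCycles_i, reassoc_of% (hg' i), ← hg, toCycles_i_assoc] }
  refine ⟨f, ?_⟩
  rw [← cancel_mono (L.iCycles m), cyclesMap_i]
  simp [f, hg, hφ]

/-- A chain map between complete projective resolutions is null-homotopic if it factors through
the previous term on the cycles in a single degree. -/
lemma IsCompleteProjectiveResolution.nonempty_homotopy (hK : IsCompleteProjectiveResolution K)
    (hL : IsCompleteProjectiveResolution L) (f : K ⟶ L) (m : ℤ) (s : K.X (m + 1) ⟶ L.X m)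
    (hs : K.iCycles (m + 1) ≫ s ≫ L.d m (m + 1) = K.iCycles (m + 1) ≫ f.f (m + 1)) :
    Nonempty (Homotopy f 0) := by
  -- The homotopy condition in one degree involves two consecutive components. What a single
  -- component must satisfy is that it agrees with `f` on cycles after the differential. This makes
  -- the error descend to the next cycles, so that the next component exists; downwards, the error
  -- lands in the cycles of `L` and is lifted.
  obtain ⟨σ, -, H⟩ := exists_int_family
    (α := fun n => { s : K.X (n + 1) ⟶ L.X n //
      K.iCycles (n + 1) ≫ s ≫ L.d n (n + 1) = K.iCycles (n + 1) ≫ f.f (n + 1) })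
    (fun n s t => f.f (n + 1) = s.1 ≫ L.d n (n + 1) + K.d (n + 1) (n + 1 + 1) ≫ t.1) m ⟨s, hs⟩
    (fun n s => by
      obtain ⟨g, hg⟩ := acyclic_exists_desc hK.acyclic (n + 1) (n + 1 + 1) rfl
        (f.f (n + 1) - s.1 ≫ L.d n (n + 1)) (by rw [Preadditive.comp_sub, s.2, sub_self])
      obtain ⟨t, ht⟩ := (hK.homExact _ (hL.projective (n + 1))).exists_extension hK.acyclic _ g
      have ht' : K.d (n + 1) (n + 1 + 1) ≫ t = f.f (n + 1) - s.1 ≫ L.d n (n + 1) := by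
        rw [← hg, ← ht, toCycles_i_assoc]
      have := acyclic_epi_toCycles hK.acyclic (n + 1) (n + 1 + 1) rfl
      refine ⟨⟨t, ?_⟩, by simp [ht']⟩
      rw [← cancel_epi (K.toCycles (n + 1) (n + 1 + 1))]
      simp [reassoc_of% ht'])
    (fun n t => by
      have := hK.projective (n + 1)
      have h0 : (f.f (n + 1) - K.d (n + 1) (n + 1 + 1) ≫ t.1) ≫ L.d (n + 1) (n + 1 + 1) = 0 := by
        have := K.toCycles (n + 1) (n + 1 + 1) ≫= t.2
        simp only [toCycles_i_assoc] at this
        simp [this]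
      obtain ⟨s, hs⟩ := acyclic_exists_lift hL.acyclic n (n + 1) rfl
        (L.liftCycles _ (n + 1 + 1) (by simp) h0)
      have hs' : s ≫ L.d n (n + 1) = f.f (n + 1) - K.d (n + 1) (n + 1 + 1) ≫ t.1 := by
        rw [← L.toCycles_i, reassoc_of% hs, liftCycles_i]
      exact ⟨⟨s, by simp [hs']⟩, by simp [hs']⟩)
  let h : ∀ i j, (ComplexShape.up ℤ).Rel j i → (K.X i ⟶ L.X j) :=
    fun i j hij => (K.XIsoOfEq (show i = j + 1 from hij.symm)).hom ≫ (σ j).1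
  refine ⟨(Homotopy.ofEq ?_).trans (Homotopy.nullHomotopy' h)⟩
  ext n
  obtain ⟨p, rfl⟩ : ∃ p, n = p + 1 := ⟨n - 1, by lia⟩
  rw [Homotopy.nullHomotopicMap'_f (k₂ := p) (k₁ := p + 1) (k₀ := p + 1 + 1) rfl rfl, H p]
  simp [h, add_comm]

/-- The projection of a term of a complex onto the cycles of degree `0` of its shift; the sign is
that of the connecting morphism of a degreewise split short exact sequence. -/
def toCyclesShift (K : CochainComplex C ℤ) : K.X 0 ⟶ (K⟦(1 : ℤ)⟧).cycles 0 :=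
  -K.toCycles 0 (0 + 1) ≫ (cyclesShiftIso K 1 0).inv

end ChainMaps


/-! ### Degreewise split extensions and the twist by a morphism to the shift. -/

section DegreewiseSplit

variable {C : Type u} [Category.{v} C] [Abelian C]

open HomologicalComplex CochainComplex

lemma exists_degreewise_retraction {S : ShortComplex (CochainComplex C ℤ)}
    (σ : ∀ n, (S.map (eval C _ n)).Splitting) :
    ∃ (r : ∀ n, S.X₂.X n ⟶ S.X₁.X n) (s : ∀ n, S.X₃.X n ⟶ S.X₂.X n),
      (∀ n, S.f.f n ≫ r n = 𝟙 _) ∧ (∀ n, s n ≫ S.g.f n = 𝟙 _) ∧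
      (∀ n, r n ≫ S.f.f n + S.g.f n ≫ s n = 𝟙 _) :=
  ⟨fun n => (σ n).r, fun n => (σ n).s, fun n => (σ n).f_r, fun n => (σ n).s_g, fun n => (σ n).id⟩

/-- Subtracting a coboundary makes the cocycle vanish on `S.X₁`; what is left descends to `S.X₃`,
where exactness applies again. -/
lemma HomExact.of_degreewiseSplit {S : ShortComplex (CochainComplex C ℤ)}
    (σ : ∀ n, (S.map (eval C _ n)).Splitting) {X : C} (h₁ : HomExact S.X₁ X)
    (h₃ : HomExact S.X₃ X) : HomExact S.X₂ X := by
  obtain ⟨r, s, f_r, s_g, hid⟩ := exists_degreewise_retraction σ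
  intro n φ hφ
  obtain ⟨b, hb⟩ := h₁ n (S.f.f n ≫ φ) (by rw [← S.f.comm_assoc, hφ, comp_zero])
  let φ' : S.X₂.X n ⟶ X := φ - S.X₂.d n (n + 1) ≫ r (n + 1) ≫ b
  have h1 : S.f.f n ≫ φ' = 0 := by
    rw [Preadditive.comp_sub, S.f.comm_assoc, reassoc_of% (f_r (n + 1)), hb, sub_self]
  have h2 : S.g.f n ≫ s n ≫ φ' = φ' := by
    have := hid n =≫ φ'
    rw [Preadditive.add_comp, Category.assoc, h1, comp_zero, zero_add] at this
    simpa using this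
  obtain ⟨m, hm⟩ := h₃ n (s n ≫ φ') (by
    have : Epi (S.g.f (n - 1)) := epi_of_epi_fac (s_g (n - 1))
    rw [← cancel_epi (S.g.f (n - 1)), S.g.comm_assoc, h2]
    simp [φ', hφ])
  refine ⟨r (n + 1) ≫ b + S.g.f (n + 1) ≫ m, ?_⟩
  rw [Preadditive.comp_add, ← S.g.comm_assoc, hm, h2]
  simp [φ']

lemma Acyclic.of_degreewiseSplit {S : ShortComplex (CochainComplex C ℤ)}
    (σ : ∀ n, (S.map (eval C _ n)).Splitting) (h₁ : S.X₁.Acyclic) (h₃ : S.X₃.Acyclic) :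
    S.X₂.Acyclic := by
  simp only [← HomotopyCategory.quotient_obj_mem_subcategoryAcyclic_iff_acyclic] at h₁ h₃ ⊢
  exact (HomotopyCategory.subcategoryAcyclic C).ext_of_isTriangulatedClosed₂ _
    ((HomotopyCategory.distinguished_iff_iso_trianglehOfDegreewiseSplit _).2
      ⟨S, σ, ⟨Iso.refl _⟩⟩) h₁ h₃

lemma IsCompleteProjectiveResolution.of_degreewiseSplit {S : ShortComplex (CochainComplex C ℤ)}
    (σ : ∀ n, (S.map (eval C _ n)).Splitting) (h₁ : IsCompleteProjectiveResolution S.X₁)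
    (h₃ : IsCompleteProjectiveResolution S.X₃) : IsCompleteProjectiveResolution S.X₂ where
  projective n := by
    have := h₁.projective n
    have := h₃.projective n
    obtain ⟨r, s, -, -, hid⟩ := exists_degreewise_retraction σ
    exact Retract.projective (Y := S.X₁.X n ⊞ S.X₃.X n)
      { i := biprod.lift (r n) (S.g.f n)
        r := biprod.desc (S.f.f n) (s n)
        retract := (biprod.lift_desc ..).trans (hid n) }
  acyclic := Acyclic.of_degreewiseSplit σ h₁.acyclic h₃.acyclic
  homExact P hP := HomExact.of_degreewiseSplit σ (h₁.homExact P hP) (h₃.homExact P hP)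

variable {K M : CochainComplex C ℤ} (ψ : M ⟶ K⟦(1 : ℤ)⟧)

/-- The components of a morphism `M ⟶ K⟦1⟧`. -/
def shiftComp (i j : ℤ) (hij : i + 1 = j) : M.X i ⟶ K.X j :=
  ψ.f i ≫ (shiftFunctorObjXIso K 1 i j hij.symm).hom

lemma shiftComp_rfl (i : ℤ) : shiftComp ψ i (i + 1) rfl = ψ.f i := Category.comp_id _

/-- The minus sign comes from the differential of the shift; it is what makes the differential of
`twist` square to zero. -/
lemma shiftComp_d (i j k : ℤ) (hij : i + 1 = j) (hjk : j + 1 = k) :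
    shiftComp ψ i j hij ≫ K.d j k = -M.d i j ≫ shiftComp ψ j k hjk := by
  subst hij hjk
  have h : shiftComp ψ i (i + 1) rfl ≫ ((1 : ℤ).negOnePow • K.d (i + 1) (i + 1 + 1)) =
      M.d i (i + 1) ≫ shiftComp ψ (i + 1) (i + 1 + 1) rfl := by
    rw [shiftComp_rfl, shiftComp_rfl]
    exact ψ.comm i (i + 1)
  rw [← h]
  simp

/-- The extension of `M` by `K` attached to a morphism `M ⟶ K⟦1⟧`. -/
def twist : CochainComplex C ℤ where
  X n := K.X n ⊞ M.X n
  d i j := if hij : i + 1 = j then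
    biprod.desc (K.d i j ≫ biprod.inl) (shiftComp ψ i j hij ≫ biprod.inl + M.d i j ≫ biprod.inr)
    else 0
  shape i j hij := dif_neg hij
  d_comp_d' i j k hij hjk := by
    rw [dif_pos (show i + 1 = j from hij), dif_pos (show j + 1 = k from hjk)]
    ext <;> simp [shiftComp_d ψ i j k hij hjk]

namespace twist

/-- The inclusion of `K`. -/
def inl (n : ℤ) : K.X n ⟶ (twist ψ).X n := biprod.inl (X := K.X n) (Y := M.X n)

/-- The degreewise inclusion of `M`. -/
def inr (n : ℤ) : M.X n ⟶ (twist ψ).X n := biprod.inr (X := K.X n) (Y := M.X n)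

/-- The degreewise projection onto `K`. -/
def fst (n : ℤ) : (twist ψ).X n ⟶ K.X n := biprod.fst (X := K.X n) (Y := M.X n)

/-- The projection onto `M`. -/
def snd (n : ℤ) : (twist ψ).X n ⟶ M.X n := biprod.snd (X := K.X n) (Y := M.X n)

@[simp]
lemma inl_fst (n : ℤ) : inl ψ n ≫ fst ψ n = 𝟙 _ := biprod.inl_fst

lemma inl_fst_assoc (n : ℤ) {X : C} (f : _ ⟶ X) :
    inl ψ n ≫ fst ψ n ≫ f = f := by
  rw [← Category.assoc, inl_fst, Category.id_comp]

@[simp]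
lemma inr_snd (n : ℤ) : inr ψ n ≫ snd ψ n = 𝟙 _ := biprod.inr_snd

lemma inr_snd_assoc (n : ℤ) {X : C} (f : _ ⟶ X) :
    inr ψ n ≫ snd ψ n ≫ f = f := by
  rw [← Category.assoc, inr_snd, Category.id_comp]

@[simp]
lemma inl_snd (n : ℤ) : inl ψ n ≫ snd ψ n = 0 := biprod.inl_snd

lemma inl_snd_assoc (n : ℤ) {X : C} (f : _ ⟶ X) :
    inl ψ n ≫ snd ψ n ≫ f = 0 := by
  rw [← Category.assoc, inl_snd, zero_comp]

@[simp]
lemma inr_fst (n : ℤ) : inr ψ n ≫ fst ψ n = 0 := biprod.inr_fst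

lemma inr_fst_assoc (n : ℤ) {X : C} (f : _ ⟶ X) :
    inr ψ n ≫ fst ψ n ≫ f = 0 := by
  rw [← Category.assoc, inr_fst, zero_comp]

lemma total (n : ℤ) : fst ψ n ≫ inl ψ n + snd ψ n ≫ inr ψ n = 𝟙 _ := biprod.total

lemma hom_ext' {n : ℤ} {X : C} {f g : (twist ψ).X n ⟶ X} (h₁ : inl ψ n ≫ f = inl ψ n ≫ g)
    (h₂ : inr ψ n ≫ f = inr ψ n ≫ g) : f = g :=
  biprod.hom_ext' (X := K.X n) (Y := M.X n) _ _ h₁ h₂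

lemma inl_d (i j : ℤ) (hij : i + 1 = j) :
    inl ψ i ≫ (twist ψ).d i j = K.d i j ≫ inl ψ j :=
  (inl ψ i ≫= dif_pos hij).trans (biprod.inl_desc _ _)

lemma inl_d_assoc (i j : ℤ) (hij : i + 1 = j) {X : C} (f : (twist ψ).X j ⟶ X) :
    inl ψ i ≫ (twist ψ).d i j ≫ f = K.d i j ≫ inl ψ j ≫ f := by
  rw [← Category.assoc, inl_d ψ i j hij, Category.assoc]

lemma inr_d (i j : ℤ) (hij : i + 1 = j) :
    inr ψ i ≫ (twist ψ).d i j = shiftComp ψ i j hij ≫ inl ψ j + M.d i j ≫ inr ψ j :=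
  (inr ψ i ≫= dif_pos hij).trans (biprod.inr_desc _ _)

lemma inr_d_assoc (i j : ℤ) (hij : i + 1 = j) {X : C} (f : (twist ψ).X j ⟶ X) :
    inr ψ i ≫ (twist ψ).d i j ≫ f =
      (shiftComp ψ i j hij ≫ inl ψ j + M.d i j ≫ inr ψ j) ≫ f := by
  rw [← Category.assoc, inr_d ψ i j hij]

end twist

/-- The degreewise split short exact sequence attached to a morphism `M ⟶ K⟦1⟧`. -/
def twistShortComplex : ShortComplex (CochainComplex C ℤ) where
  X₁ := K
  X₂ := twist ψ
  X₃ := M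
  f :=
    { f := twist.inl ψ
      comm' := fun i j hij => twist.inl_d ψ i j hij }
  g :=
    { f := twist.snd ψ
      comm' := fun i j hij => by
        apply twist.hom_ext'
        · simp [twist.inl_d_assoc ψ i j hij, twist.inl_snd_assoc]
        · simp [twist.inr_d_assoc ψ i j hij, twist.inr_snd_assoc] }
  zero := by ext n; exact twist.inl_snd ψ n

/-- The splittings of `twistShortComplex`. -/
def twistSplitting (n : ℤ) : ((twistShortComplex ψ).map (eval C _ n)).Splitting where
  r := twist.fst ψ n
  s := twist.inr ψ n
  f_r := twist.inl_fst ψ n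
  s_g := twist.inr_snd ψ n
  id := twist.total ψ n

lemma homOfDegreewiseSplit_twist :
    homOfDegreewiseSplit (twistShortComplex ψ) (twistSplitting ψ) = ψ := by
  ext n
  rw [homOfDegreewiseSplit_f, ← shiftComp_rfl]
  change twist.inr ψ n ≫ (twist ψ).d n (n + 1) ≫ twist.fst ψ (n + 1) = _
  rw [twist.inr_d_assoc ψ n (n + 1) rfl]
  simp

lemma IsCompleteProjectiveResolution.twist (hK : IsCompleteProjectiveResolution K)
    (hM : IsCompleteProjectiveResolution M) : IsCompleteProjectiveResolution (twist ψ) :=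
  of_degreewiseSplit (S := twistShortComplex ψ) (twistSplitting ψ) hK hM

/-- Distinguished triangles of the homotopy category come from the short exact sequences
`twistShortComplex`. -/
lemma exists_iso_trianglehOfDegreewiseSplit_twist
    (T : Triangle (HomotopyCategory C (ComplexShape.up ℤ))) (hT : T ∈ distTriang _)
    {K M : CochainComplex C ℤ} (e₁ : (HomotopyCategory.quotient C _).obj K ≅ T.obj₁)
    (e₃ : (HomotopyCategory.quotient C _).obj M ≅ T.obj₃) :
    ∃ (ψ : M ⟶ K⟦(1 : ℤ)⟧)
      (e : trianglehOfDegreewiseSplit (twistShortComplex ψ) (twistSplitting ψ) ≅ T),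
      e.hom.hom₁ = e₁.hom ∧ e.hom.hom₃ = e₃.hom := by
  -- A triangle is determined up to isomorphism by its third morphism, and that morphism is
  -- represented by a chain map because the quotient functor is full.
  obtain ⟨ψ, hψ⟩ := (HomotopyCategory.quotient C (ComplexShape.up ℤ)).map_surjective
    (e₃.hom ≫ T.mor₃ ≫ e₁.inv⟦(1 : ℤ)⟧' ≫
      ((HomotopyCategory.quotient C (ComplexShape.up ℤ)).commShiftIso (1 : ℤ)).inv.app K)
  have key : ((HomotopyCategory.quotient C (ComplexShape.up ℤ)).map ψ ≫
      ((HomotopyCategory.quotient C (ComplexShape.up ℤ)).commShiftIso (1 : ℤ)).hom.app K) ≫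
        e₁.hom⟦(1 : ℤ)⟧' = e₃.hom ≫ T.mor₃ := by
    rw [hψ]
    simp only [Category.assoc, Iso.inv_hom_id_app_assoc]
    rw [← Functor.map_comp, e₁.inv_hom_id, CategoryTheory.Functor.map_id,
      Category.comp_id]
  exact ⟨ψ, isoTriangleOfIso₁₃ _ _
    ((HomotopyCategory.distinguished_iff_iso_trianglehOfDegreewiseSplit _).2
      ⟨_, _, ⟨Iso.refl _⟩⟩) hT e₁ e₃ ((congrArg (fun t : M ⟶ K⟦(1 : ℤ)⟧ =>
        ((HomotopyCategory.quotient C (ComplexShape.up ℤ)).map t ≫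
          ((HomotopyCategory.quotient C (ComplexShape.up ℤ)).commShiftIso (1 : ℤ)).hom.app K) ≫
            e₁.hom⟦(1 : ℤ)⟧') (homOfDegreewiseSplit_twist ψ)).trans key), rfl, rfl⟩

end DegreewiseSplit

/-! ### The triangulated category of complete projective resolutions. -/

section Tac

variable {C : Type u} [Category.{v} C] [Abelian C]

lemma isCompleteProjectiveResolution_of_isZero {K : CochainComplex C ℤ} (hK : IsZero K) :
    IsCompleteProjectiveResolution K := by
  have hX : ∀ n, IsZero (K.X n) := fun n =>
    (HomologicalComplex.eval C (ComplexShape.up ℤ) n).map_isZero hK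
  exact ⟨fun n => ⟨fun f e _ => ⟨0, (hX n).eq_of_src _ _⟩⟩,
    fun n => ShortComplex.exact_of_isZero_X₂ _ (hX n),
    fun P _ n f _ => ⟨0, (hX n).eq_of_src _ _⟩⟩

variable (C) in
/-- Complete projective resolutions, as a property of objects of the homotopy category. -/
def tac : ObjectProperty (HomotopyCategory C (ComplexShape.up ℤ)) :=
  fun K => IsCompleteProjectiveResolution K.as

instance : (tac C).ContainsZero where
  exists_zero := ⟨(HomotopyCategory.quotient _ _).obj 0, Functor.map_isZero _ (isZero_zero _),
    isCompleteProjectiveResolution_of_isZero (isZero_zero _)⟩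

instance : (tac C).IsStableUnderShift ℤ where
  isStableUnderShiftBy n :=
    { le_shift K hK := by
        obtain ⟨K : CochainComplex _ _, rfl⟩ := K.quotient_obj_surjective
        rw [ObjectProperty.prop_shift_iff, HomotopyCategory.shift_quotient_obj]
        exact IsCompleteProjectiveResolution.shift hK n }

instance : (tac C).IsTriangulated where
  ext₂' T hT h₁ h₃ := by
    obtain ⟨ψ, e, -, -⟩ := exists_iso_trianglehOfDegreewiseSplit_twist T hT
      (K := T.obj₁.as) (M := T.obj₃.as) (Iso.refl _) (Iso.refl _)
    exact ⟨_, IsCompleteProjectiveResolution.twist ψ h₁ h₃, ⟨(Triangle.π₂.mapIso e).symm⟩⟩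

variable (C) in
/-- The homotopy category of complete projective resolutions. -/
abbrev Tac := (tac C).FullSubcategory

end Tac


/-! ### Degree-zero cycles as an equivalence with the stable category. -/

section Cycles

variable {C : Type u} [Category.{v} C] [Abelian C] {K L M : CochainComplex C ℤ}

open HomologicalComplex CochainComplex

lemma toStable_map_eq_iff {X Y : (GP C).FullSubcategory} (f g : X ⟶ Y) :
    (toStable C).map f = (toStable C).map g ↔ stableRel C f g :=
  Quotient.functor_map_eq_iff (stableRel C) f g

lemma toStable_map_eq_of_factor {X Y : (GP C).FullSubcategory} (f g : X ⟶ Y) {P : C}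
    [hP : Projective P] (a : X.obj ⟶ P) (b : P ⟶ Y.obj) (h : f.hom - g.hom = a ≫ b) :
    (toStable C).map f = (toStable C).map g :=
  (toStable_map_eq_iff f g).2 ⟨P, hP, a, b, h⟩

instance : (toStable C).Full := inferInstanceAs (Quotient.functor (stableRel C)).Full

instance : (toStable C).EssSurj := inferInstanceAs (Quotient.functor (stableRel C)).EssSurj

/-- The cycles of degree `0` of a complete projective resolution. -/
abbrev cyc (hK : IsCompleteProjectiveResolution K) : (GP C).FullSubcategory :=
  ⟨K.cycles 0, hK.GP_cycles 0⟩

/-- The morphism induced on the cycles of degree `0`. -/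
def cycMap (hK : IsCompleteProjectiveResolution K) (hL : IsCompleteProjectiveResolution L)
    (f : K ⟶ L) : cyc hK ⟶ cyc hL :=
  ObjectProperty.homMk (cyclesMap f 0)

@[simp]
lemma cycMap_hom (hK : IsCompleteProjectiveResolution K) (hL : IsCompleteProjectiveResolution L)
    (f : K ⟶ L) : (cycMap hK hL f).hom = cyclesMap f 0 := rfl

/-- From a factorization through `P`, extending the first factor to `K.X 0` and lifting the second
to `L.X (-1)` gives one component of a homotopy, which propagates to all degrees. Conversely, the
component of a homotopy from degree 0 to degree -1 exhibits a factorization through the projective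
`L.X (-1)`. -/
lemma toStable_map_cycMap_eq_iff (hK : IsCompleteProjectiveResolution K)
    (hL : IsCompleteProjectiveResolution L) (f g : K ⟶ L) :
    (toStable C).map (cycMap hK hL f) = (toStable C).map (cycMap hK hL g) ↔
      Nonempty (Homotopy f g) := by
  constructor
  · intro h
    obtain ⟨P, hP, a, b, hab⟩ := (toStable_map_eq_iff _ _).1 h
    obtain ⟨a', ha'⟩ := (hK.homExact P hP).exists_extension hK.acyclic 0 a
    obtain ⟨b', hb'⟩ := acyclic_exists_lift hL.acyclic (-1) 0 rfl b
    obtain ⟨H⟩ := hK.nonempty_homotopy hL (f - g) (-1) (a' ≫ b') (by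
      have h1 : (cyclesMap f 0 - cyclesMap g 0) ≫ L.iCycles 0 = a ≫ b ≫ L.iCycles 0 := by
        rw [← Category.assoc, ← hab, cycMap_hom, cycMap_hom]
      rw [← ha', ← hb', Preadditive.sub_comp, cyclesMap_i, cyclesMap_i, Category.assoc,
        Category.assoc, toCycles_i, ← Preadditive.comp_sub] at h1
      exact (K.iCycles 0 ≫= Category.assoc _ _ _).trans h1.symm)
    exact ⟨Homotopy.equivSubZero.symm H⟩
  · rintro ⟨H⟩
    have := hL.projective (-1)
    refine toStable_map_eq_of_factor _ _ (K.iCycles 0 ≫ H.hom 0 (-1)) (L.toCycles (-1) 0) ?_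
    have h := K.iCycles 0 ≫= H.comm 0
    rw [dNext_eq _ (show (ComplexShape.up ℤ).Rel 0 1 from rfl),
      prevD_eq _ (show (ComplexShape.up ℤ).Rel (-1) 0 from rfl)] at h
    simp only [Preadditive.comp_add, iCycles_d_assoc, zero_comp, zero_add] at h
    rw [cycMap_hom, cycMap_hom, ← cancel_mono (L.iCycles 0)]
    simp [h]

lemma cyclesMap_add' (f g : K ⟶ L) (n : ℤ) :
    cyclesMap (f + g) n = cyclesMap f n + cyclesMap g n := by
  rw [← cancel_mono (L.iCycles n)]
  simp

/-- The complex underlying an object of `Tac C`. -/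
def Tac.cplx (K : Tac C) : CochainComplex C ℤ := K.obj.as

lemma Tac.isComplete (K : Tac C) : IsCompleteProjectiveResolution K.cplx := K.property

/-- A chain map representing a morphism of `Tac C`. -/
def Tac.rep {K L : Tac C} (f : K ⟶ L) : K.cplx ⟶ L.cplx :=
  (HomotopyCategory.quotient C (ComplexShape.up ℤ)).preimage (X := K.cplx) (Y := L.cplx) f.hom

/-- The morphism of `Tac C` represented by a chain map. -/
def Tac.homMk {K L : Tac C} (f : K.cplx ⟶ L.cplx) : K ⟶ L :=
  ObjectProperty.homMk ((HomotopyCategory.quotient C (ComplexShape.up ℤ)).map f)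

lemma Tac.homMk_rep {K L : Tac C} (f : K ⟶ L) : Tac.homMk (Tac.rep f) = f :=
  ObjectProperty.hom_ext _
    ((HomotopyCategory.quotient C (ComplexShape.up ℤ)).map_preimage (X := K.cplx) (Y := L.cplx)
      f.hom)

lemma Tac.homMk_id (K : Tac C) : Tac.homMk (𝟙 K.cplx) = 𝟙 K :=
  ObjectProperty.hom_ext _ ((HomotopyCategory.quotient C (ComplexShape.up ℤ)).map_id K.cplx)

lemma Tac.homMk_comp {K L M : Tac C} (f : K.cplx ⟶ L.cplx) (g : L.cplx ⟶ M.cplx) :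
    Tac.homMk (f ≫ g) = Tac.homMk f ≫ Tac.homMk g :=
  ObjectProperty.hom_ext _ ((HomotopyCategory.quotient C (ComplexShape.up ℤ)).map_comp f g)

lemma Tac.homMk_add {K L : Tac C} (f g : K.cplx ⟶ L.cplx) :
    Tac.homMk (f + g) = Tac.homMk f + Tac.homMk g :=
  ObjectProperty.hom_ext _ ((HomotopyCategory.quotient C (ComplexShape.up ℤ)).map_add (f := f))

lemma Tac.homMk_eq_iff {K L : Tac C} (f g : K.cplx ⟶ L.cplx) :
    Tac.homMk f = Tac.homMk g ↔ Nonempty (Homotopy f g) :=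
  ⟨fun h => ⟨HomotopyCategory.homotopyOfEq _ _ (congr_arg (fun k => k.hom) h)⟩,
    fun ⟨H⟩ => ObjectProperty.hom_ext _ (HomotopyCategory.eq_of_homotopy _ _ H)⟩

variable (C) in
/-- The cycles of degree `0`, as a functor from the homotopy category of complete projective
resolutions to the stable category. -/
def stableCycles : Tac C ⥤ StableGP C where
  obj K := (toStable C).obj (cyc K.isComplete)
  map {K L} f := (toStable C).map (cycMap K.isComplete L.isComplete (Tac.rep f))
  map_id K := by
    rw [← (toStable C).map_id]
    have : 𝟙 (cyc K.isComplete) = cycMap K.isComplete K.isComplete (𝟙 _) :=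
      ObjectProperty.hom_ext _ (cyclesMap_id K.cplx 0).symm
    rw [this, toStable_map_cycMap_eq_iff, ← Tac.homMk_eq_iff, Tac.homMk_rep, Tac.homMk_id]
  map_comp {K L M} f g := by
    rw [← (toStable C).map_comp]
    have : ∀ (a : K.cplx ⟶ L.cplx) (b : L.cplx ⟶ M.cplx),
        cycMap K.isComplete L.isComplete a ≫ cycMap L.isComplete M.isComplete b =
          cycMap K.isComplete M.isComplete (a ≫ b) :=
      fun a b => ObjectProperty.hom_ext _ (cyclesMap_comp a b 0).symm
    rw [this, toStable_map_cycMap_eq_iff, ← Tac.homMk_eq_iff, Tac.homMk_rep, Tac.homMk_comp,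
      Tac.homMk_rep, Tac.homMk_rep]

lemma stableCycles_map_homMk {K L : Tac C} (f : K.cplx ⟶ L.cplx) :
    (stableCycles C).map (Tac.homMk f) =
      (toStable C).map (cycMap K.isComplete L.isComplete f) := by
  refine (toStable_map_cycMap_eq_iff K.isComplete L.isComplete _ _).2 ?_
  rw [← Tac.homMk_eq_iff, Tac.homMk_rep]

/-- A complete projective resolution, as an object of `Tac C`. -/
def tacObj (hK : IsCompleteProjectiveResolution K) : Tac C :=
  ⟨(HomotopyCategory.quotient C (ComplexShape.up ℤ)).obj K, hK⟩

instance : (stableCycles C).Full where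
  map_surjective {K L} f := by
    obtain ⟨f, rfl⟩ := (toStable C).map_surjective f
    obtain ⟨g, hg⟩ := K.isComplete.exists_hom L.isComplete 0 f.hom
    refine ⟨Tac.homMk g, (stableCycles_map_homMk _).trans ?_⟩
    congr 1
    exact ObjectProperty.hom_ext _ hg

instance : (stableCycles C).Faithful where
  map_injective {K L} f g h := by
    rw [← Tac.homMk_rep f, ← Tac.homMk_rep g, Tac.homMk_eq_iff]
    exact (toStable_map_cycMap_eq_iff _ _ _ _).1 h

instance : (stableCycles C).EssSurj where
  mem_essImage X := by
    obtain ⟨Y, ⟨e⟩⟩ : ∃ Y, Nonempty ((toStable C).obj Y ≅ X) :=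
      ⟨(toStable C).objPreimage X, ⟨(toStable C).objObjPreimageIso X⟩⟩
    obtain ⟨K, hK, ⟨i⟩⟩ := (GP_iff _).1 Y.property
    exact ⟨tacObj hK, ⟨(toStable C).mapIso ((GP C).isoMk (X := cyc hK) (Y := Y) i.symm) ≪≫ e⟩⟩

instance : (stableCycles C).IsEquivalence where

instance : (stableCycles C).Additive where
  map_add {K L f g} := by
    have h : ∀ a b : K.cplx ⟶ L.cplx, cycMap K.isComplete L.isComplete (a + b) =
      cycMap K.isComplete L.isComplete a + cycMap K.isComplete L.isComplete b :=
        fun a b => ObjectProperty.hom_ext _ (cyclesMap_add' a b 0)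
    rw [← Tac.homMk_rep f, ← Tac.homMk_rep g, ← Tac.homMk_add, stableCycles_map_homMk,
      stableCycles_map_homMk, stableCycles_map_homMk, h, Functor.map_add]
    rfl

end Cycles


/-! ### Equivalences as localizations at the isomorphisms. -/

section Transport

open MorphismProperty

/-- An equivalence is a localization at the class of isomorphisms. Once this class is known to be
compatible with shifts and triangles, the triangulated structure on a localization specializes to
transport along the equivalence. -/
instance isomorphisms_hasLeftCalculusOfFractions (T : Type*) [Category* T] :
    (isomorphisms T).HasLeftCalculusOfFractions where
  exists_leftFraction X Y φ :=
    have : IsIso φ.s := φ.hs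
    ⟨⟨inv φ.s ≫ φ.f, 𝟙 _, isomorphisms.infer_property _⟩, by simp⟩
  ext X' X Y f₁ f₂ s hs h :=
    have : IsIso s := hs
    ⟨Y, 𝟙 _, isomorphisms.infer_property _, by rw [(cancel_epi s).1 h]⟩

instance isomorphisms_isCompatibleWithShift (T : Type*) [Category* T] [HasShift T ℤ] :
    (isomorphisms T).IsCompatibleWithShift ℤ where
  condition n := by
    ext X Y f
    exact isIso_iff_of_reflects_iso f (shiftFunctor T n)

instance isomorphisms_isCompatibleWithTriangulation (T : Type*) [Category* T] [HasShift T ℤ]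
    [Preadditive T] [HasZeroObject T] [∀ n : ℤ, (shiftFunctor T n).Additive]
    [Pretriangulated T] : (isomorphisms T).IsCompatibleWithTriangulation where
  compatible_with_triangulation T₁ T₂ h₁ h₂ a b ha hb comm := by
    obtain ⟨c, hc₁, hc₂⟩ := complete_distinguished_triangle_morphism T₁ T₂ h₁ h₂ a b comm
    exact ⟨c, isIso₃_of_isIso₁₂ (Triangle.homMk T₁ T₂ a b c comm hc₁ hc₂) h₁ h₂ ha hb, hc₁, hc₂⟩

instance isLocalization_isomorphisms {T D : Type*} [Category* T] [Category* D] (L : T ⥤ D)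
    [L.IsEquivalence] : L.IsLocalization (isomorphisms T) :=
  Functor.IsLocalization.of_isEquivalence _ _ (fun _ _ _ h => h)

end Transport

/-! ### The triangulated structure transported to the stable category. -/

namespace StableShift

open MorphismProperty

variable (C : Type u) [Category.{v} C] [Abelian C]

scoped instance hasShift : HasShift (StableGP C) ℤ :=
  HasShift.localized (stableCycles C) (isomorphisms (Tac C)) ℤ

scoped instance stableCyclesCommShift : (stableCycles C).CommShift ℤ :=
  Functor.CommShift.localized (stableCycles C) (isomorphisms (Tac C)) ℤ

scoped instance shift_additive (n : ℤ) : (shiftFunctor (StableGP C) n).Additive := by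
  rw [Localization.functor_additive_iff (stableCycles C) (isomorphisms (Tac C))]
  exact Functor.additive_of_iso ((stableCycles C).commShiftIso n)

scoped instance pretriangulated : Pretriangulated (StableGP C) :=
  Triangulated.Localization.pretriangulated (stableCycles C) (isomorphisms (Tac C))

scoped instance stableCycles_isTriangulated : (stableCycles C).IsTriangulated :=
  Triangulated.Localization.isTriangulated_functor (stableCycles C) (isomorphisms (Tac C))

scoped instance isTriangulated : IsTriangulated (StableGP C) :=
  Triangulated.Localization.isTriangulated (stableCycles C) (isomorphisms (Tac C))

end StableShift


/-! ### Connecting morphisms of short exact sequences. -/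

section Connecting

open scoped StableShift

variable {C : Type u} [Category.{v} C] [Abelian C] {K L M : CochainComplex C ℤ}

open HomologicalComplex CochainComplex

/-- A chain map between complete projective resolutions, as a morphism of `Tac C`. -/
def tacMap (hK : IsCompleteProjectiveResolution K) (hL : IsCompleteProjectiveResolution L)
    (f : K ⟶ L) : tacObj hK ⟶ tacObj hL :=
  Tac.homMk (K := tacObj hK) (L := tacObj hL) f

variable (hK : IsCompleteProjectiveResolution K) (hL : IsCompleteProjectiveResolution L)
  (hM : IsCompleteProjectiveResolution M)

/-- The value of `stableCycles` at a complete projective resolution. -/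
def stableCyclesIso : (stableCycles C).obj (tacObj hK) ≅ (toStable C).obj (cyc hK) := Iso.refl _

lemma stableCycles_map_tacMap (f : K ⟶ L) :
    (stableCycles C).map (tacMap hK hL f) ≫ (stableCyclesIso hL).hom =
      (stableCyclesIso hK).hom ≫ (toStable C).map (cycMap hK hL f) :=
  (Category.comp_id _).trans ((stableCycles_map_homMk (K := tacObj hK) (L := tacObj hL) f).trans
    (Category.id_comp _).symm)

lemma stableCycles_map_tacMap_assoc (f : K ⟶ L) {X : StableGP C}
    (g : (toStable C).obj (cyc hL) ⟶ X) :
    (stableCycles C).map (tacMap hK hL f) ≫ (stableCyclesIso hL).hom ≫ g =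
      (stableCyclesIso hK).hom ≫ (toStable C).map (cycMap hK hL f) ≫ g := by
  rw [← Category.assoc, stableCycles_map_tacMap, Category.assoc]

/-- The shift of a complete projective resolution in `Tac C`. -/
def tacShiftIso : (tacObj hK)⟦(1 : ℤ)⟧ ≅ tacObj (hK.shift 1) :=
  (tac C).fullyFaithfulι.preimageIso (((tac C).ι.commShiftIso (1 : ℤ)).app (tacObj hK) ≪≫
    ((HomotopyCategory.quotient C (ComplexShape.up ℤ)).commShiftIso (1 : ℤ)).symm.app K)

lemma ι_map_tacShiftIso_hom : (tac C).ι.map (tacShiftIso hK).hom =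
    ((tac C).ι.commShiftIso (1 : ℤ)).hom.app (tacObj hK) ≫
      ((HomotopyCategory.quotient C (ComplexShape.up ℤ)).commShiftIso (1 : ℤ)).inv.app K :=
  (tac C).fullyFaithfulι.map_preimage _

lemma tacShiftIso_naturality (f : K ⟶ L) :
    (tacMap hK hL f)⟦(1 : ℤ)⟧' ≫ (tacShiftIso hL).hom =
      (tacShiftIso hK).hom ≫ tacMap (hK.shift 1) (hL.shift 1) (f⟦(1 : ℤ)⟧') := by
  apply (tac C).ι.map_injective
  rw [Functor.map_comp, Functor.map_comp, ι_map_tacShiftIso_hom, ι_map_tacShiftIso_hom]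
  refine ((tac C).ι.commShiftIso_hom_naturality_assoc (tacMap hK hL f) (1 : ℤ) _).trans ?_
  exact (congrArg (fun t => _ ≫ t) ((HomotopyCategory.quotient C
    (ComplexShape.up ℤ)).commShiftIso_inv_naturality f (1 : ℤ))).trans (Category.assoc _ _ _).symm

/-- The shift of the cycles of a complete projective resolution. -/
def shiftCycIso : ((toStable C).obj (cyc hK))⟦(1 : ℤ)⟧ ≅ (toStable C).obj (cyc (hK.shift 1)) :=
  (CategoryTheory.shiftFunctor (StableGP C) (1 : ℤ)).mapIso (stableCyclesIso hK).symm ≪≫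
    ((stableCycles C).commShiftIso (1 : ℤ)).symm.app (tacObj hK) ≪≫
    (stableCycles C).mapIso (tacShiftIso hK) ≪≫ stableCyclesIso (hK.shift 1)

lemma shiftCycIso_naturality (f : K ⟶ L) :
    ((toStable C).map (cycMap hK hL f))⟦(1 : ℤ)⟧' ≫ (shiftCycIso hL).hom =
      (shiftCycIso hK).hom ≫
        (toStable C).map (cycMap (hK.shift 1) (hL.shift 1) (f⟦(1 : ℤ)⟧')) := by
  have h1 : (toStable C).map (cycMap hK hL f) ≫ (stableCyclesIso hL).inv =
      (stableCyclesIso hK).inv ≫ (stableCycles C).map (tacMap hK hL f) := by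
    rw [Iso.comp_inv_eq, Category.assoc, stableCycles_map_tacMap, Iso.inv_hom_id_assoc]
  simp only [shiftCycIso, Iso.trans_hom, Functor.mapIso_hom, Iso.symm_hom, Iso.app_hom,
    Category.assoc]
  rw [← Functor.map_comp_assoc, h1, Functor.map_comp_assoc]
  congr 1
  rw [← stableCycles_map_tacMap, ← Functor.map_comp_assoc, ← tacShiftIso_naturality,
    Functor.map_comp_assoc]
  exact (stableCycles C).commShiftIso_inv_naturality_assoc (tacMap hK hL f) (1 : ℤ) _

lemma cyclesShiftIso_inv_iCycles (K : CochainComplex C ℤ) (n i : ℤ) :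
    (cyclesShiftIso K n i).inv ≫ (K⟦n⟧).iCycles i =
      K.iCycles (i + n) ≫ (shiftFunctorObjXIso K n i (i + n) rfl).inv :=
  (K⟦n⟧).liftCycles_i _ (i + 1) (by simp) (iCycles_shift_comp_d K n i)

lemma shiftFunctorObjXIso_inv_naturality (f : K ⟶ L) (n i : ℤ) :
    (shiftFunctorObjXIso K n i (i + n) rfl).inv ≫ (f⟦n⟧').f i =
      f.f (i + n) ≫ (shiftFunctorObjXIso L n i (i + n) rfl).inv :=
  (Category.id_comp _).trans (Category.comp_id _).symm

lemma toCyclesShift_iCycles (K : CochainComplex C ℤ) :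
    toCyclesShift K ≫ (K⟦(1 : ℤ)⟧).iCycles 0 =
      -K.d 0 (0 + 1) ≫ (shiftFunctorObjXIso K 1 0 (0 + 1) rfl).inv := by
  rw [toCyclesShift, Preadditive.neg_comp, Category.assoc, cyclesShiftIso_inv_iCycles,
    toCycles_i_assoc]

lemma iCycles_toCyclesShift (K : CochainComplex C ℤ) : K.iCycles 0 ≫ toCyclesShift K = 0 := by
  rw [← cancel_mono ((K⟦(1 : ℤ)⟧).iCycles 0), Category.assoc, toCyclesShift_iCycles,
        Preadditive.comp_neg, iCycles_d_assoc,
    zero_comp, neg_zero, zero_comp]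

lemma toCyclesShift_naturality (f : K ⟶ L) :
    toCyclesShift K ≫ cyclesMap (f⟦(1 : ℤ)⟧') 0 = f.f 0 ≫ toCyclesShift L := by
  rw [← cancel_mono ((L⟦(1 : ℤ)⟧).iCycles 0), Category.assoc, cyclesMap_i,
    ← Category.assoc, toCyclesShift_iCycles, Category.assoc, toCyclesShift_iCycles,
    Preadditive.neg_comp, Preadditive.comp_neg, Category.assoc, shiftFunctorObjXIso_inv_naturality,
    f.comm_assoc]

/-- The data defining the connecting morphism of a short exact sequence: a complete projective
resolution `K` of the first object, an extension `g` to the second object of the inclusion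
in `K.X 0`, and the induced morphism `h` on the third object. -/
structure ConnectingData (S : ShortComplex (GP C).FullSubcategory) where
  /-- a complete projective resolution -/
  K : CochainComplex C ℤ
  hK : IsCompleteProjectiveResolution K
  /-- its cycles are the first object -/
  e : S.X₁ ≅ cyc hK
  /-- the extension of the inclusion in `K.X 0` -/
  g : S.X₂.obj ⟶ K.X 0
  /-- the induced morphism -/
  h : S.X₃ ⟶ cyc (hK.shift 1)
  comm₁ : S.f.hom ≫ g = e.hom.hom ≫ K.iCycles 0
  comm₂ : S.g.hom ≫ h.hom = g ≫ toCyclesShift K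

namespace ConnectingData

variable {S S' : ShortComplex (GP C).FullSubcategory}

/-- The connecting morphism. -/
def δ (D : ConnectingData S) : (toStable C).obj S.X₃ ⟶ ((toStable C).obj S.X₁)⟦(1 : ℤ)⟧ :=
  (toStable C).map D.h ≫ (shiftCycIso D.hK).inv ≫ ((toStable C).map D.e.inv)⟦(1 : ℤ)⟧'

/-- A chain map `f` over `φ.τ₁` makes the square with the extensions `D.g` and `D'.g` commute up to
a morphism vanishing on `S.X₁`. That error factors as `S.g.hom ≫ w`, so the two morphisms out of
`S.X₃` differ by one through the projective `D'.K.X 0`. Only exactness of `S` is needed, and the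
case of the identity shows independence of the data. -/
lemma δ_naturality (hS : (S.map (GP C).ι).ShortExact) (D : ConnectingData S)
    (D' : ConnectingData S') (φ : S ⟶ S') :
    (toStable C).map φ.τ₃ ≫ D'.δ = D.δ ≫ ((toStable C).map φ.τ₁)⟦(1 : ℤ)⟧' := by
  obtain ⟨f, hf⟩ := D.hK.exists_hom D'.hK 0 (D.e.inv ≫ φ.τ₁ ≫ D'.e.hom).hom
  have hf' : cycMap D.hK D'.hK f = D.e.inv ≫ φ.τ₁ ≫ D'.e.hom := ObjectProperty.hom_ext _ hf
  have hf'' : D.e.hom.hom ≫ cyclesMap f 0 = φ.τ₁.hom ≫ D'.e.hom.hom := by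
    have : D.e.hom ≫ cycMap D.hK D'.hK f = φ.τ₁ ≫ D'.e.hom := by
      rw [hf', Iso.hom_inv_id_assoc]
    exact congr_arg (fun k => k.hom) this
  have h1 : φ.τ₁.hom ≫ S'.f.hom = S.f.hom ≫ φ.τ₂.hom := congr_arg (fun k => k.hom) φ.comm₁₂
  have h2 : φ.τ₂.hom ≫ S'.g.hom = S.g.hom ≫ φ.τ₃.hom := congr_arg (fun k => k.hom) φ.comm₂₃
  have h3 : S.f.hom ≫ (φ.τ₂.hom ≫ D'.g - D.g ≫ f.f 0) = 0 := by
    rw [Preadditive.comp_sub, ← reassoc_of% h1, D'.comm₁, reassoc_of% D.comm₁, ← cyclesMap_i,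
      reassoc_of% hf'', sub_self]
  have : Epi (S.map (GP C).ι).g := hS.epi_g
  obtain ⟨w, hw⟩ : ∃ w : S.X₃.obj ⟶ D'.K.X 0,
      S.g.hom ≫ w = φ.τ₂.hom ≫ D'.g - D.g ≫ f.f 0 :=
    ⟨hS.exact.desc _ h3, hS.exact.g_desc _ h3⟩
  have h4 : (toStable C).map (φ.τ₃ ≫ D'.h) = (toStable C).map
      (D.h ≫ cycMap (D.hK.shift 1) (D'.hK.shift 1) (f⟦(1 : ℤ)⟧')) := by
    have := D'.hK.projective 0
    refine toStable_map_eq_of_factor _ _ w (toCyclesShift D'.K) ?_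
    have : Epi S.g.hom := hS.epi_g
    rw [← cancel_epi S.g.hom, reassoc_of% hw, Preadditive.comp_sub, Preadditive.sub_comp,
      Category.assoc, Category.assoc, ← D'.comm₂, ← toCyclesShift_naturality, ← reassoc_of% D.comm₂,
      reassoc_of% h2]
    rfl
  have h5 := shiftCycIso_naturality D.hK D'.hK f
  have h6 : (shiftCycIso D.hK).inv ≫ ((toStable C).map (cycMap D.hK D'.hK f))⟦(1 : ℤ)⟧' =
      (toStable C).map (cycMap (D.hK.shift 1) (D'.hK.shift 1) (f⟦(1 : ℤ)⟧')) ≫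
        (shiftCycIso D'.hK).inv := by
    rw [Iso.inv_comp_eq, ← reassoc_of% h5, Iso.hom_inv_id, Category.comp_id]
  rw [δ, δ, ← Functor.map_comp_assoc, h4, Functor.map_comp_assoc, ← reassoc_of% h6, hf',
    Category.assoc, Category.assoc, ← Functor.map_comp, ← Functor.map_comp, ← Functor.map_comp,
    ← Functor.map_comp]
  simp

lemma nonempty (hS : (S.map (GP C).ι).ShortExact) : Nonempty (ConnectingData S) := by
  obtain ⟨K, hK, ⟨e⟩⟩ := (GP_iff _).1 S.X₁.property
  have := hK.projective 0
  obtain ⟨g, hg⟩ : ∃ g : S.X₂.obj ⟶ K.X 0, S.f.hom ≫ g = e.hom ≫ K.iCycles 0 :=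
    GP.exists_extension hS S.X₃.property (e.hom ≫ K.iCycles 0)
  have : Epi (S.map (GP C).ι).g := hS.epi_g
  have h0 : S.f.hom ≫ g ≫ toCyclesShift K = 0 := by
    rw [reassoc_of% hg, iCycles_toCyclesShift, comp_zero]
  exact ⟨⟨K, hK, (GP C).isoMk e, g, ObjectProperty.homMk (hS.exact.desc _ h0), hg,
    hS.exact.g_desc _ h0⟩⟩

end ConnectingData

end Connecting


/-! ### Triangles of twists and short exact sequences of their cycles. -/

section TwistTriangle

open scoped StableShift

variable {C : Type u} [Category.{v} C] [Abelian C] {K M : CochainComplex C ℤ}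

open HomologicalComplex CochainComplex

variable (ψ : M ⟶ K⟦(1 : ℤ)⟧) (hK : IsCompleteProjectiveResolution K)
  (hM : IsCompleteProjectiveResolution M)

/-- The inclusion of `K`, as a chain map. -/
def twist.inlHom : K ⟶ twist ψ := (twistShortComplex ψ).f

/-- The projection onto `M`, as a chain map. -/
def twist.sndHom : twist ψ ⟶ M := (twistShortComplex ψ).g

@[simp]
lemma twist.inlHom_f (n : ℤ) : (twist.inlHom ψ).f n = twist.inl ψ n := rfl

@[simp]
lemma twist.sndHom_f (n : ℤ) : (twist.sndHom ψ).f n = twist.snd ψ n := rfl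

lemma twist.inlHom_sndHom : twist.inlHom ψ ≫ twist.sndHom ψ = 0 := (twistShortComplex ψ).zero

/-- The cycles of the short exact sequence `twistShortComplex`. -/
def twistCycles : ShortComplex (GP C).FullSubcategory where
  X₁ := cyc hK
  X₂ := cyc (hK.twist ψ hM)
  X₃ := cyc hM
  f := cycMap hK (hK.twist ψ hM) (twist.inlHom ψ)
  g := cycMap (hK.twist ψ hM) hM (twist.sndHom ψ)
  zero := ObjectProperty.hom_ext _
    ((cyclesMap_comp (twist.inlHom ψ) (twist.sndHom ψ) 0).symm.trans
      ((congrArg (fun t => cyclesMap t 0) (twist.inlHom_sndHom ψ)).trans (cyclesMap_zero _ _ _)))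

lemma twistShortComplex_shortExact : (twistShortComplex ψ).ShortExact :=
  shortExact_of_degreewise_shortExact _ (fun n => (twistSplitting ψ n).shortExact)

lemma twistCycles_shortExact : ((twistCycles ψ hK hM).map (GP C).ι).ShortExact := by
  have h := twistShortComplex_shortExact ψ
  have := h.mono_f
  have hex := cycles_left_exact (twistShortComplex ψ) h.exact 0
  have hmono : Mono (cyclesMap (twist.inlHom ψ) 0) :=
    inferInstanceAs (Mono (cyclesMap (twistShortComplex ψ).f 0))
  have hepi : Epi (cyclesMap (twist.sndHom ψ) 0) := by
    have := acyclic_epi_toCycles hM.acyclic (-1) 0 rfl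
    have hfac : (twist.inr ψ (-1) ≫ (twist ψ).toCycles (-1) 0) ≫
        cyclesMap (twist.sndHom ψ) 0 = M.toCycles (-1) 0 := by
      rw [← cancel_mono (M.iCycles 0), Category.assoc, Category.assoc, cyclesMap_i, toCycles_i,
        toCycles_i_assoc, ← (twist.sndHom ψ).comm, twist.sndHom_f, twist.inr_snd_assoc]
    exact epi_of_epi_fac hfac
  exact { exact := hex, mono_f := hmono, epi_g := hepi }

lemma twist.d_fst (i j : ℤ) (hij : i + 1 = j) :
    (twist ψ).d i j ≫ twist.fst ψ j =
      twist.fst ψ i ≫ K.d i j + twist.snd ψ i ≫ shiftComp ψ i j hij := by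
  apply twist.hom_ext'
  · simp [twist.inl_d_assoc ψ i j hij, twist.inl_fst_assoc, twist.inl_snd_assoc]
  · simp [twist.inr_d_assoc ψ i j hij, twist.inr_fst_assoc, twist.inr_snd_assoc]

lemma shiftComp_comp_inv (i : ℤ) :
    shiftComp ψ i (i + 1) rfl ≫ (shiftFunctorObjXIso K 1 i (i + 1) rfl).inv = ψ.f i := by
  rw [shiftComp, Category.assoc, Iso.hom_inv_id, Category.comp_id]

/-- The connecting data of `twistCycles`. -/
def twistConnectingData : ConnectingData (twistCycles ψ hK hM) where
  K := K
  hK := hK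
  e := Iso.refl _
  g := (twist ψ).iCycles 0 ≫ twist.fst ψ 0
  h := cycMap hM (hK.shift 1) ψ
  comm₁ := by
    have h : cyclesMap (twist.inlHom ψ) 0 ≫ (twist ψ).iCycles 0 =
      K.iCycles 0 ≫ twist.inl ψ 0 := cyclesMap_i (twist.inlHom ψ) 0
    refine Eq.trans (b := K.iCycles 0) ?_ (Category.id_comp _).symm
    change cyclesMap (twist.inlHom ψ) 0 ≫ (twist ψ).iCycles 0 ≫ twist.fst ψ 0 = _
    rw [reassoc_of% h, twist.inl_fst, Category.comp_id]
  comm₂ := by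
    have h : cyclesMap (twist.sndHom ψ) 0 ≫ M.iCycles 0 =
      (twist ψ).iCycles 0 ≫ twist.snd ψ 0 := cyclesMap_i (twist.sndHom ψ) 0
    -- On cycles of the twist, the component in `K` of the differential vanishes, so `ψ` and the
    -- differential of `K` cancel. The sign in `toCyclesShift` absorbs the resulting minus sign.
    have h' : (twist ψ).iCycles 0 ≫ twist.snd ψ 0 ≫ shiftComp ψ 0 (0 + 1) rfl =
        -(twist ψ).iCycles 0 ≫ twist.fst ψ 0 ≫ K.d 0 (0 + 1) := by
      have := (twist ψ).iCycles_d_assoc 0 (0 + 1) (twist.fst ψ (0 + 1))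
      rw [twist.d_fst ψ 0 (0 + 1) rfl, zero_comp, Preadditive.comp_add] at this
      exact eq_neg_of_add_eq_zero_right this
    change cyclesMap (twist.sndHom ψ) 0 ≫ cyclesMap ψ 0 =
      ((twist ψ).iCycles 0 ≫ twist.fst ψ 0) ≫ toCyclesShift K
    rw [← cancel_mono ((K⟦(1 : ℤ)⟧).iCycles 0), Category.assoc, Category.assoc, Category.assoc,
      toCyclesShift_iCycles, cyclesMap_i, reassoc_of% h, ← shiftComp_comp_inv, reassoc_of% h']
    simp only [Preadditive.neg_comp, Preadditive.comp_neg, Category.assoc]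

/-- The triangle of complete projective resolutions attached to a morphism `M ⟶ K⟦1⟧`. -/
def twistTriangle : Triangle (Tac C) :=
  Triangle.mk (tacMap hK (hK.twist ψ hM) (twist.inlHom ψ))
    (tacMap (hK.twist ψ hM) hM (twist.sndHom ψ))
    (tacMap hM (hK.shift 1) ψ ≫ (tacShiftIso hK).inv)

/-- The image of `twistTriangle` in the homotopy category. -/
def mapTwistTriangleIso : (tac C).ι.mapTriangle.obj (twistTriangle ψ hK hM) ≅
    trianglehOfDegreewiseSplit (twistShortComplex ψ) (twistSplitting ψ) := by
  refine Triangle.isoMk _ _ (Iso.refl _) (Iso.refl _) (Iso.refl _) ?_ ?_ ?_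
  · exact (Category.comp_id _).trans (Category.id_comp _).symm
  · exact (Category.comp_id _).trans (Category.id_comp _).symm
  · have h : (tac C).ι.map (tacShiftIso hK).inv ≫
        ((tac C).ι.commShiftIso (1 : ℤ)).hom.app (tacObj hK) =
        ((HomotopyCategory.quotient C (ComplexShape.up ℤ)).commShiftIso (1 : ℤ)).hom.app K := by
      refine (Iso.inv_comp_eq ((tac C).ι.mapIso (tacShiftIso hK))).2 (Eq.symm ?_)
      exact (congrArg (fun t => t ≫ _) (ι_map_tacShiftIso_hom hK)).trans
        ((Category.assoc _ _ _).trans ((congrArg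
          (fun t => ((tac C).ι.commShiftIso (1 : ℤ)).hom.app (tacObj hK) ≫ t)
          (Iso.inv_hom_id_app _ K)).trans (Category.comp_id _)))
    refine (congrArg (fun t => _ ≫ t) (CategoryTheory.Functor.map_id _ _)).trans
      ((Category.comp_id _).trans (Eq.trans ?_ (Category.id_comp _).symm))
    refine (congrArg (fun t => t ≫ _) (Functor.map_comp _ _ _)).trans
      ((Category.assoc _ _ _).trans ((congrArg (fun t => _ ≫ t) h).trans ?_))
    exact congrArg (fun t => (HomotopyCategory.quotient C (ComplexShape.up ℤ)).map t ≫ _)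
      (homOfDegreewiseSplit_twist ψ).symm

lemma twistTriangle_distinguished : twistTriangle ψ hK hM ∈ distTriang (Tac C) := by
  refine isomorphic_distinguished _ ((HomotopyCategory.distinguished_iff_iso_trianglehOfDegreewiseSplit _).2
      ⟨_, _, ⟨Iso.refl _⟩⟩) _ (mapTwistTriangleIso ψ hK hM)

/-- The image of `twistTriangle` in the stable category. -/
def stableTwistTriangleIso : (stableCycles C).mapTriangle.obj (twistTriangle ψ hK hM) ≅
    Triangle.mk ((toStable C).map (twistCycles ψ hK hM).f)
      ((toStable C).map (twistCycles ψ hK hM).g) (twistConnectingData ψ hK hM).δ := by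
  refine Triangle.isoMk _ _ (stableCyclesIso hK) (stableCyclesIso (hK.twist ψ hM))
    (stableCyclesIso hM) ?_ ?_ ?_
  · exact stableCycles_map_tacMap _ _ _
  · exact stableCycles_map_tacMap _ _ _
  · change ((stableCycles C).map (tacMap hM (hK.shift 1) ψ ≫ (tacShiftIso hK).inv) ≫
      ((stableCycles C).commShiftIso (1 : ℤ)).hom.app (tacObj hK)) ≫
        (stableCyclesIso hK).hom⟦(1 : ℤ)⟧' = (stableCyclesIso hM).hom ≫
          (toStable C).map (cycMap hM (hK.shift 1) ψ) ≫ (shiftCycIso hK).inv ≫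
            ((toStable C).map (𝟙 (cyc hK)))⟦(1 : ℤ)⟧'
    rw [CategoryTheory.Functor.map_id, CategoryTheory.Functor.map_id, Category.comp_id,
      ← stableCycles_map_tacMap_assoc, Functor.map_comp]
    simp [shiftCycIso]

lemma exists_iso_twistTriangle (T : Triangle (Tac C)) (hT : T ∈ distTriang (Tac C)) :
    ∃ (K M : CochainComplex C ℤ) (ψ : M ⟶ K⟦(1 : ℤ)⟧) (hK : IsCompleteProjectiveResolution K)
      (hM : IsCompleteProjectiveResolution M), Nonempty (T ≅ twistTriangle ψ hK hM) := by
  obtain ⟨ψ, e, -, -⟩ := exists_iso_trianglehOfDegreewiseSplit_twist ((tac C).ι.mapTriangle.obj T)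
    hT (K := T.obj₁.cplx) (M := T.obj₃.cplx) (Iso.refl _) (Iso.refl _)
  exact ⟨_, _, ψ, T.obj₁.isComplete, T.obj₃.isComplete,
    ⟨(tac C).ι.mapTriangle.preimageIso (e.symm ≪≫ (mapTwistTriangleIso _ _ _).symm)⟩⟩

/-- An extension of cycles of complete projective resolutions is the cycles of an extension. -/
lemma exists_iso_cycles_twist {S : ShortComplex C} (hS : S.ShortExact)
    (hK : IsCompleteProjectiveResolution K) (hM : IsCompleteProjectiveResolution M)
    (e₁ : S.X₁ ≅ K.cycles 0) (e₃ : S.X₃ ≅ M.cycles 0) :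
    ∃ (ψ : M ⟶ K⟦(1 : ℤ)⟧) (θ : S.X₂ ≅ (twist ψ).cycles 0),
      e₁.hom ≫ cyclesMap (twist.inlHom ψ) 0 = S.f ≫ θ.hom ∧
        θ.hom ≫ cyclesMap (twist.sndHom ψ) 0 = S.g ≫ e₃.hom := by
  have := hK.projective 0
  have h₃ : GP C S.X₃ := (GP_iff _).2 ⟨M, hM, ⟨e₃⟩⟩
  obtain ⟨g, hg⟩ := GP.exists_extension hS h₃ (e₁.hom ≫ K.iCycles 0)
  have := hS.epi_g
  have h0 : S.f ≫ g ≫ toCyclesShift K = 0 := by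
    rw [reassoc_of% hg, iCycles_toCyclesShift, comp_zero]
  obtain ⟨h, hh⟩ : ∃ h : S.X₃ ⟶ (K⟦(1 : ℤ)⟧).cycles 0, S.g ≫ h = g ≫ toCyclesShift K :=
    ⟨hS.exact.desc _ h0, hS.exact.g_desc _ h0⟩
  -- The induced morphism `h` is the connecting morphism of the extension before passing to the
  -- stable category; `ψ` is a chain map realizing it on cycles.
  obtain ⟨ψ, hψ⟩ := hM.exists_hom (hK.shift 1) 0 (e₃.inv ≫ h)
  have h1 : S.g ≫ e₃.hom ≫ M.iCycles 0 ≫ shiftComp ψ 0 (0 + 1) rfl = -g ≫ K.d 0 (0 + 1) := by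
    rw [← cancel_mono (shiftFunctorObjXIso K 1 0 (0 + 1) rfl).inv]
    simp only [Category.assoc, Preadditive.neg_comp]
    have h2 := congrArg (fun t => t ≫ (K⟦(1 : ℤ)⟧).iCycles 0) hh
    have h3 : h ≫ (K⟦(1 : ℤ)⟧).iCycles 0 = e₃.hom ≫ M.iCycles 0 ≫ ψ.f 0 := by
      rw [← cyclesMap_i, hψ, Category.assoc, Iso.hom_inv_id_assoc]
    simp only [Category.assoc, h3, toCyclesShift_iCycles, Preadditive.comp_neg] at h2
    rw [shiftComp_comp_inv]
    exact h2
  -- The extension `g` gives the `K`-coordinate and the projection to `S.X₃` the `M`-coordinate. The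
  -- defining property of `ψ` is precisely that this pair is a cycle.
  have h2 : (g ≫ twist.inl ψ 0 + S.g ≫ e₃.hom ≫ M.iCycles 0 ≫ twist.inr ψ 0) ≫
      (twist ψ).d 0 (0 + 1) = 0 := by
    rw [Preadditive.add_comp]
    simp only [Category.assoc, twist.inl_d ψ 0 (0 + 1) rfl, twist.inr_d ψ 0 (0 + 1) rfl,
      Preadditive.comp_add, iCycles_d_assoc, zero_comp, add_zero]
    have := congrArg (fun t => t ≫ twist.inl ψ (0 + 1)) h1
    simp only [Category.assoc, Preadditive.neg_comp] at this
    rw [this, add_neg_cancel]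
  let θ : S.X₂ ⟶ (twist ψ).cycles 0 := (twist ψ).liftCycles _ (0 + 1) (by simp) h2
  have hθ : θ ≫ (twist ψ).iCycles 0 =
    g ≫ twist.inl ψ 0 + S.g ≫ e₃.hom ≫ M.iCycles 0 ≫ twist.inr ψ 0 := liftCycles_i _ _ _ _ _
  have hf : cyclesMap (twist.inlHom ψ) 0 ≫ (twist ψ).iCycles 0 =
      K.iCycles 0 ≫ twist.inl ψ 0 := cyclesMap_i (twist.inlHom ψ) 0
  have hg' : cyclesMap (twist.sndHom ψ) 0 ≫ M.iCycles 0 =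
      (twist ψ).iCycles 0 ≫ twist.snd ψ 0 := cyclesMap_i (twist.sndHom ψ) 0
  let f' : K.cycles 0 ⟶ (twist ψ).cycles 0 := cyclesMap (twist.inlHom ψ) 0
  let g' : (twist ψ).cycles 0 ⟶ M.cycles 0 := cyclesMap (twist.sndHom ψ) 0
  have c₁ : e₁.hom ≫ f' = S.f ≫ θ := by
    have hf : f' ≫ (twist ψ).iCycles 0 = K.iCycles 0 ≫ twist.inl ψ 0 := hf
    rw [← cancel_mono ((twist ψ).iCycles 0), Category.assoc, Category.assoc, hθ, hf,
      Preadditive.comp_add, S.zero_assoc, zero_comp, add_zero, reassoc_of% hg]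
  have c₂ : θ ≫ g' = S.g ≫ e₃.hom := by
    have hg' : g' ≫ M.iCycles 0 = (twist ψ).iCycles 0 ≫ twist.snd ψ 0 := hg'
    rw [← cancel_mono (M.iCycles 0), Category.assoc, Category.assoc, hg', reassoc_of% hθ]
    simp
  let Φ : S ⟶ (twistCycles ψ hK hM).map (GP C).ι := ⟨e₁.hom, θ, e₃.hom, c₁, c₂⟩
  have : IsIso Φ.τ₁ := inferInstanceAs (IsIso e₁.hom)
  have : IsIso Φ.τ₃ := inferInstanceAs (IsIso e₃.hom)
  have : IsIso θ :=
    ShortComplex.isIso₂_of_shortExact_of_isIso₁₃ Φ hS (twistCycles_shortExact ψ hK hM)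
  exact ⟨ψ, asIso θ, c₁, c₂⟩

/-- The twist of the two outer complete resolutions plays the part of the horseshoe lemma. -/
lemma GP.of_shortExact {S : ShortComplex C} (hS : S.ShortExact) (h₁ : GP C S.X₁)
    (h₃ : GP C S.X₃) : GP C S.X₂ := by
  obtain ⟨K, hK, ⟨e₁⟩⟩ := (GP_iff _).1 h₁
  obtain ⟨M, hM, ⟨e₃⟩⟩ := (GP_iff _).1 h₃
  obtain ⟨ψ, θ, -, -⟩ := exists_iso_cycles_twist hS hK hM e₁ e₃
  exact (GP_iff _).2 ⟨_, hK.twist ψ hM, ⟨θ⟩⟩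

end TwistTriangle

/-! ### Distinguished triangles are those of short exact sequences. -/

section Triangulation

open scoped StableShift

variable {C : Type u} [Category.{v} C] [Abelian C]

/-- The connecting morphism of a short exact sequence of Gorenstein projective objects. -/
def connectingHom (S : ShortComplex (GP C).FullSubcategory) (hS : (S.map (GP C).ι).ShortExact) :
    (toStable C).obj S.X₃ ⟶ ((toStable C).obj S.X₁)⟦(1 : ℤ)⟧ :=
  (ConnectingData.nonempty hS).some.δ

lemma connectingHom_naturality {S S' : ShortComplex (GP C).FullSubcategory}
    (hS : (S.map (GP C).ι).ShortExact) (hS' : (S'.map (GP C).ι).ShortExact) (φ : S ⟶ S') :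
    (toStable C).map φ.τ₃ ≫ connectingHom S' hS' =
      connectingHom S hS ≫ ((toStable C).map φ.τ₁)⟦(1 : ℤ)⟧' :=
  ConnectingData.δ_naturality hS _ _ φ

lemma connectingHom_eq {S : ShortComplex (GP C).FullSubcategory}
    (hS : (S.map (GP C).ι).ShortExact) (D : ConnectingData S) : connectingHom S hS = D.δ := by
  have := ConnectingData.δ_naturality hS (ConnectingData.nonempty hS).some D (𝟙 S)
  simpa [connectingHom] using this.symm

/-- The triangle of a short exact sequence of Gorenstein projective objects. -/
abbrev stableTriangle (S : ShortComplex (GP C).FullSubcategory)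
    (hS : (S.map (GP C).ι).ShortExact) : Triangle (StableGP C) :=
  Triangle.mk ((toStable C).map S.f) ((toStable C).map S.g) (connectingHom S hS)

/-- The triangles of isomorphic short exact sequences are isomorphic. -/
def stableTriangleIso {S S' : ShortComplex (GP C).FullSubcategory}
    (hS : (S.map (GP C).ι).ShortExact) (hS' : (S'.map (GP C).ι).ShortExact) (e : S ≅ S') :
    stableTriangle S hS ≅ stableTriangle S' hS' :=
  Triangle.isoMk _ _ ((toStable C).mapIso (ShortComplex.π₁.mapIso e))
    ((toStable C).mapIso (ShortComplex.π₂.mapIso e))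
    ((toStable C).mapIso (ShortComplex.π₃.mapIso e))
    (((toStable C).map_comp _ _).symm.trans
      ((congrArg (toStable C).map e.hom.comm₁₂.symm).trans ((toStable C).map_comp _ _)))
    (((toStable C).map_comp _ _).symm.trans
      ((congrArg (toStable C).map e.hom.comm₂₃.symm).trans ((toStable C).map_comp _ _)))
    (connectingHom_naturality hS hS' e.hom).symm

lemma stableTriangle_distinguished (S : ShortComplex (GP C).FullSubcategory)
    (hS : (S.map (GP C).ι).ShortExact) : stableTriangle S hS ∈ distTriang (StableGP C) := by
  obtain ⟨K, hK, ⟨e₁⟩⟩ := (GP_iff _).1 S.X₁.property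
  obtain ⟨M, hM, ⟨e₃⟩⟩ := (GP_iff _).1 S.X₃.property
  obtain ⟨ψ, θ, h₁, h₂⟩ := exists_iso_cycles_twist hS hK hM e₁ e₃
  let e : S ≅ twistCycles ψ hK hM := ShortComplex.isoMk ((GP C).isoMk e₁) ((GP C).isoMk θ)
    ((GP C).isoMk e₃) (ObjectProperty.hom_ext _ h₁) (ObjectProperty.hom_ext _ h₂)
  refine isomorphic_distinguished _ ((stableCycles C).map_distinguished _
    (twistTriangle_distinguished ψ hK hM)) _ (stableTriangleIso hS
      (twistCycles_shortExact ψ hK hM) e ≪≫ ?_ ≪≫ (stableTwistTriangleIso ψ hK hM).symm)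
  exact eqToIso (by rw [stableTriangle, connectingHom_eq _ (twistConnectingData ψ hK hM)])

variable (C) in
/-- The triangulated structure of the stable category. -/
abbrev stableTriangulation : StableTriangulation C where
  δ := connectingHom
  δ_naturality := connectingHom_naturality
  distinguished_iff T := by
    constructor
    · rintro ⟨T', e, hT'⟩
      obtain ⟨K, M, ψ, hK, hM, ⟨e'⟩⟩ := exists_iso_twistTriangle T' hT'
      refine ⟨twistCycles ψ hK hM, twistCycles_shortExact ψ hK hM,
        ⟨e ≪≫ (stableCycles C).mapTriangle.mapIso e' ≪≫ stableTwistTriangleIso ψ hK hM ≪≫ ?_⟩⟩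
      exact eqToIso (by rw [connectingHom_eq _ (twistConnectingData ψ hK hM)])
    · rintro ⟨S, hS, ⟨e⟩⟩
      exact isomorphic_distinguished _ (stableTriangle_distinguished S hS) _ e

end Triangulation


/-! ### Triangulated functors and adjunctions induced on stable categories. -/

section StableMap

open scoped StableShift

variable {C : Type u₁} [Category.{v₁} C] [Abelian C] {D : Type u₂} [Category.{v₂} D] [Abelian D]

open HomologicalComplex

section

variable (φ : C ⥤ D) [φ.Additive]

/-- The image of a complex under an additive functor. -/
abbrev mapCplx (K : CochainComplex C ℤ) : CochainComplex D ℤ :=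
  (φ.mapHomologicalComplex (ComplexShape.up ℤ)).obj K

/-- The inclusion of the cycles of the image of a complex. -/
def mapICycles (K : CochainComplex C ℤ) (n : ℤ) : (mapCplx φ K).cycles n ⟶ φ.obj (K.X n) :=
  (mapCplx φ K).iCycles n

/-- The differential of the image of a complex, as a morphism to the cycles. -/
def mapToCycles (K : CochainComplex C ℤ) (m n : ℤ) : φ.obj (K.X m) ⟶ (mapCplx φ K).cycles n :=
  (mapCplx φ K).toCycles m n

instance (K : CochainComplex C ℤ) (n : ℤ) : Mono (mapICycles φ K n) :=
  inferInstanceAs (Mono ((mapCplx φ K).iCycles n))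

lemma mapToCycles_mapICycles (K : CochainComplex C ℤ) (m n : ℤ) :
    mapToCycles φ K m n ≫ mapICycles φ K n = φ.map (K.d m n) :=
  (mapCplx φ K).toCycles_i m n

/-- The canonical morphism from the image of the cycles to the cycles of the image. -/
def mapCyclesHom (K : CochainComplex C ℤ) (n : ℤ) :
    φ.obj (K.cycles n) ⟶ (mapCplx φ K).cycles n :=
  (mapCplx φ K).liftCycles (φ.map (K.iCycles n)) (n + 1) (by simp)
    ((φ.map_comp _ _).symm.trans ((congrArg φ.map (K.iCycles_d _ _)).trans (φ.map_zero _ _)))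

lemma mapCyclesHom_mapICycles (K : CochainComplex C ℤ) (n : ℤ) :
    mapCyclesHom φ K n ≫ mapICycles φ K n = φ.map (K.iCycles n) :=
  liftCycles_i _ _ _ _ _

lemma mapCyclesHom_naturality {K L : CochainComplex C ℤ} (f : K ⟶ L) (n : ℤ) :
    φ.map (cyclesMap f n) ≫ mapCyclesHom φ L n =
      mapCyclesHom φ K n ≫
        cyclesMap ((φ.mapHomologicalComplex (ComplexShape.up ℤ)).map f) n := by
  have h : cyclesMap ((φ.mapHomologicalComplex (ComplexShape.up ℤ)).map f) n ≫ mapICycles φ L n =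
      mapICycles φ K n ≫ φ.map (f.f n) := cyclesMap_i _ _
  rw [← cancel_mono (mapICycles φ L n), Category.assoc, Category.assoc, mapCyclesHom_mapICycles, h,
    ← φ.map_comp, cyclesMap_i, φ.map_comp, ← mapCyclesHom_mapICycles, Category.assoc]

lemma map_toCycles_mapCyclesHom (K : CochainComplex C ℤ) (m n : ℤ) :
    φ.map (K.toCycles m n) ≫ mapCyclesHom φ K n = mapToCycles φ K m n := by
  rw [← cancel_mono (mapICycles φ K n), Category.assoc, mapCyclesHom_mapICycles, ← φ.map_comp,
    toCycles_i, mapToCycles_mapICycles]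

/-- Left exactness of `φ` is not needed. The morphism is epi because the differential of the image
already covers its cycles. An element in the kernel lifts, after refinement, to a cycle of degree `n
- 1` in the image; acyclicity makes it a boundary, and boundaries die in the image of the cycles. -/
lemma isIso_mapCyclesHom [φ.PreservesEpimorphisms] {K : CochainComplex C ℤ} (hK : K.Acyclic)
    (hφK : (mapCplx φ K).Acyclic) (n : ℤ) : IsIso (mapCyclesHom φ K n) := by
  have h₁ := acyclic_epi_toCycles hK (n - 1) n (by simp)
  have h₂ : Epi (mapToCycles φ K (n - 1) n) := acyclic_epi_toCycles hφK (n - 1) n (by simp)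
  have : Epi (mapCyclesHom φ K n) := epi_of_epi_fac (map_toCycles_mapCyclesHom φ K (n - 1) n)
  have : Mono (mapCyclesHom φ K n) := by
    refine Preadditive.mono_of_cancel_zero _ (fun {A} x hx => ?_)
    obtain ⟨A', π, _, x', hx'⟩ := surjective_up_to_refinements_of_epi
      (φ.map (K.toCycles (n - 1) n)) x
    have h0 : x' ≫ φ.map (K.d (n - 1) n) = 0 := by
      rw [← toCycles_i, φ.map_comp, ← reassoc_of% hx', ← mapCyclesHom_mapICycles,
        reassoc_of% hx, zero_comp, comp_zero]
    have hex := (exactAt_iff' _ (n - 1 - 1) (n - 1) n (by simp) (by simp)).1 (hφK (n - 1))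
    obtain ⟨A'', π', _, y, hy⟩ : ∃ (A'' : D) (π' : A'' ⟶ A') (_ : Epi π')
        (y : A'' ⟶ φ.obj (K.X (n - 1 - 1))), π' ≫ x' = y ≫ φ.map (K.d (n - 1 - 1) (n - 1)) :=
      hex.exact_up_to_refinements x' h0
    rw [← cancel_epi π, ← cancel_epi π', comp_zero, comp_zero, hx', reassoc_of% hy, ← φ.map_comp,
      K.d_toCycles, φ.map_zero, comp_zero]
  exact isIso_of_mono_of_epi _

/-- A functor sends complete projective resolutions to complete projective resolutions. -/
def PreservesCompleteResolutions : Prop :=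
  ∀ K : CochainComplex C ℤ, IsCompleteProjectiveResolution K →
    IsCompleteProjectiveResolution (mapCplx φ K)

variable {φ}

/-- The cycles of the image of a complete projective resolution. -/
def mapCyclesIso [φ.PreservesEpimorphisms] (hφ : PreservesCompleteResolutions φ)
    {K : CochainComplex C ℤ} (hK : IsCompleteProjectiveResolution K) (n : ℤ) :
    φ.obj (K.cycles n) ≅ (mapCplx φ K).cycles n :=
  have := isIso_mapCyclesHom φ hK.acyclic (hφ K hK).acyclic n
  asIso (mapCyclesHom φ K n)

lemma PreservesCompleteResolutions.GP_obj [φ.PreservesEpimorphisms]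
    (hφ : PreservesCompleteResolutions φ) (X : C) (hX : GP C X) : GP D (φ.obj X) := by
  obtain ⟨K, hK, ⟨e⟩⟩ := (GP_iff _).1 hX
  exact (GP_iff _).2 ⟨_, hφ K hK, ⟨φ.mapIso e ≪≫ mapCyclesIso hφ hK 0⟩⟩

variable (φ)

/-- The functor between stable categories induced by a functor which preserves projective and
Gorenstein projective objects. -/
def stableMap (hP : ∀ X : C, Projective X → Projective (φ.obj X))
    (hG : ∀ X : C, GP C X → GP D (φ.obj X)) : StableGP C ⥤ StableGP D :=
  CategoryTheory.Quotient.lift (stableRel C) (restrictGP φ hG ⋙ toStable D) (by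
    rintro X Y f g ⟨P, hP', a, b, h⟩
    have := hP P hP'
    refine toStable_map_eq_of_factor _ _ (φ.map a) (φ.map b) ?_
    have h' : φ.map f.hom - φ.map g.hom = φ.map a ≫ φ.map b := by
      rw [← φ.map_comp, ← h, φ.map_sub]
    exact h')

/-- The functor `stableMap` is induced. -/
def toStableCompStableMap (hP : ∀ X : C, Projective X → Projective (φ.obj X))
    (hG : ∀ X : C, GP C X → GP D (φ.obj X)) :
    toStable C ⋙ stableMap φ hP hG ≅ restrictGP φ hG ⋙ toStable D :=
  CategoryTheory.Quotient.lift.isLift _ _ _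

lemma isInducedBy_stableMap (hP : ∀ X : C, Projective X → Projective (φ.obj X))
    (hG : ∀ X : C, GP C X → GP D (φ.obj X)) : IsInducedBy (stableMap φ hP hG) φ :=
  ⟨hG, ⟨toStableCompStableMap φ hP hG⟩⟩

/-- The functor on homotopy categories of complete projective resolutions. -/
def tacFunctor (hφ : PreservesCompleteResolutions φ) : Tac C ⥤ Tac D :=
  (tac D).lift ((tac C).ι ⋙ φ.mapHomotopyCategory (ComplexShape.up ℤ))
    (fun K => hφ (Tac.cplx K) (Tac.isComplete K))

/-- The functor `tacFunctor` is the restriction of the functor between homotopy categories. -/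
def tacFunctorCompι (hφ : PreservesCompleteResolutions φ) : tacFunctor φ hφ ⋙ (tac D).ι ≅
    (tac C).ι ⋙ φ.mapHomotopyCategory (ComplexShape.up ℤ) :=
  Iso.refl _

instance (hφ : PreservesCompleteResolutions φ) : (tacFunctor φ hφ).CommShift ℤ :=
  Functor.CommShift.ofComp (tacFunctorCompι φ hφ) ℤ

instance (hφ : PreservesCompleteResolutions φ) :
    NatTrans.CommShift (tacFunctorCompι φ hφ).hom ℤ :=
  Functor.CommShift.ofComp_compatibility _ _

instance (hφ : PreservesCompleteResolutions φ) : (tacFunctor φ hφ).IsTriangulated := by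
  rw [Functor.isTriangulated_iff_comp_right (tacFunctorCompι φ hφ)]
  infer_instance

variable {φ}

/-- The compatibility of `stableMap` and `tacFunctor`. -/
def stableCyclesCompStableMap [φ.PreservesEpimorphisms]
    (hP : ∀ X : C, Projective X → Projective (φ.obj X)) (hφ : PreservesCompleteResolutions φ) :
    stableCycles C ⋙ stableMap φ hP hφ.GP_obj ≅ tacFunctor φ hφ ⋙ stableCycles D :=
  NatIso.ofComponents (fun K => (toStable D).mapIso
    ((GP D).isoMk (X := (restrictGP φ hφ.GP_obj).obj (cyc K.isComplete))
      (Y := cyc (hφ _ K.isComplete)) (mapCyclesIso hφ K.isComplete 0))) (by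
    intro K L f
    obtain ⟨f, rfl⟩ : ∃ g, f = Tac.homMk g := ⟨_, (Tac.homMk_rep f).symm⟩
    have h₁ : (stableCycles C ⋙ stableMap φ hP hφ.GP_obj).map (Tac.homMk f) =
        (toStable D).map ((restrictGP φ hφ.GP_obj).map (cycMap K.isComplete L.isComplete f)) :=
      congrArg (stableMap φ hP hφ.GP_obj).map (stableCycles_map_homMk f)
    have h₂ : (tacFunctor φ hφ ⋙ stableCycles D).map (Tac.homMk f) =
        (toStable D).map (cycMap (hφ _ K.isComplete) (hφ _ L.isComplete)
          ((φ.mapHomologicalComplex (ComplexShape.up ℤ)).map f)) :=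
      stableCycles_map_homMk (K := (tacFunctor φ hφ).obj K) (L := (tacFunctor φ hφ).obj L)
        ((φ.mapHomologicalComplex (ComplexShape.up ℤ)).map f)
    refine (congrArg (fun t => t ≫ _) h₁).trans (Eq.trans ?_ (congrArg (fun t => _ ≫ t) h₂.symm))
    refine ((toStable D).map_comp _ _).symm.trans (Eq.trans ?_ ((toStable D).map_comp _ _))
    exact congrArg (toStable D).map (ObjectProperty.hom_ext _ (mapCyclesHom_naturality φ f 0)))

/-- The commutation with shifts of the functor induced by a functor which preserves complete
projective resolutions. -/
@[reducible]
def stableMapCommShift [φ.PreservesEpimorphisms]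
    (hP : ∀ X : C, Projective X → Projective (φ.obj X)) (hφ : PreservesCompleteResolutions φ) :
    (stableMap φ hP hφ.GP_obj).CommShift ℤ :=
  letI : Localization.Lifting (stableCycles C) (MorphismProperty.isomorphisms (Tac C))
    (tacFunctor φ hφ ⋙ stableCycles D) (stableMap φ hP hφ.GP_obj) :=
      ⟨stableCyclesCompStableMap hP hφ⟩
  Functor.commShiftOfLocalization (stableCycles C) (MorphismProperty.isomorphisms (Tac C)) ℤ
    (tacFunctor φ hφ ⋙ stableCycles D) (stableMap φ hP hφ.GP_obj)

/-- After precomposition with the equivalence `stableCycles` the functor becomes `tacFunctor`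
followed by `stableCycles`, a composite of triangulated functors. This suffices because every
morphism of the stable category comes, up to isomorphism, from `Tac C`. -/
lemma stableMap_isTriangulated [φ.PreservesEpimorphisms]
    (hP : ∀ X : C, Projective X → Projective (φ.obj X)) (hφ : PreservesCompleteResolutions φ) :
    letI := stableMapCommShift hP hφ
    (stableMap φ hP hφ.GP_obj).IsTriangulated := by
  let := stableMapCommShift hP hφ
  let : Localization.Lifting (stableCycles C) (MorphismProperty.isomorphisms (Tac C))
    (tacFunctor φ hφ ⋙ stableCycles D) (stableMap φ hP hφ.GP_obj) :=
      ⟨stableCyclesCompStableMap hP hφ⟩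
  have : NatTrans.CommShift (stableCyclesCompStableMap hP hφ).hom ℤ :=
    NatTrans.commShift_iso_hom_of_localization (stableCycles C)
      (MorphismProperty.isomorphisms (Tac C)) ℤ
      (tacFunctor φ hφ ⋙ stableCycles D) (stableMap φ hP hφ.GP_obj)
  have : (stableCycles C).mapArrow.EssSurj :=
    Localization.essSurj_mapArrow (stableCycles C) (MorphismProperty.isomorphisms (Tac C))
  exact Functor.isTriangulated_of_precomp_iso (stableCyclesCompStableMap hP hφ)

end

section

variable {φ : C ⥤ D} [φ.Additive] {ψ : D ⥤ C} [ψ.Additive]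
  (hP : ∀ X : C, Projective X → Projective (φ.obj X)) (hG : ∀ X : C, GP C X → GP D (φ.obj X))
  (hP' : ∀ X : D, Projective X → Projective (ψ.obj X)) (hG' : ∀ X : D, GP D X → GP C (ψ.obj X))

/-- The adjunction between stable categories induced by an adjunction. -/
def stableAdjunction (adj : φ ⊣ ψ) : stableMap φ hP hG ⊣ stableMap ψ hP' hG' where
  unit :=
    { app := fun X => (toStable C).map (X := X.as) (Y := ⟨_, hG' _ (hG _ X.as.property)⟩)
        (ObjectProperty.homMk (adj.unit.app X.as.obj))
      naturality := fun X Y f => by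
        obtain ⟨f, rfl⟩ := (toStable C).map_surjective (X := X.as) (Y := Y.as) f
        refine ((toStable C).map_comp _ _).symm.trans (Eq.trans ?_ ((toStable C).map_comp _ _))
        exact congrArg (toStable C).map (ObjectProperty.hom_ext _ (adj.unit.naturality f.hom)) }
  counit :=
    { app := fun X => (toStable D).map (X := ⟨_, hG _ (hG' _ X.as.property)⟩) (Y := X.as)
        (ObjectProperty.homMk (adj.counit.app X.as.obj))
      naturality := fun X Y f => by
        obtain ⟨f, rfl⟩ := (toStable D).map_surjective (X := X.as) (Y := Y.as) f
        refine ((toStable D).map_comp _ _).symm.trans (Eq.trans ?_ ((toStable D).map_comp _ _))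
        exact congrArg (toStable D).map (ObjectProperty.hom_ext _ (adj.counit.naturality f.hom)) }
  left_triangle_components X := by
    refine ((toStable D).map_comp _ _).symm.trans (Eq.trans ?_ ((toStable D).map_id _))
    exact congrArg (toStable D).map
      (ObjectProperty.hom_ext _ (adj.left_triangle_components X.as.obj))
  right_triangle_components X := by
    refine ((toStable C).map_comp _ _).symm.trans (Eq.trans ?_ ((toStable C).map_id _))
    exact congrArg (toStable C).map
      (ObjectProperty.hom_ext _ (adj.right_triangle_components X.as.obj))

end

end StableMap


/-! ### Hom-exactness: dimension shifting and adjunctions. -/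

section HomExact

open HomologicalComplex

lemma homExact_of_injective {C : Type u} [Category.{v} C] [Abelian C] {K : CochainComplex C ℤ}
    (hK : K.Acyclic) (I : C) [Injective I] : HomExact K I := by
  intro n f hf
  have hex := (exactAt_iff' _ (n - 1) n (n + 1) (by simp) (by simp)).1 (hK n)
  exact ⟨hex.descToInjective f hf, hex.comp_descToInjective f hf⟩

/-- Since the terms of `K` are projective, `S` induces a short exact sequence of Hom complexes; this
is the part of its long exact sequence that is needed. -/
lemma HomExact.of_shortExact {C : Type u} [Category.{v} C] [Abelian C] {K : CochainComplex C ℤ}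
    (hK : ∀ n, Projective (K.X n)) {S : ShortComplex C} (hS : S.ShortExact) (h₂ : HomExact K S.X₂)
    (h₃ : HomExact K S.X₃) : HomExact K S.X₁ := by
  intro n f hf
  have := hS.mono_f
  have := hS.epi_g
  obtain ⟨g, hg⟩ := h₂ n (f ≫ S.f) (by rw [reassoc_of% hf, zero_comp])
  obtain ⟨h, hh⟩ := h₃.exists_desc n (n + 1) (n + 1 + 1) rfl rfl (g ≫ S.g)
    (by rw [reassoc_of% hg, S.zero, comp_zero])
  have := hK (n + 1 + 1)
  have h' : (g - K.d (n + 1) (n + 1 + 1) ≫ Projective.factorThru h S.g) ≫ S.g = 0 := by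
    rw [Preadditive.sub_comp, Category.assoc, Projective.factorThru_comp, hh, sub_self]
  refine ⟨hS.exact.lift _ h', ?_⟩
  rw [← cancel_mono S.f, Category.assoc, hS.exact.lift_f, Preadditive.comp_sub, hg,
    K.d_comp_d_assoc, zero_comp, sub_zero]

lemma homExact_of_hasInjectiveDimensionLE {C : Type u} [Category.{v} C] [Abelian C]
    [EnoughInjectives C] {K : CochainComplex C ℤ} (hK : ∀ n, Projective (K.X n))
    (hK' : K.Acyclic) (n : ℕ) (X : C) (hX : HasInjectiveDimensionLE X n) : HomExact K X := by
  induction n generalizing X with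
  | zero =>
    have : Injective X := injective_iff_hasInjectiveDimensionLT_one.2 hX
    exact homExact_of_injective hK' X
  | succ n hn =>
    let S : ShortComplex C := ShortComplex.mk (Injective.ι X) (cokernel.π (Injective.ι X)) (by simp)
    have hS : S.ShortExact := { exact := ShortComplex.exact_cokernel _ }
    have : Injective S.X₂ := inferInstanceAs (Injective (Injective.under X))
    exact HomExact.of_shortExact hK hS (homExact_of_injective hK' _)
      (hn _ ((hS.hasInjectiveDimensionLT_X₃_iff n inferInstance).2 hX))

/-- Projectives have finite injective dimension, so Hom-exactness into them follows by dimension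
shifting from the injective case. -/
lemma IsGorenstein.isCompleteProjectiveResolution {B : Type u} [Category.{v} B] [Abelian B]
    (hB : IsGorenstein B) {K : CochainComplex B ℤ} (hK : ∀ n, Projective (K.X n))
    (hK' : K.Acyclic) : IsCompleteProjectiveResolution K where
  projective := hK
  acyclic := hK'
  homExact P hP := by
    have := hB.enoughInjectives
    obtain ⟨n, hn⟩ := hB.injectiveDimension
    exact homExact_of_hasInjectiveDimensionLE hK hK' n P (hn P hP)

/-- The adjunction identifies the complexes $\operatorname{Hom}(\varphi K,X)$ and
$\operatorname{Hom}(K,\psi X)$. -/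
lemma HomExact.map_of_adjunction {C : Type u₁} [Category.{v₁} C] [Abelian C] {D : Type u₂}
    [Category.{v₂} D] [Abelian D] {φ : C ⥤ D} {ψ : D ⥤ C} [φ.Additive] [ψ.Additive]
    (adj : φ ⊣ ψ) {K : CochainComplex C ℤ} {X : D} (h : HomExact K (ψ.obj X)) :
    HomExact (mapCplx φ K) X := by
  intro n f hf
  let f' : φ.obj (K.X n) ⟶ X := f
  have hf' : φ.map (K.d (n - 1) n) ≫ f' = 0 := hf
  obtain ⟨g, hg⟩ := h n (adj.homEquiv _ _ f') (by
    rw [← adj.homEquiv_naturality_left, hf', adj.homEquiv_unit, ψ.map_zero, comp_zero])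
  refine ⟨(adj.homEquiv _ _).symm g, ?_⟩
  refine (adj.homEquiv_naturality_left_symm (K.d n (n + 1)) g).symm.trans ?_
  rw [hg, Equiv.symm_apply_apply]

lemma acyclic_of_shortExact {C : Type u} [Category.{v} C] [Abelian C]
    {S : ShortComplex (CochainComplex C ℤ)} (hS : S.ShortExact) (h₁ : S.X₁.Acyclic)
    (h₂ : S.X₂.Acyclic) : S.X₃.Acyclic :=
  hS.acyclic_X₃ ⟨fun i => (quasiIsoAt_iff_exactAt _ i (h₁ i)).2 (h₂ i)⟩

end HomExact

/-! ### Morphisms of the comma category and their components. -/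

section Components

variable {A : Type u₁} [Category.{v₁} A] {B : Type u₂} [Category.{v₂} B] {F : A ⥤ B}

lemma epi_of_components {W W' : LeftComma F} (f : W ⟶ W') [Epi f.left] [Epi f.right] : Epi f where
  left_cancellation g h hgh := by
    ext
    · rw [← cancel_epi f.left]
      exact congrArg (fun k => k.left) hgh
    · rw [← cancel_epi f.right]
      exact congrArg (fun k => k.right) hgh

lemma mono_of_components {W W' : LeftComma F} (f : W ⟶ W') [Mono f.left] [Mono f.right] :
    Mono f where
  right_cancellation g h hgh := by
    ext
    · rw [← cancel_mono f.left]
      exact congrArg (fun k => k.left) hgh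
    · rw [← cancel_mono f.right]
      exact congrArg (fun k => k.right) hgh

/-- The structure morphism of an object of the left comma category. -/
def str (W : LeftComma F) : F.obj W.left ⟶ W.right := W.hom

/-- Constructor for morphisms of the left comma category. -/
def commaHom {W W' : LeftComma F} (a : W.left ⟶ W'.left) (b : W.right ⟶ W'.right)
    (h : F.map a ≫ str W' = str W ≫ b) : W ⟶ W' where
  left := a
  right := b
  w := h

lemma str_naturality {W W' : LeftComma F} (f : W ⟶ W') :
    F.map f.left ≫ str W' = str W ≫ f.right := f.w

lemma str_naturality_assoc {W W' : LeftComma F} (f : W ⟶ W') {X : B} (g : W'.right ⟶ X) :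
    F.map f.left ≫ str W' ≫ g = str W ≫ f.right ≫ g := by
  rw [← Category.assoc, str_naturality, Category.assoc]

end Components

/-! ### Adjoint functors, exactness and projectives in the comma category. -/

section Comma

variable {A : Type u₁} [Category.{v₁} A] [Abelian A] {B : Type u₂} [Category.{v₂} B] [Abelian B]
  (F : A ⥤ B)

section

variable [PreservesFiniteColimits F]

instance : PreservesFiniteLimits (Comma.fst F (𝟭 B)) :=
  ⟨fun J _ _ => preservesLimitsOfShape_fst F J⟩

instance : PreservesFiniteLimits (Comma.snd F (𝟭 B)) :=
  ⟨fun J _ _ => preservesLimitsOfShape_snd F J⟩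

instance : PreservesFiniteColimits (Comma.fst F (𝟭 B)) where
  preservesFiniteColimits _ _ _ :=
    { preservesColimit :=
        preservesColimit_of_preserves_colimit_cocone
          (Comma.coconeOfPreservesIsColimit _ (colimit.isColimit _) (colimit.isColimit _))
          (colimit.isColimit _) }

instance : PreservesFiniteColimits (Comma.snd F (𝟭 B)) where
  preservesFiniteColimits _ _ _ :=
    { preservesColimit :=
        preservesColimit_of_preserves_colimit_cocone
          (Comma.coconeOfPreservesIsColimit _ (colimit.isColimit _) (colimit.isColimit _))
          (colimit.isColimit _) }

end

section

variable {F}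

/-- The projection onto the cokernel of the structure morphism. -/
def cokerπ (W : LeftComma F) : W.right ⟶ (cokerFunctor F).obj W := cokernel.π W.hom

instance (W : LeftComma F) : Epi (cokerπ W) := inferInstanceAs (Epi (cokernel.π W.hom))

@[simp]
lemma str_cokerπ (W : LeftComma F) : str W ≫ cokerπ W = 0 := cokernel.condition W.hom

lemma str_cokerπ_assoc (W : LeftComma F) {X : B} (g : (cokerFunctor F).obj W ⟶ X) :
    str W ≫ cokerπ W ≫ g = 0 := by
  rw [← Category.assoc, str_cokerπ, zero_comp]

/-- The morphism from the cokernel of the structure morphism induced by a morphism. -/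
def cokerDesc (W : LeftComma F) {X : B} (f : W.right ⟶ X) (h : str W ≫ f = 0) :
    (cokerFunctor F).obj W ⟶ X := cokernel.desc W.hom f h

@[simp]
lemma cokerπ_desc (W : LeftComma F) {X : B} (f : W.right ⟶ X) (h : str W ≫ f = 0) :
    cokerπ W ≫ cokerDesc W f h = f := cokernel.π_desc _ _ _

lemma cokerπ_desc_assoc (W : LeftComma F) {X Y : B} (f : W.right ⟶ X) (h : str W ≫ f = 0)
    (g : X ⟶ Y) : cokerπ W ≫ cokerDesc W f h ≫ g = f ≫ g := by
  rw [← Category.assoc, cokerπ_desc]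

@[simp]
lemma cokerπ_naturality {W W' : LeftComma F} (f : W ⟶ W') :
    cokerπ W ≫ (cokerFunctor F).map f = f.right ≫ cokerπ W' := cokernel.π_desc _ _ _

lemma cokerπ_naturality_assoc {W W' : LeftComma F} (f : W ⟶ W') {X : B}
    (g : (cokerFunctor F).obj W' ⟶ X) :
    cokerπ W ≫ (cokerFunctor F).map f ≫ g = f.right ≫ cokerπ W' ≫ g := by
  rw [← Category.assoc, cokerπ_naturality, Category.assoc]

end

variable [F.Additive]

/-- The functor `X ↦ (0, X)` is left adjoint to the second projection. -/
def zeroLeftAdjSnd : zeroLeftFunctor F ⊣ Comma.snd F (𝟭 B) where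
  unit :=
    { app := fun X => 𝟙 X
      naturality := fun X Y f => (Category.comp_id f).trans (Category.id_comp f).symm }
  counit :=
    { app := fun W => commaHom (W := (zeroLeftFunctor F).obj W.right) 0 (𝟙 W.right)
        ((IsZero.of_iso (isZero_zero B) F.mapZeroObject).eq_of_src _ _)
      naturality := fun W W' f => by
        ext
        · exact (isZero_zero A).eq_of_src _ _
        · exact (Category.comp_id f.right).trans (Category.id_comp f.right).symm }
  left_triangle_components X := by
    ext
    · exact (isZero_zero A).eq_of_src _ _
    · exact Category.id_comp _
  right_triangle_components W := Category.id_comp _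

/-- The functor `Y ↦ (Y, F Y)` is left adjoint to the first projection. -/
def freeAdjFst : freeFunctor F ⊣ Comma.fst F (𝟭 B) where
  unit :=
    { app := fun X => 𝟙 X
      naturality := fun X Y f => (Category.comp_id f).trans (Category.id_comp f).symm }
  counit :=
    { app := fun W => commaHom (W := (freeFunctor F).obj W.left) (𝟙 W.left) (str W)
        (congrArg (fun t => t ≫ str W) (F.map_id W.left))
      naturality := fun W W' f => by
        ext
        · exact (Category.comp_id f.left).trans (Category.id_comp f.left).symm
        · exact f.w }
  left_triangle_components X := by
    ext
    · exact Category.id_comp (𝟙 X)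
    · exact (Category.comp_id _).trans (F.map_id _)
  right_triangle_components W := Category.id_comp (𝟙 W.left)

/-- The cokernel functor is left adjoint to `X ↦ (0, X)`. -/
def cokerAdjZeroLeft : cokerFunctor F ⊣ zeroLeftFunctor F where
  unit :=
    { app := fun W => commaHom (W' := (zeroLeftFunctor F).obj ((cokerFunctor F).obj W))
        0 (cokerπ W) (((congrArg (fun t => t ≫ _) (F.map_zero _ _)).trans zero_comp).trans
          (str_cokerπ W).symm)
      naturality := fun W W' f => by
        ext
        · exact (isZero_zero A).eq_of_tgt _ _
        · exact (cokerπ_naturality f).symm }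
  counit :=
    { app := fun X => cokerDesc ((zeroLeftFunctor F).obj X) (𝟙 X)
        ((IsZero.of_iso (isZero_zero B) F.mapZeroObject).eq_of_src _ _)
      naturality := fun X X' f => by
        refine (cancel_epi (cokerπ ((zeroLeftFunctor F).obj X))).1 ?_
        refine (cokerπ_naturality_assoc ((zeroLeftFunctor F).map f) _).trans ?_
        refine Eq.trans ?_ (cokerπ_desc_assoc _ _ _ f).symm
        exact ((congrArg (fun t => f ≫ t) (cokerπ_desc _ _ _)).trans (Category.comp_id f)).trans
          (Category.id_comp f).symm }
  left_triangle_components W := by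
    refine (cancel_epi (cokerπ W)).1 ?_
    refine (cokerπ_naturality_assoc _ _).trans ?_
    exact ((congrArg (fun t => cokerπ W ≫ t) (cokerπ_desc _ _ _)))
  right_triangle_components X := by
    ext
    · exact (isZero_zero A).eq_of_src _ _
    · exact cokerπ_desc _ _ _

/-- The functor `Y ↦ (Y, 0)`. -/
def zeroRightFunctor : A ⥤ LeftComma F where
  obj Y := { left := Y, right := 0, hom := 0 }
  map f := { left := f, right := 0, w := (isZero_zero B).eq_of_tgt _ _ }

/-- The functor `Y ↦ (Y, 0)` is right adjoint to the first projection. -/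
def fstAdjZeroRight : Comma.fst F (𝟭 B) ⊣ zeroRightFunctor F where
  unit :=
    { app := fun W => commaHom (W' := (zeroRightFunctor F).obj W.left) (𝟙 W.left) 0
        ((isZero_zero B).eq_of_tgt _ _)
      naturality := fun W W' f => by
        ext
        · exact (Category.comp_id f.left).trans (Category.id_comp f.left).symm
        · exact (isZero_zero B).eq_of_tgt _ _ }
  counit :=
    { app := fun Y => 𝟙 Y
      naturality := fun X Y f => (Category.comp_id f).trans (Category.id_comp f).symm }
  left_triangle_components W := Category.id_comp (𝟙 W.left)
  right_triangle_components Y := by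
    ext
    · exact Category.id_comp (𝟙 Y)
    · exact (isZero_zero B).eq_of_src _ _

instance : (zeroLeftFunctor F).Additive where
  map_add := by
    intros
    ext
    · exact (isZero_zero A).eq_of_src _ _
    · rfl

instance : (freeFunctor F).Additive where
  map_add := by
    intros
    ext
    · rfl
    · exact F.map_add

instance : (cokerFunctor F).Additive where
  map_add := by
    intro W W' f g
    rw [← cancel_epi (cokerπ W), Preadditive.comp_add, cokerπ_naturality, cokerπ_naturality,
      cokerπ_naturality, ← Preadditive.add_comp]
    rfl

variable {F}

lemma isZero_of_components {W : LeftComma F} (h₁ : IsZero W.left) (h₂ : IsZero W.right) :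
    IsZero W := by
  rw [IsZero.iff_id_eq_zero]
  ext
  · exact h₁.eq_of_src _ _
  · exact h₂.eq_of_src _ _

variable [PreservesFiniteColimits F]

/-- Both projections are exact, so homology is computed componentwise, and an object with zero
components is zero. -/
lemma exact_of_components {S : ShortComplex (LeftComma F)}
    (h₁ : (S.map (Comma.fst F (𝟭 B))).Exact) (h₂ : (S.map (Comma.snd F (𝟭 B))).Exact) :
    S.Exact := by
  rw [ShortComplex.exact_iff_isZero_homology] at h₁ h₂ ⊢
  exact isZero_of_components (h₁.of_iso (S.mapHomologyIso (Comma.fst F (𝟭 B))).symm)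
    (h₂.of_iso (S.mapHomologyIso (Comma.snd F (𝟭 B))).symm)

lemma shortExact_of_components {S : ShortComplex (LeftComma F)}
    (h₁ : (S.map (Comma.fst F (𝟭 B))).ShortExact) (h₂ : (S.map (Comma.snd F (𝟭 B))).ShortExact) :
    S.ShortExact where
  exact := exact_of_components h₁.exact h₂.exact
  mono_f :=
    have : Mono S.f.left := h₁.mono_f
    have : Mono S.f.right := h₂.mono_f
    mono_of_components _
  epi_g :=
    have : Epi S.g.left := h₁.epi_g
    have : Epi S.g.right := h₂.epi_g
    epi_of_components _

lemma acyclic_of_components {K : CochainComplex (LeftComma F) ℤ}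
    (h₁ : (mapCplx (Comma.fst F (𝟭 B)) K).Acyclic) (h₂ : (mapCplx (Comma.snd F (𝟭 B)) K).Acyclic) :
    K.Acyclic :=
  fun n => exact_of_components (h₁ n) (h₂ n)

lemma acyclic_fst {K : CochainComplex (LeftComma F) ℤ} (hK : K.Acyclic) :
    (mapCplx (Comma.fst F (𝟭 B)) K).Acyclic :=
  fun n => ShortComplex.Exact.map (hK n) (Comma.fst F (𝟭 B))

lemma acyclic_snd {K : CochainComplex (LeftComma F) ℤ} (hK : K.Acyclic) :
    (mapCplx (Comma.snd F (𝟭 B)) K).Acyclic :=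
  fun n => ShortComplex.Exact.map (hK n) (Comma.snd F (𝟭 B))

instance : (zeroLeftFunctor F).PreservesEpimorphisms where
  preserves f _ :=
    have : Epi ((zeroLeftFunctor F).map f).left := ⟨fun _ _ _ => (isZero_zero A).eq_of_src _ _⟩
    have : Epi ((zeroLeftFunctor F).map f).right := inferInstanceAs (Epi f)
    epi_of_components _

instance : (zeroRightFunctor F).PreservesEpimorphisms where
  preserves f _ :=
    have : Epi ((zeroRightFunctor F).map f).left := inferInstanceAs (Epi f)
    have : Epi ((zeroRightFunctor F).map f).right := ⟨fun _ _ _ => (isZero_zero B).eq_of_src _ _⟩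
    epi_of_components _

instance : (freeFunctor F).PreservesEpimorphisms where
  preserves f _ :=
    have : Epi ((freeFunctor F).map f).left := inferInstanceAs (Epi f)
    have : Epi ((freeFunctor F).map f).right := inferInstanceAs (Epi (F.map f))
    epi_of_components _

instance : (cokerFunctor F).PreservesEpimorphisms :=
  Functor.preservesEpimorphisms_of_adjunction (cokerAdjZeroLeft F)

/-- This and the next three statements have one cause: a left adjoint preserves projectives when its
right adjoint preserves epimorphisms. -/
lemma projective_zeroLeft (P : B) (hP : Projective P) : Projective ((zeroLeftFunctor F).obj P) :=
  (zeroLeftAdjSnd F).map_projective P hP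

lemma projective_free (Q : A) (hQ : Projective Q) : Projective ((freeFunctor F).obj Q) :=
  (freeAdjFst F).map_projective Q hQ

lemma projective_coker (W : LeftComma F) (hW : Projective W) :
    Projective ((cokerFunctor F).obj W) :=
  (cokerAdjZeroLeft F).map_projective W hW

lemma projective_fst (W : LeftComma F) (hW : Projective W) :
    Projective ((Comma.fst F (𝟭 B)).obj W) :=
  (fstAdjZeroRight F).map_projective W hW

/-- The object $(Y,FY\oplus X)$, with the first inclusion as structure morphism, maps onto
$(Y,X)_\phi$ by the identity and $(\phi,1)$. A section is the identity on $Y$, so its second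
component composed with the projection to $FY$ retracts $\phi$. No supply of projectives is used. -/
lemma exists_retraction_of_projective (W : LeftComma F) [Projective W] :
    ∃ r : W.right ⟶ F.obj W.left, str W ≫ r = 𝟙 _ := by
  let V : LeftComma F := { left := W.left, right := F.obj W.left ⊞ W.right, hom := biprod.inl }
  let p : V ⟶ W := commaHom (𝟙 W.left) (biprod.desc (str W) (𝟙 W.right))
    (((congrArg (fun t => t ≫ str W) (F.map_id W.left)).trans (Category.id_comp _)).trans
      (biprod.inl_desc _ _).symm)
  have : Epi p.left := inferInstanceAs (Epi (𝟙 _))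
  have : Epi p.right := by
    have h : (biprod.inr : W.right ⟶ F.obj W.left ⊞ W.right) ≫ biprod.desc (str W) (𝟙 W.right) =
      𝟙 _ := biprod.inr_desc _ _
    exact epi_of_epi_fac h
  have : Epi p := epi_of_components p
  let s : W ⟶ V := Projective.factorThru (𝟙 W) p
  have hs : s ≫ p = 𝟙 W := Projective.factorThru_comp _ _
  let s' : W.right ⟶ F.obj W.left ⊞ W.right := s.right
  have hl : s.left = 𝟙 W.left :=
    (Category.comp_id _).symm.trans (congrArg (fun k => k.left) hs)
  have hw : str W ≫ s' = biprod.inl :=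
    s.w.symm.trans (((congrArg (fun t => F.map t ≫ biprod.inl) hl).trans
      (congrArg (fun t => t ≫ biprod.inl) (F.map_id _))).trans (Category.id_comp _))
  exact ⟨s' ≫ biprod.fst, by rw [reassoc_of% hw, biprod.inl_fst]⟩

/-- The retraction splits $\phi$, which makes $X$ a direct summand of
$FY\oplus\operatorname{Coker}\phi$; both summands are projective. -/
lemma projective_snd (hproj : F.PreservesProjectiveObjects) (W : LeftComma F)
    (hW : Projective W) : Projective ((Comma.snd F (𝟭 B)).obj W) := by
  obtain ⟨r, hr⟩ := exists_retraction_of_projective W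
  have : Projective W.left := projective_fst W hW
  have : Projective (F.obj W.left) := hproj.projective_obj this
  have : Projective ((cokerFunctor F).obj W) := projective_coker W hW
  have h : str W ≫ (𝟙 W.right - r ≫ str W) = 0 := by
    rw [Preadditive.comp_sub, reassoc_of% hr, Category.comp_id, sub_self]
  let ρ : Retract W.right (F.obj W.left ⊞ (cokerFunctor F).obj W) :=
    { i := biprod.lift r (cokerπ W)
      r := biprod.desc (str W) (cokerDesc _ _ h)
      retract := by rw [biprod.lift_desc, cokerπ_desc, add_sub_cancel] }
  exact ρ.projective

end Comma


/-! ### The functors of the recollement preserve complete resolutions. -/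

section CompleteResolutions

variable {A : Type u₁} [Category.{v₁} A] [Abelian A] {B : Type u₂} [Category.{v₂} B] [Abelian B]
  {F : A ⥤ B} [F.Additive] [PreservesFiniteColimits F]

open HomologicalComplex

lemma zeroLeft_preservesCompleteResolutions (hproj : F.PreservesProjectiveObjects) :
    PreservesCompleteResolutions (zeroLeftFunctor F) := fun _ hK =>
  { projective := fun n => projective_zeroLeft _ (hK.projective n)
    acyclic := acyclic_of_components
      (fun _ => ShortComplex.exact_of_isZero_X₂ _ (isZero_zero A)) hK.acyclic
    homExact := fun W hW => HomExact.map_of_adjunction (zeroLeftAdjSnd F)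
      (hK.homExact _ (projective_snd hproj W hW)) }

lemma free_preservesCompleteResolutions (hF : IsPerfect F) :
    PreservesCompleteResolutions (freeFunctor F) := fun K hK =>
  { projective := fun n => projective_free _ (hK.projective n)
    acyclic := acyclic_of_components hK.acyclic (hF.acyclic_map K hK.projective hK.acyclic)
    homExact := fun W hW => HomExact.map_of_adjunction (freeAdjFst F)
      (hK.homExact _ (projective_fst W hW)) }

variable (F) in
/-- The short complex formed by the structure morphisms of a complex and their cokernels. -/
def strShortComplex (K : CochainComplex (LeftComma F) ℤ) : ShortComplex (CochainComplex B ℤ) where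
  X₁ := mapCplx F (mapCplx (Comma.fst F (𝟭 B)) K)
  X₂ := mapCplx (Comma.snd F (𝟭 B)) K
  X₃ := mapCplx (cokerFunctor F) K
  f :=
    { f := fun n => str (K.X n)
      comm' := fun i j _ => (str_naturality (K.d i j)).symm }
  g :=
    { f := fun n => cokerπ (K.X n)
      comm' := fun i j _ => cokerπ_naturality (K.d i j) }
  zero := by
    ext n
    exact str_cokerπ (K.X n)

lemma strShortComplex_shortExact {K : CochainComplex (LeftComma F) ℤ}
    (hK : ∀ n, Projective (K.X n)) : (strShortComplex F K).ShortExact := by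
  refine shortExact_of_degreewise_shortExact _ (fun n => ?_)
  obtain ⟨r, hr⟩ := exists_retraction_of_projective (K.X n)
  exact
    { exact := ShortComplex.exact_cokernel (K.X n).hom
      mono_f := (SplitMono.mk r hr).mono
      epi_g := inferInstanceAs (Epi (cokerπ (K.X n))) }

/-- Structure morphisms of projectives are split monomorphisms, so $0\to FY^\bullet\to
X^\bullet\to\operatorname{Coker}\to0$ is exact. The first complex is acyclic by perfectness, the
second by exactness of the projection, hence so is the third. -/
lemma coker_preservesCompleteResolutions (hF : IsPerfect F) :
    PreservesCompleteResolutions (cokerFunctor F) := fun _ hK =>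
  { projective := fun n => projective_coker _ (hK.projective n)
    acyclic := acyclic_of_shortExact (strShortComplex_shortExact hK.projective)
      (hF.acyclic_map _ (fun n => projective_fst _ (hK.projective n)) (acyclic_fst hK.acyclic))
      (acyclic_snd hK.acyclic)
    homExact := fun P hP => HomExact.map_of_adjunction (cokerAdjZeroLeft F)
      (hK.homExact _ (projective_zeroLeft P hP)) }

lemma snd_preservesCompleteResolutions (hproj : F.PreservesProjectiveObjects)
    (hB : IsGorenstein B) : PreservesCompleteResolutions (Comma.snd F (𝟭 B)) := fun _ hK =>
  hB.isCompleteProjectiveResolution (fun n => projective_snd hproj _ (hK.projective n))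
    (acyclic_snd hK.acyclic)

lemma preservesCompleteResolutions_of_isPerfect (hF : IsPerfect F)
    (hproj : F.PreservesProjectiveObjects) (hB : IsGorenstein B) :
    PreservesCompleteResolutions F := fun K hK =>
  hB.isCompleteProjectiveResolution (fun n => hproj.projective_obj (hK.projective n))
    (hF.acyclic_map K hK.projective hK.acyclic)

/-- The right adjoint $Q\mapsto(Q,0)$ need not preserve projectives, so adjunction does not settle
Hom-exactness. Instead a cocycle $Y^n\to Q$ is extended to a cocycle with values in the projective
$(Q,FQ)$, where Hom-exactness is available. -/
lemma fst_preservesCompleteResolutions (hF : IsPerfect F)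
    (hproj : F.PreservesProjectiveObjects) :
    PreservesCompleteResolutions (Comma.fst F (𝟭 B)) := fun K hK =>
  { projective := fun n => projective_fst _ (hK.projective n)
    acyclic := acyclic_fst hK.acyclic
    homExact := fun Q hQ n f hf => by
      let f' : (K.X n).left ⟶ Q := f
      have hf' : (K.d (n - 1) n).left ≫ f' = 0 := hf
      have := hK.projective n
      obtain ⟨r, hr⟩ := exists_retraction_of_projective (K.X n)
      have hcoker := (coker_preservesCompleteResolutions hF K hK).homExact (F.obj Q)
        (hproj.projective_obj hQ)
      have h₁ : str (K.X (n - 1)) ≫ (K.d (n - 1) n).right ≫ r ≫ F.map f' = 0 := by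
        rw [← str_naturality_assoc, reassoc_of% hr, ← F.map_comp, hf', F.map_zero]
      -- The first candidate for the second component is `r ≫ F.map f'`. Its failure to be a cocycle
      -- vanishes on the structure morphism, so it is a cocycle on the complex of cokernels; that
      -- complex is complete and `F.obj Q` is projective, so it is a coboundary. Subtracting `c'`
      -- corrects the candidate without disturbing compatibility with `f'`.
      obtain ⟨c', hc'⟩ : ∃ c' : (cokerFunctor F).obj (K.X n) ⟶ F.obj Q,
          (cokerFunctor F).map (K.d (n - 1) n) ≫ c' = cokerDesc _ _ h₁ := by
        refine hcoker.exists_desc (n - 1 - 1) (n - 1) n (by lia) (by lia) (cokerDesc _ _ h₁) ?_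
        refine (cancel_epi (cokerπ (K.X (n - 1 - 1)))).1 (Eq.trans ?_ comp_zero.symm)
        refine (cokerπ_naturality_assoc (K.d (n - 1 - 1) (n - 1)) _).trans ?_
        have hdd : (K.d (n - 1 - 1) (n - 1)).right ≫ (K.d (n - 1) n).right = 0 :=
          congrArg (fun k => k.right) (K.d_comp_d (n - 1 - 1) (n - 1) n)
        rw [cokerπ_desc, reassoc_of% hdd, zero_comp]
      have h₂ : F.map f' ≫ str ((freeFunctor F).obj Q) =
          str (K.X n) ≫ (r ≫ F.map f' - cokerπ (K.X n) ≫ c') := by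
        rw [Preadditive.comp_sub, reassoc_of% hr, str_cokerπ_assoc, sub_zero]
        exact Category.comp_id _
      have := projective_free (F := F) Q hQ
      obtain ⟨g, hg⟩ := hK.homExact ((freeFunctor F).obj Q) inferInstance n (commaHom f' _ h₂) (by
        ext
        · exact hf'
        · change (K.d (n - 1) n).right ≫ (r ≫ F.map f' - cokerπ (K.X n) ≫ c') = 0
          rw [Preadditive.comp_sub, ← cokerπ_naturality_assoc, hc', cokerπ_desc, sub_self])
      exact ⟨g.left, congrArg (fun k => k.left) hg⟩ }

end CompleteResolutions

/-! ### Gorenstein projective objects of the comma category. -/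

section GorensteinProjectives

variable {A : Type u₁} [Category.{v₁} A] [Abelian A] {B : Type u₂} [Category.{v₂} B] [Abelian B]
  {F : A ⥤ B} [F.Additive] [PreservesFiniteColimits F]

open HomologicalComplex

/-- The sequence `(Y, F Y) ⟶ (Y, X) ⟶ (0, coker)`. -/
def strSequence (W : LeftComma F) : ShortComplex (LeftComma F) where
  X₁ := (freeFunctor F).obj W.left
  X₂ := W
  X₃ := (zeroLeftFunctor F).obj ((cokerFunctor F).obj W)
  f := (freeAdjFst F).counit.app W
  g := (cokerAdjZeroLeft F).unit.app W
  zero := by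
    ext
    · exact (isZero_zero A).eq_of_tgt _ _
    · exact str_cokerπ W

lemma strSequence_shortExact (W : LeftComma F) [Mono W.hom] : (strSequence W).ShortExact := by
  refine shortExact_of_components ?_ ?_
  · exact ShortComplex.Splitting.shortExact
      { r := 𝟙 W.left
        s := 0
        f_r := Category.comp_id (𝟙 W.left)
        s_g := (isZero_zero A).eq_of_src _ _
        id := ((congrArg (fun t => 𝟙 W.left ≫ 𝟙 W.left + t) comp_zero).trans
          (add_zero _)).trans (Category.comp_id (𝟙 W.left)) }
  · exact
      { exact := ShortComplex.exact_cokernel W.hom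
        mono_f := inferInstanceAs (Mono W.hom)
        epi_g := inferInstanceAs (Epi (cokerπ W)) }

lemma GP_of_components (hF : IsPerfect F) (hproj : F.PreservesProjectiveObjects)
    (W : LeftComma F) (h₁ : GP A W.left) [Mono W.hom] (h₂ : GP B ((cokerFunctor F).obj W)) :
    GP (LeftComma F) W :=
  GP.of_shortExact (strSequence_shortExact W)
    ((free_preservesCompleteResolutions hF).GP_obj _ h₁)
    ((zeroLeft_preservesCompleteResolutions hproj).GP_obj _ h₂)

/-- Embed $W$ in a projective term of a complete resolution. Perfectness makes $F$ commute with
cycles of the first components, so $F$ keeps this embedding mono on $Y$; the structure morphism of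
the projective is a split mono. The composite factors through the structure morphism of $W$. -/
lemma mono_hom_of_GP (hF : IsPerfect F) (W : LeftComma F) (hW : GP (LeftComma F) W) :
    Mono W.hom := by
  obtain ⟨K, hK, ⟨e⟩⟩ := (GP_iff _).1 hW
  let i : W ⟶ K.X 0 := e.hom ≫ K.iCycles 0
  let L := mapCplx (Comma.fst F (𝟭 B)) K
  have hL : L.Acyclic := acyclic_fst hK.acyclic
  have hFL : (mapCplx F L).Acyclic :=
    hF.acyclic_map _ (fun n => projective_fst _ (hK.projective n)) hL
  have := isIso_mapCyclesHom F hL hFL 0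
  have := isIso_mapCyclesHom (Comma.fst F (𝟭 B)) hK.acyclic hL 0
  have hi : F.map i.left = F.map e.hom.left ≫ F.map (mapCyclesHom (Comma.fst F (𝟭 B)) K 0) ≫
      mapCyclesHom F L 0 ≫ mapICycles F L 0 := by
    rw [mapCyclesHom_mapICycles, ← F.map_comp, ← F.map_comp]
    exact congrArg (fun t => F.map (e.hom.left ≫ t))
      (mapCyclesHom_mapICycles (Comma.fst F (𝟭 B)) K 0).symm
  have hmono : Mono (F.map i.left) := by
    have hι : Mono (mapICycles F L 0) := inferInstance
    rw [hi]
    have : IsIso e.hom.left := inferInstanceAs (IsIso ((Comma.fst F (𝟭 B)).map e.hom))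
    exact mono_comp' inferInstance (mono_comp' inferInstance (mono_comp' inferInstance hι))
  have hr : Mono (str (K.X 0)) := by
    have := hK.projective 0
    obtain ⟨r, hr⟩ := exists_retraction_of_projective (K.X 0)
    exact (SplitMono.mk r hr).mono
  have : Mono (str W ≫ i.right) := by
    rw [← str_naturality]
    infer_instance
  exact mono_of_mono (str W) i.right

lemma GP.exists_embedding {C : Type u} [Category.{v} C] [Abelian C] {X : C} (hX : GP C X) :
    ∃ (P : C) (ι : X ⟶ P), Projective P ∧ Mono ι ∧ GP C (cokernel ι) := by
  obtain ⟨K, hK, ⟨e⟩⟩ := (GP_iff _).1 hX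
  have hS := cyclesShortComplex_shortExact hK.acyclic 0 1 rfl
  have := hS.epi_g
  refine ⟨K.X 0, e.hom ≫ K.iCycles 0, hK.projective 0, inferInstance, ?_⟩
  exact (GP C).prop_of_iso ((cokernelEpiComp e.hom (K.iCycles 0) ≪≫
    IsColimit.coconePointUniqueUpToIso (colimit.isColimit _)
      hS.gIsCokernel).symm) (hK.GP_cycles 1)

end GorensteinProjectives


/-! ### The exact sequence of cokernels of a composite. -/

section CokernelComp

variable {C : Type u} [Category.{v} C] [Abelian C] {X Y Z : C} (f : X ⟶ Y) (g : Y ⟶ Z)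

/-- The sequence of the cokernels of `f`, `f ≫ g` and `g`. -/
def cokernelCompSequence : ShortComplex C where
  X₁ := cokernel f
  X₂ := cokernel (f ≫ g)
  X₃ := cokernel g
  f := cokernel.desc f (g ≫ cokernel.π (f ≫ g)) (by
    rw [← Category.assoc, cokernel.condition])
  g := cokernel.desc (f ≫ g) (cokernel.π g) (by simp)
  zero := by
    rw [← cancel_epi (cokernel.π f)]
    simp

lemma cokernelCompSequence_shortExact [Mono g] : (cokernelCompSequence f g).ShortExact where
  exact := by
    rw [ShortComplex.exact_iff_exact_up_to_refinements]
    intro T x hx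
    let x' : T ⟶ cokernel (f ≫ g) := x
    have hx' : x' ≫ cokernel.desc (f ≫ g) (cokernel.π g) (by simp) = 0 := hx
    obtain ⟨T₁, π₁, _, z, hz⟩ := surjective_up_to_refinements_of_epi (cokernel.π (f ≫ g)) x'
    obtain ⟨T₂, π₂, _, y, hy⟩ := (ShortComplex.exact_cokernel g).exact_up_to_refinements z (by
      have := π₁ ≫= hx'
      rw [reassoc_of% hz, cokernel.π_desc, comp_zero] at this
      exact this)
    refine ⟨T₂, π₂ ≫ π₁, inferInstance, y ≫ cokernel.π f, ?_⟩
    have hy' : π₂ ≫ z = y ≫ g := hy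
    change (π₂ ≫ π₁) ≫ x' = (y ≫ cokernel.π f) ≫ cokernel.desc f _ _
    rw [Category.assoc, hz, reassoc_of% hy', Category.assoc, cokernel.π_desc]
  mono_f := by
    suffices Mono (cokernel.desc f (g ≫ cokernel.π (f ≫ g)) (by
      rw [← Category.assoc, cokernel.condition])) from this
    refine Preadditive.mono_of_cancel_zero _ (fun {T} x hx' => ?_)
    obtain ⟨T₁, π₁, _, y, hy⟩ := surjective_up_to_refinements_of_epi (cokernel.π f) x
    obtain ⟨T₂, π₂, _, z, hz⟩ :=
      (ShortComplex.exact_cokernel (f ≫ g)).exact_up_to_refinements (y ≫ g) (by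
        have := π₁ ≫= hx'
        rw [reassoc_of% hy, cokernel.π_desc, comp_zero] at this
        exact (Category.assoc _ _ _).trans this)
    have hz' : π₂ ≫ y ≫ g = z ≫ f ≫ g := hz
    have h : π₂ ≫ y = z ≫ f := by
      rw [← cancel_mono g, Category.assoc, Category.assoc, hz']
    rw [← cancel_epi π₁, ← cancel_epi π₂, comp_zero, comp_zero, hy, reassoc_of% h,
      cokernel.condition, comp_zero]
  epi_g := by
    have h : cokernel.π (f ≫ g) ≫ cokernel.desc (f ≫ g) (cokernel.π g) (by simp) = cokernel.π g :=
      cokernel.π_desc _ _ _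
    have : Epi (cokernel.desc (f ≫ g) (cokernel.π g) (by simp)) := epi_of_epi_fac h
    exact this

end CokernelComp

/-! ### Copresentations and the right adjoint of the first projection. -/

section Copresentations

variable {A : Type u₁} [Category.{v₁} A] [Abelian A] {B : Type u₂} [Category.{v₂} B] [Abelian B]
  {F : A ⥤ B} [F.Additive] [PreservesFiniteColimits F]

lemma IsProjectiveCopresentation.GP (hF : IsPerfect F) (hproj : F.PreservesProjectiveObjects)
    {W : LeftComma F} (hW : IsProjectiveCopresentation F W) : GP (LeftComma F) W :=
  have := hW.2.1
  GP_of_components hF hproj W hW.1 hW.2.2.2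

lemma exists_copresentation (hF : IsPerfect F) (hproj : F.PreservesProjectiveObjects)
    (hB : IsGorenstein B) (Y : A) (hY : GP A Y) : ∃ (P : B) (φ : F.obj Y ⟶ P),
      IsProjectiveCopresentation F { left := Y, right := P, hom := φ } := by
  obtain ⟨P, ι, h₁, h₂, h₃⟩ := GP.exists_embedding
    ((preservesCompleteResolutions_of_isPerfect hF hproj hB).GP_obj Y hY)
  exact ⟨P, ι, hY, h₂, h₁, h₃⟩

/-- The structure morphism is mono with Gorenstein projective cokernel, so extensions to projectives
are unobstructed. Both fullness and faithfulness of `stableFst` towards copresentations rest on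
this. -/
lemma exists_extension_of_GP (hF : IsPerfect F) {W : LeftComma F} (hW : GP (LeftComma F) W)
    {P : B} [Projective P] (f : F.obj W.left ⟶ P) : ∃ g : W.right ⟶ P, str W ≫ g = f := by
  have := mono_hom_of_GP hF W hW
  let S : ShortComplex B := ShortComplex.mk (str W) (cokerπ W) (str_cokerπ W)
  have hS : S.ShortExact :=
    { exact := ShortComplex.exact_cokernel W.hom
      mono_f := inferInstanceAs (Mono W.hom)
      epi_g := inferInstanceAs (Epi (cokerπ W)) }
  exact GP.exists_extension hS ((coker_preservesCompleteResolutions hF).GP_obj W hW) f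

variable (hF : IsPerfect F) (hproj : F.PreservesProjectiveObjects)

/-- The functor `j^*`. -/
abbrev stableFst : StableGP (LeftComma F) ⥤ StableGP A :=
  stableMap (Comma.fst F (𝟭 B)) projective_fst (fst_preservesCompleteResolutions hF hproj).GP_obj

lemma stableFst_surjective {W W' : (GP (LeftComma F)).FullSubcategory}
    (hW' : IsProjectiveCopresentation F W'.obj) :
    Function.Surjective (fun g : (toStable _).obj W ⟶ (toStable _).obj W' =>
      (stableFst hF hproj).map g) := by
  intro f
  obtain ⟨f, rfl⟩ := (toStable A).map_surjective f
  let f' : W.obj.left ⟶ W'.obj.left := f.hom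
  have := hW'.2.2.1
  obtain ⟨g, hg⟩ := exists_extension_of_GP hF W.property (F.map f' ≫ str W'.obj)
  exact ⟨(toStable _).map (ObjectProperty.homMk (commaHom f' g hg.symm)), rfl⟩

/-- A factorization of the first component through $Q$ lifts to one through $(Q,FQ)$. The remaining
difference has zero first component and vanishes on the structure morphism, hence passes through
$(0,P')$ with $P'$ the projective second component of the target. Together they give a factorization
through a projective. -/
lemma stableFst_injective {W W' : (GP (LeftComma F)).FullSubcategory}
    (hW' : IsProjectiveCopresentation F W'.obj) :
    Function.Injective (fun g : (toStable _).obj W ⟶ (toStable _).obj W' =>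
      (stableFst hF hproj).map g) := by
  intro f g hfg
  obtain ⟨f, rfl⟩ := (toStable _).map_surjective f
  obtain ⟨g, rfl⟩ := (toStable _).map_surjective g
  let d : W.obj ⟶ W'.obj := f.hom - g.hom
  obtain ⟨Q, hQ, a, b, hab⟩ : ∃ (Q : A) (_ : Projective Q) (a : W.obj.left ⟶ Q)
      (b : Q ⟶ W'.obj.left), d.left = a ≫ b := (toStable_map_eq_iff _ _).1 hfg
  have hd : d.left = a ≫ b := hab
  have : Projective (F.obj Q) := hproj.projective_obj hQ
  have hP' : Projective W'.obj.right := hW'.2.2.1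
  obtain ⟨c, hc⟩ := exists_extension_of_GP hF W.property (F.map a)
  let α : W.obj ⟶ (freeFunctor F).obj Q :=
    commaHom a c ((Category.comp_id _).trans hc.symm)
  let β : (freeFunctor F).obj Q ⟶ W'.obj :=
    commaHom b (F.map b ≫ str W'.obj) (Category.id_comp _).symm
  have h : str W.obj ≫ (d.right - c ≫ F.map b ≫ str W'.obj) = 0 := by
    rw [Preadditive.comp_sub, ← str_naturality, hd, reassoc_of% hc, F.map_comp, Category.assoc,
      sub_self]
  let γ : W.obj ⟶ (zeroLeftFunctor F).obj W'.obj.right :=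
    commaHom 0 (d.right - c ≫ F.map b ≫ str W'.obj)
      (((congrArg (fun t => t ≫ _) (F.map_zero _ _)).trans zero_comp).trans h.symm)
  let ε : (zeroLeftFunctor F).obj W'.obj.right ⟶ W'.obj := (zeroLeftAdjSnd F).counit.app W'.obj
  have := projective_free (F := F) Q hQ
  have := projective_zeroLeft (F := F) W'.obj.right hP'
  refine toStable_map_eq_of_factor f g (biprod.lift α γ) (biprod.desc β ε) ?_
  rw [biprod.lift_desc]
  ext
  · refine hd.trans (Eq.trans ?_ (congrArg (fun t => a ≫ b + t) zero_comp.symm))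
    exact (add_zero _).symm
  · change d.right = c ≫ F.map b ≫ str W'.obj + (d.right - c ≫ F.map b ≫ str W'.obj) ≫ 𝟙 _
    rw [Category.comp_id, add_sub_cancel]

lemma stableFst_bijective (W : StableGP (LeftComma F)) {W' : (GP (LeftComma F)).FullSubcategory}
    (hW' : IsProjectiveCopresentation F W'.obj) :
    Function.Bijective (fun g : W ⟶ (toStable _).obj W' => (stableFst hF hproj).map g) :=
  ⟨stableFst_injective hF hproj (W := W.as) hW', stableFst_surjective hF hproj (W := W.as) hW'⟩

variable (hB : IsGorenstein B)

/-- A chosen copresentation of a Gorenstein projective object. -/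
def copresentation (Y : (GP A).FullSubcategory) : (GP (LeftComma F)).FullSubcategory :=
  ⟨{ left := Y.obj
     right := (exists_copresentation hF hproj hB Y.obj Y.property).choose
     hom := (exists_copresentation hF hproj hB Y.obj Y.property).choose_spec.choose },
    (exists_copresentation hF hproj hB Y.obj Y.property).choose_spec.choose_spec.GP hF hproj⟩

lemma copresentation_isProjectiveCopresentation (Y : (GP A).FullSubcategory) :
    IsProjectiveCopresentation F (copresentation hF hproj hB Y).obj :=
  (exists_copresentation hF hproj hB Y.obj Y.property).choose_spec.choose_spec

/-- The bijection defining the right adjoint of `stableFst`. -/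
def copresentationEquiv (W : StableGP (LeftComma F)) (Y : StableGP A) :
    ((stableFst hF hproj).obj W ⟶ Y) ≃
      (W ⟶ (toStable _).obj (copresentation hF hproj hB Y.as)) :=
  (Equiv.ofBijective (fun g : W ⟶ (toStable _).obj (copresentation hF hproj hB Y.as) =>
    ((stableFst hF hproj).map g : (stableFst hF hproj).obj W ⟶ Y)) (stableFst_bijective hF hproj W
      (copresentation_isProjectiveCopresentation hF hproj hB Y.as))).symm

lemma copresentationEquiv_naturality (W' W : StableGP (LeftComma F)) (Y : StableGP A)
    (f : W' ⟶ W) (g : (stableFst hF hproj).obj W ⟶ Y) :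
    copresentationEquiv hF hproj hB W' Y ((stableFst hF hproj).map f ≫ g) =
      f ≫ copresentationEquiv hF hproj hB W Y g := by
  rw [← Equiv.eq_symm_apply]
  obtain ⟨g, rfl⟩ := (copresentationEquiv hF hproj hB W Y).symm.surjective g
  rw [Equiv.apply_symm_apply]
  exact ((stableFst hF hproj).map_comp f g).symm

/-- The functor `j_*`. -/
def stableCopresentation : StableGP A ⥤ StableGP (LeftComma F) :=
  Adjunction.rightAdjointOfEquiv (copresentationEquiv hF hproj hB)
    (copresentationEquiv_naturality hF hproj hB)

/-- The functor `j_*` is right adjoint to `j^*`. -/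
def stableFstAdj : stableFst hF hproj ⊣ stableCopresentation hF hproj hB :=
  Adjunction.adjunctionOfEquivRight (copresentationEquiv hF hproj hB)
    (copresentationEquiv_naturality hF hproj hB)

lemma stableFst_map_unit (W : StableGP (LeftComma F)) :
    (stableFst hF hproj).map ((stableFstAdj hF hproj hB).unit.app W) =
      𝟙 ((stableFst hF hproj).obj W) := by
  have h : (stableFstAdj hF hproj hB).unit.app W = copresentationEquiv hF hproj hB W _ (𝟙 _) := by
    simp only [stableFstAdj, Adjunction.adjunctionOfEquivRight_unit_app]
    rfl
  rw [h]
  exact (copresentationEquiv hF hproj hB W _).symm_apply_apply (𝟙 _)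

/-- The chosen copresentation has first component $Y$ on the nose, and the adjunction bijection is
inverse to applying `stableFst`; so the counit is the identity. -/
lemma stableFstAdj_counit_app (Y : StableGP A) :
    (stableFstAdj hF hproj hB).counit.app Y = 𝟙 Y := by
  have h : (stableFstAdj hF hproj hB).counit.app Y =
      (copresentationEquiv hF hproj hB _ Y).symm (𝟙 _) := by
    simp only [stableFstAdj, Adjunction.adjunctionOfEquivRight_counit_app]
    rfl
  rw [h]
  exact (stableFst hF hproj).map_id _

/-- The given and the chosen copresentation have the same first component and so represent the same
functor. Both inverse identities are checked after `stableFst`, where the unit becomes the identity.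
-/
lemma isIso_unit_of_isProjectiveCopresentation {W : (GP (LeftComma F)).FullSubcategory}
    (hW : IsProjectiveCopresentation F W.obj) :
    IsIso ((stableFstAdj hF hproj hB).unit.app ((toStable _).obj W)) := by
  let u := (stableFstAdj hF hproj hB).unit.app ((toStable _).obj W)
  have hu : (stableFst hF hproj).map u = 𝟙 _ := stableFst_map_unit hF hproj hB _
  obtain ⟨v, hv⟩ := (stableFst_bijective hF hproj ((stableCopresentation hF hproj hB).obj
    ((stableFst hF hproj).obj ((toStable _).obj W))) hW).2 (𝟙 ((stableFst hF hproj).obj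
      ((toStable _).obj W)))
  refine ⟨v, ?_, ?_⟩
  · apply (stableFst_bijective hF hproj _ hW).1
    refine ((stableFst hF hproj).map_comp _ _).trans
      (Eq.trans ?_ ((stableFst hF hproj).map_id _).symm)
    exact (congrArg (fun t => t ≫ _) hu).trans ((Category.id_comp _).trans hv)
  · apply (stableFst_bijective hF hproj _
      (copresentation_isProjectiveCopresentation hF hproj hB _)).1
    refine ((stableFst hF hproj).map_comp _ _).trans
      (Eq.trans ?_ ((stableFst hF hproj).map_id _).symm)
    exact (congrArg (fun t => _ ≫ t) hu).trans ((Category.comp_id _).trans hv)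

lemma isGivenByCopresentations_stableCopresentation :
    IsGivenByCopresentations F (stableCopresentation hF hproj hB) := by
  refine ⟨exists_copresentation hF hproj hB, fun W hW => hW.GP hF hproj, ⟨Iso.symm ?_⟩⟩
  refine NatIso.ofComponents (fun W => ?_) ?_
  · have := isIso_unit_of_isProjectiveCopresentation hF hproj hB
      (W := ⟨W.obj, W.property.GP hF hproj⟩) W.property
    exact @asIso _ _ _ _ _ this
  · intro W W' f
    exact (stableFstAdj hF hproj hB).unit.naturality ((toStable _).map
      (X := ⟨W.obj, W.property.GP hF hproj⟩) (Y := ⟨W'.obj, W'.property.GP hF hproj⟩)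
      (ObjectProperty.homMk f.hom))

end Copresentations


/-! ### The triangle from an embedding of the second component. -/

section Triangles

open scoped StableShift

variable {A : Type u₁} [Category.{v₁} A] [Abelian A] {B : Type u₂} [Category.{v₂} B] [Abelian B]
  {F : A ⥤ B} [F.Additive] [PreservesFiniteColimits F]

section

variable (W : LeftComma F) {P : B} (ι : W.right ⟶ P)

/-- The object `(Y, P)` obtained from `(Y, X)` and a morphism `X ⟶ P`. -/
def pushRight : LeftComma F where
  left := W.left
  right := P
  hom := str W ≫ ι

/-- The canonical morphism to `pushRight`. -/
def toPushRight : W ⟶ pushRight W ι :=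
  commaHom (𝟙 W.left) ι ((congrArg (fun t => t ≫ _) (F.map_id _)).trans (Category.id_comp _))

lemma toPushRight_naturality {P' : B} (ι' : W.right ⟶ P') (a : P ⟶ P') (h : ι ≫ a = ι') :
    F.map (𝟙 W.left) ≫ str (pushRight W ι') = str (pushRight W ι) ≫ a := by
  refine (congrArg (fun t => t ≫ str (pushRight W ι')) (F.map_id _)).trans
    ((Category.id_comp _).trans ?_)
  exact (congrArg (fun t => str W ≫ t) h.symm).trans (Category.assoc _ _ _).symm

/-- A morphism between two objects of the form `pushRight`. -/
def pushRightMap {P' : B} (ι' : W.right ⟶ P') (a : P ⟶ P') (h : ι ≫ a = ι') :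
    pushRight W ι ⟶ pushRight W ι' :=
  commaHom (𝟙 W.left) a (toPushRight_naturality W ι ι' a h)

/-- A morphism from `(0, X')` given by its second component. -/
def fromZeroLeft {X' : B} (V : LeftComma F) (a : X' ⟶ V.right) :
    (zeroLeftFunctor F).obj X' ⟶ V :=
  commaHom (W := (zeroLeftFunctor F).obj X') 0 a
    ((IsZero.of_iso (isZero_zero B) F.mapZeroObject).eq_of_src _ _)

/-- A resolution of `pushRight` when `P` is projective. -/
def pushRightSequence : ShortComplex (LeftComma F) where
  X₁ := (zeroLeftFunctor F).obj W.right
  X₂ := pushRight W (biprod.inl : W.right ⟶ W.right ⊞ P)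
  X₃ := pushRight W ι
  f := fromZeroLeft _ (biprod.lift (𝟙 W.right) ι)
  g := pushRightMap W _ ι (biprod.desc ι (-𝟙 P)) (biprod.inl_desc _ _)
  zero := by
    ext
    · exact (isZero_zero A).eq_of_src _ _
    · have h : biprod.lift (𝟙 W.right) ι ≫ biprod.desc ι (-𝟙 P) = 0 := by
        rw [biprod.lift_desc, Category.id_comp, Preadditive.comp_neg, Category.comp_id,
          add_neg_cancel]
      exact h

lemma pushRightSequence_shortExact : (pushRightSequence W ι).ShortExact := by
  refine shortExact_of_components ?_ ?_
  · exact ShortComplex.Splitting.shortExact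
      { r := 0
        s := 𝟙 W.left
        f_r := (isZero_zero A).eq_of_src _ _
        s_g := Category.comp_id (𝟙 W.left)
        id := ((congrArg (fun t => t + 𝟙 W.left ≫ 𝟙 W.left) zero_comp).trans
          (zero_add _)).trans (Category.comp_id (𝟙 W.left)) }
  · let f' : W.right ⟶ W.right ⊞ P := biprod.lift (𝟙 W.right) ι
    let g' : W.right ⊞ P ⟶ P := biprod.desc ι (-𝟙 P)
    have h₁ : f' ≫ biprod.fst = 𝟙 _ := biprod.lift_fst _ _
    have h₂ : (-biprod.inr : P ⟶ W.right ⊞ P) ≫ g' = 𝟙 _ := by simp [g']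
    have h₃ : biprod.fst ≫ f' + g' ≫ (-biprod.inr : P ⟶ W.right ⊞ P) = 𝟙 _ := by
      ext <;> simp [f', g']
    exact ShortComplex.Splitting.shortExact
      { r := (biprod.fst : W.right ⊞ P ⟶ W.right)
        s := (-biprod.inr : P ⟶ W.right ⊞ P)
        f_r := h₁
        s_g := h₂
        id := h₃ }

end

/-- The cokernel of $FY\to X\to P$ is an extension of the cokernel of $X\to P$ by that of $FY\to X$,
both Gorenstein projective. -/
lemma exists_pushRight_copresentation (hF : IsPerfect F) (hproj : F.PreservesProjectiveObjects)
    (hB : IsGorenstein B) (W : (GP (LeftComma F)).FullSubcategory) :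
    ∃ (P : B) (ι : W.obj.right ⟶ P), Projective P ∧
      IsProjectiveCopresentation F (pushRight W.obj ι) := by
  obtain ⟨P, ι, hP, hι, hG⟩ := GP.exists_embedding
    ((snd_preservesCompleteResolutions hproj hB).GP_obj W.obj W.property)
  have h₁ : Mono (str W.obj) := mono_hom_of_GP hF W.obj W.property
  let ι' : W.obj.right ⟶ P := ι
  have h₂ : Mono ι' := hι
  refine ⟨P, ι', hP, (fst_preservesCompleteResolutions hF hproj).GP_obj W.obj W.property,
    inferInstanceAs (Mono (str W.obj ≫ ι')), hP, ?_⟩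
  exact GP.of_shortExact (cokernelCompSequence_shortExact (str W.obj) ι')
    ((coker_preservesCompleteResolutions hF).GP_obj W.obj W.property) hG

/-- The middle term $U$ of `pushRightSequence` amounts to the direct sum of $W$ and the projective
$(0,P)$, so it may be replaced by $W$ stably; the morphisms of the sequence then become the counit
and `toPushRight`. -/
lemma exists_triangle_pushRight (W : (GP (LeftComma F)).FullSubcategory) {P : B} [Projective P]
    (ι : W.obj.right ⟶ P) (hV : GP (LeftComma F) (pushRight W.obj ι))
    (h₀ : GP (LeftComma F) ((zeroLeftFunctor F).obj W.obj.right)) :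
    ∃ w : (toStable _).obj ⟨_, hV⟩ ⟶ ((toStable _).obj ⟨_, h₀⟩)⟦(1 : ℤ)⟧,
      Triangle.mk ((toStable _).map (X := ⟨_, h₀⟩) (Y := W)
          (ObjectProperty.homMk ((zeroLeftAdjSnd F).counit.app W.obj)))
        ((toStable _).map (X := W) (Y := ⟨_, hV⟩)
          (ObjectProperty.homMk (toPushRight W.obj ι))) w ∈ distTriang _ := by
  have hS := pushRightSequence_shortExact W.obj ι
  have hU : GP (LeftComma F) (pushRight W.obj (biprod.inl : W.obj.right ⟶ W.obj.right ⊞ P)) :=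
    GP.of_shortExact hS h₀ hV
  let U : (GP (LeftComma F)).FullSubcategory := ⟨_, hU⟩
  let S : ShortComplex (GP (LeftComma F)).FullSubcategory :=
    { X₁ := ⟨_, h₀⟩
      X₂ := U
      X₃ := ⟨_, hV⟩
      f := ObjectProperty.homMk (pushRightSequence W.obj ι).f
      g := ObjectProperty.homMk (pushRightSequence W.obj ι).g
      zero := ObjectProperty.hom_ext _ (pushRightSequence W.obj ι).zero }
  have hS' : (S.map (GP (LeftComma F)).ι).ShortExact := hS
  have hp : F.map (𝟙 W.obj.left) ≫ str W.obj =
      str (pushRight W.obj (biprod.inl : W.obj.right ⟶ W.obj.right ⊞ P)) ≫ biprod.fst := by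
    refine (congrArg (fun t => t ≫ str W.obj) (F.map_id _)).trans
      ((Category.id_comp _).trans ?_)
    exact ((Category.assoc _ _ _).trans ((congrArg (fun t => str W.obj ≫ t)
      biprod.inl_fst).trans (Category.comp_id _))).symm
  let p : U ⟶ W := ObjectProperty.homMk (commaHom (𝟙 W.obj.left) biprod.fst hp)
  let q : W ⟶ U := ObjectProperty.homMk (toPushRight W.obj biprod.inl)
  have hqp : q ≫ p = 𝟙 W := by
    apply ObjectProperty.hom_ext
    ext
    · exact Category.comp_id (𝟙 W.obj.left)
    · exact biprod.inl_fst
  -- The difference from the identity is minus the idempotent onto the summand $(0,P)$.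
  have hpq : (toStable _).map (p ≫ q) = (toStable _).map (𝟙 U) := by
    have := projective_zeroLeft (F := F) P inferInstance
    have h : F.map (0 : W.obj.left ⟶ 0) ≫ str ((zeroLeftFunctor F).obj P) =
        str (pushRight W.obj (biprod.inl : W.obj.right ⟶ W.obj.right ⊞ P)) ≫ biprod.snd := by
      refine (comp_zero (f := F.map (0 : W.obj.left ⟶ 0))).trans ?_
      exact ((Category.assoc _ _ _).trans ((congrArg (fun t => str W.obj ≫ t)
        biprod.inl_snd).trans comp_zero)).symm
    refine toStable_map_eq_of_factor _ _
      (commaHom (W' := (zeroLeftFunctor F).obj P) 0 biprod.snd h :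
        U.obj ⟶ (zeroLeftFunctor F).obj P)
      (fromZeroLeft _ (-biprod.inr)) ?_
    ext
    · change 𝟙 W.obj.left ≫ 𝟙 W.obj.left - 𝟙 W.obj.left = 0 ≫ 0
      simp
    · change (biprod.fst : W.obj.right ⊞ P ⟶ _) ≫ biprod.inl - 𝟙 (W.obj.right ⊞ P) =
        biprod.snd ≫ (-biprod.inr)
      rw [← biprod.total, Preadditive.comp_neg]
      abel
  let e : (toStable _).obj U ≅ (toStable _).obj W :=
    { hom := (toStable _).map p
      inv := (toStable _).map q
      hom_inv_id := ((toStable _).map_comp p q).symm.trans (hpq.trans ((toStable _).map_id U))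
      inv_hom_id := ((toStable _).map_comp q p).symm.trans
        ((congrArg (toStable _).map hqp).trans ((toStable _).map_id W)) }
  have hf : S.f ≫ p = ObjectProperty.homMk ((zeroLeftAdjSnd F).counit.app W.obj) := by
    apply ObjectProperty.hom_ext
    ext
    · exact (isZero_zero A).eq_of_src _ _
    · exact biprod.lift_fst _ _
  have hg : q ≫ S.g = ObjectProperty.homMk (toPushRight W.obj ι) := by
    apply ObjectProperty.hom_ext
    ext
    · exact Category.comp_id (𝟙 W.obj.left)
    · exact biprod.inl_desc _ _
  refine ⟨connectingHom S hS', isomorphic_distinguished _ (stableTriangle_distinguished S hS') _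
    (Triangle.isoMk _ _ (Iso.refl _) e.symm (Iso.refl _) ?_ ?_ ?_)⟩
  · refine ((congrArg (fun t => t ≫ e.inv) ((congrArg (toStable _).map hf).symm.trans
      ((toStable _).map_comp _ _))).trans (Category.assoc _ _ _)).trans ?_
    exact ((congrArg (fun t => _ ≫ t) e.hom_inv_id).trans (Category.comp_id _)).trans
      (Category.id_comp _).symm
  · exact (Category.comp_id _).trans ((congrArg (toStable _).map hg).symm.trans
      ((toStable _).map_comp _ _))
  · refine ((congrArg (fun t => _ ≫ t) ((shiftFunctor _ (1 : ℤ)).map_id _)).trans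
      (Category.comp_id _)).trans (Category.id_comp _).symm

end Triangles


/-! ### Assembly of the recollement. -/

section Recollement

open scoped StableShift

variable {A : Type u₁} [Category.{v₁} A] [Abelian A] {B : Type u₂} [Category.{v₂} B] [Abelian B]
  {F : A ⥤ B} [F.Additive] [PreservesFiniteColimits F]

section

variable (hproj : F.PreservesProjectiveObjects)

/-- The functor `i_*`. -/
abbrev stableZeroLeft : StableGP B ⥤ StableGP (LeftComma F) :=
  stableMap (zeroLeftFunctor F) projective_zeroLeft
    (zeroLeft_preservesCompleteResolutions hproj).GP_obj

variable (hB : IsGorenstein B)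

/-- The functor `i^!`. -/
abbrev stableSnd : StableGP (LeftComma F) ⥤ StableGP B :=
  stableMap (Comma.snd F (𝟭 B)) (projective_snd hproj)
    (snd_preservesCompleteResolutions hproj hB).GP_obj

/-- The adjunction `(i_*, i^!)`. -/
abbrev stableZeroLeftAdj : stableZeroLeft hproj ⊣ stableSnd hproj hB :=
  stableAdjunction _ _ _ _ (zeroLeftAdjSnd F)

lemma isIso_stableZeroLeftAdj_unit : IsIso (stableZeroLeftAdj hproj hB).unit := by
  have (X : StableGP B) : IsIso ((stableZeroLeftAdj hproj hB).unit.app X) :=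
    inferInstanceAs (IsIso (𝟙 X))
  exact NatIso.isIso_of_isIso_app _

lemma stableZeroLeft_full (hB : IsGorenstein B) : (stableZeroLeft (F := F) hproj).Full :=
  have := isIso_stableZeroLeftAdj_unit (F := F) hproj hB
  (stableZeroLeftAdj hproj hB).fullyFaithfulLOfIsIsoUnit.full

lemma stableZeroLeft_faithful (hB : IsGorenstein B) : (stableZeroLeft (F := F) hproj).Faithful :=
  have := isIso_stableZeroLeftAdj_unit (F := F) hproj hB
  (stableZeroLeftAdj hproj hB).fullyFaithfulLOfIsIsoUnit.faithful

end

variable (hF : IsPerfect F)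

/-- The functor `i^*`. -/
abbrev stableCoker : StableGP (LeftComma F) ⥤ StableGP B :=
  stableMap (cokerFunctor F) projective_coker (coker_preservesCompleteResolutions hF).GP_obj

/-- The functor `j_!`. -/
abbrev stableFree : StableGP A ⥤ StableGP (LeftComma F) :=
  stableMap (freeFunctor F) projective_free (free_preservesCompleteResolutions hF).GP_obj

variable (hproj : F.PreservesProjectiveObjects)

/-- The adjunction `(i^*, i_*)`. -/
abbrev stableCokerAdj : stableCoker hF ⊣ stableZeroLeft hproj :=
  stableAdjunction _ _ _ _ (cokerAdjZeroLeft F)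

/-- The adjunction `(j_!, j^*)`. -/
abbrev stableFreeAdj : stableFree hF ⊣ stableFst hF hproj :=
  stableAdjunction _ _ _ _ (freeAdjFst F)

lemma isIso_stableFreeAdj_unit : IsIso (stableFreeAdj hF hproj).unit := by
  have (X : StableGP A) : IsIso ((stableFreeAdj hF hproj).unit.app X) :=
    inferInstanceAs (IsIso (𝟙 X))
  exact NatIso.isIso_of_isIso_app _

lemma stableFree_full (hproj : F.PreservesProjectiveObjects) : (stableFree hF).Full :=
  have := isIso_stableFreeAdj_unit hF hproj
  (stableFreeAdj hF hproj).fullyFaithfulLOfIsIsoUnit.full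

lemma stableFree_faithful (hproj : F.PreservesProjectiveObjects) : (stableFree hF).Faithful :=
  have := isIso_stableFreeAdj_unit hF hproj
  (stableFreeAdj hF hproj).fullyFaithfulLOfIsIsoUnit.faithful

lemma isZero_stableFst_stableZeroLeft (X : StableGP B) :
    IsZero ((stableFst hF hproj).obj ((stableZeroLeft hproj).obj X)) := by
  have h : IsZero (⟨0, GP_of_isZero (isZero_zero A)⟩ : (GP A).FullSubcategory) :=
    (IsZero.iff_id_eq_zero _).2 (ObjectProperty.hom_ext _ ((isZero_zero A).eq_of_src _ _))
  exact (toStable A).map_isZero h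

/-- The two morphisms of `strSequence` are by construction the counit and the unit, so its triangle
is the required one. -/
lemma exists_triangle_stableFree_stableZeroLeft (W : StableGP (LeftComma F)) :
    ∃ w : (stableZeroLeft hproj).obj ((stableCoker hF).obj W) ⟶
        ((stableFree hF).obj ((stableFst hF hproj).obj W))⟦(1 : ℤ)⟧,
      Triangle.mk ((stableFreeAdj hF hproj).counit.app W)
        ((stableCokerAdj hF hproj).unit.app W) w ∈ distTriang _ := by
  have := mono_hom_of_GP hF W.as.obj W.as.property
  let S : ShortComplex (GP (LeftComma F)).FullSubcategory :=
    { X₁ := ⟨_, (free_preservesCompleteResolutions hF).GP_obj _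
        ((fst_preservesCompleteResolutions hF hproj).GP_obj _ W.as.property)⟩
      X₂ := W.as
      X₃ := ⟨_, (zeroLeft_preservesCompleteResolutions hproj).GP_obj _
        ((coker_preservesCompleteResolutions hF).GP_obj _ W.as.property)⟩
      f := ObjectProperty.homMk (strSequence W.as.obj).f
      g := ObjectProperty.homMk (strSequence W.as.obj).g
      zero := ObjectProperty.hom_ext _ (strSequence W.as.obj).zero }
  have hS : (S.map (GP (LeftComma F)).ι).ShortExact := strSequence_shortExact W.as.obj
  exact ⟨connectingHom S hS, stableTriangle_distinguished S hS⟩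

variable (hB : IsGorenstein B)

lemma isIso_stableFstAdj_counit : IsIso (stableFstAdj hF hproj hB).counit := by
  have (Y : StableGP A) : IsIso ((stableFstAdj hF hproj hB).counit.app Y) := by
    rw [stableFstAdj_counit_app]
    exact inferInstanceAs (IsIso (𝟙 Y))
  exact NatIso.isIso_of_isIso_app _

lemma stableCopresentation_full : (stableCopresentation hF hproj hB).Full :=
  have := isIso_stableFstAdj_counit hF hproj hB
  (stableFstAdj hF hproj hB).fullyFaithfulROfIsIsoCounit.full

lemma stableCopresentation_faithful : (stableCopresentation hF hproj hB).Faithful :=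
  have := isIso_stableFstAdj_counit hF hproj hB
  (stableFstAdj hF hproj hB).fullyFaithfulROfIsIsoCounit.faithful

lemma exists_triangle_stableZeroLeft_stableCopresentation (W : StableGP (LeftComma F)) :
    ∃ w : (stableCopresentation hF hproj hB).obj ((stableFst hF hproj).obj W) ⟶
        ((stableZeroLeft hproj).obj ((stableSnd hproj hB).obj W))⟦(1 : ℤ)⟧,
      Triangle.mk ((stableZeroLeftAdj hproj hB).counit.app W)
        ((stableFstAdj hF hproj hB).unit.app W) w ∈ distTriang _ := by
  obtain ⟨P, ι, hP, hV⟩ := exists_pushRight_copresentation hF hproj hB W.as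
  obtain ⟨w, hw⟩ := exists_triangle_pushRight W.as ι (hV.GP hF hproj)
    ((zeroLeft_preservesCompleteResolutions hproj).GP_obj _
      ((snd_preservesCompleteResolutions hproj hB).GP_obj _ W.as.property))
  let V : (GP (LeftComma F)).FullSubcategory := ⟨_, hV.GP hF hproj⟩
  let v : W ⟶ (toStable _).obj V :=
    (toStable _).map (X := W.as) (ObjectProperty.homMk (toPushRight W.as.obj ι))
  have hu := isIso_unit_of_isProjectiveCopresentation hF hproj hB (W := V) hV
  let u := @asIso _ _ _ _ _ hu
  -- Since `v` is the identity on first components, naturality of the unit along `v` expresses the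
  -- unit at `W` as `v` followed by the isomorphism `u`.
  have hv : v ≫ u.hom = (stableFstAdj hF hproj hB).unit.app W := by
    refine ((stableFstAdj hF hproj hB).unit.naturality v).trans ?_
    exact (congrArg (fun t => _ ≫ t)
      ((stableCopresentation hF hproj hB).map_id ((stableFst hF hproj).obj W))).trans
        (Category.comp_id _)
  refine ⟨u.inv ≫ w, isomorphic_distinguished _ hw _
    (Triangle.isoMk _ _ (Iso.refl _) (Iso.refl _) u.symm ?_ ?_ ?_)⟩
  · exact (Category.comp_id _).trans (Category.id_comp _).symm
  · refine (congrArg (fun t => t ≫ u.inv) hv.symm).trans ((Category.assoc _ _ _).trans ?_)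
    exact ((congrArg (fun t => v ≫ t) u.hom_inv_id).trans (Category.comp_id _)).trans
      (Category.id_comp _).symm
  · exact (congrArg (fun t => _ ≫ t) ((shiftFunctor _ (1 : ℤ)).map_id _)).trans
      (Category.comp_id _)

/-- The recollement of the stable category of the left comma category. -/
def stableRecollement : Recollement (StableGP B) (StableGP (LeftComma F)) (StableGP A) :=
  letI := stableMapCommShift projective_coker (coker_preservesCompleteResolutions hF)
  letI := stableMapCommShift (φ := zeroLeftFunctor F) projective_zeroLeft
    (zeroLeft_preservesCompleteResolutions hproj)
  letI := stableMapCommShift (projective_snd hproj) (snd_preservesCompleteResolutions hproj hB)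
  letI := stableMapCommShift projective_free (free_preservesCompleteResolutions hF)
  letI := stableMapCommShift projective_fst (fst_preservesCompleteResolutions hF hproj)
  letI := (stableFstAdj hF hproj hB).rightAdjointCommShift ℤ
  { iUpperStar := stableCoker hF
    iLowerStar := stableZeroLeft hproj
    iUpperShriek := stableSnd hproj hB
    jLowerShriek := stableFree hF
    jUpperStar := stableFst hF hproj
    jLowerStar := stableCopresentation hF hproj hB
    iUpperStar_isTriangulated := stableMap_isTriangulated _ _
    iLowerStar_isTriangulated := stableMap_isTriangulated _ _
    iUpperShriek_isTriangulated := stableMap_isTriangulated _ _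
    jLowerShriek_isTriangulated := stableMap_isTriangulated _ _
    jUpperStar_isTriangulated := stableMap_isTriangulated _ _
    jLowerStar_isTriangulated :=
      have := stableMap_isTriangulated projective_fst (fst_preservesCompleteResolutions hF hproj)
      have := (stableFstAdj hF hproj hB).commShift_of_leftAdjoint ℤ
      (stableFstAdj hF hproj hB).isTriangulated_rightAdjoint
    adjUpperStarI := stableCokerAdj hF hproj
    adjShriekI := stableZeroLeftAdj hproj hB
    adjShriekJ := stableFreeAdj hF hproj
    adjUpperStarJ := stableFstAdj hF hproj hB
    iLowerStar_full := stableZeroLeft_full hproj hB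
    iLowerStar_faithful := stableZeroLeft_faithful hproj hB
    jLowerShriek_full := stableFree_full hF hproj
    jLowerShriek_faithful := stableFree_faithful hF hproj
    jLowerStar_full := stableCopresentation_full hF hproj hB
    jLowerStar_faithful := stableCopresentation_faithful hF hproj hB
    jUpperStar_iLowerStar := isZero_stableFst_stableZeroLeft hF hproj
    triangle_jShriek_iStar := exists_triangle_stableFree_stableZeroLeft hF hproj
    triangle_iShriek_jStar := exists_triangle_stableZeroLeft_stableCopresentation hF hproj hB }

end Recollement

end GorensteinComma

end

theorem theorem4p7 {A : Type u₁} [Category.{v₁} A] [Abelian A] {B : Type u₂} [Category.{v₂} B]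
    [Abelian B] (F : A ⥤ B) [F.Additive] [PreservesFiniteColimits F] (hF : IsPerfect F)
    (hproj : F.PreservesProjectiveObjects) (hB : IsGorenstein B) :
    ∃ (_ : StableTriangulation A) (_ : StableTriangulation B)
      (_ : StableTriangulation (LeftComma F))
      (R : Recollement (StableGP B) (StableGP (LeftComma F)) (StableGP A)),
      IsInducedBy R.iUpperStar (cokerFunctor F) ∧
      IsInducedBy R.iLowerStar (zeroLeftFunctor F) ∧
      IsInducedBy R.iUpperShriek (Comma.snd F (𝟭 B)) ∧
      IsInducedBy R.jLowerShriek (freeFunctor F) ∧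
      IsInducedBy R.jUpperStar (Comma.fst F (𝟭 B)) ∧
      IsGivenByCopresentations F R.jLowerStar := by
  exact ⟨stableTriangulation A, stableTriangulation B, stableTriangulation (LeftComma F),
    stableRecollement hF hproj hB,
    isInducedBy_stableMap _ projective_coker (coker_preservesCompleteResolutions hF).GP_obj,
    isInducedBy_stableMap _ projective_zeroLeft
      (zeroLeft_preservesCompleteResolutions hproj).GP_obj,
    isInducedBy_stableMap _ (projective_snd hproj)
      (snd_preservesCompleteResolutions hproj hB).GP_obj,
    isInducedBy_stableMap _ projective_free (free_preservesCompleteResolutions hF).GP_obj,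
    isInducedBy_stableMap _ projective_fst (fst_preservesCompleteResolutions hF hproj).GP_obj,
    isGivenByCopresentations_stableCopresentation hF hproj hB⟩
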